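/- **Model.** Let $d,\nu\ge 1$ be integers, $\mathbb L=\mathbb Z^d$ with the Euclidean distance $|\ell-\ell'|$, and let $\beta>0$. Let $S_\beta=\mathbb R/\beta\mathbb Z$ with Lebesgue measure and the distance $|\tau-\tau'|_\beta=\min\{|\tau-\tau'|,\beta-|\tau-\tau'|\}$, let $C_\beta=C(S_\beta\to\mathbb R^\nu)$ with the supremum norm, $L^2_\beta=L^2(S_\beta\to\mathbb R^\nu)$, and $|\omega|_{C^\sigma_\beta}=|\omega|_{C_\beta}+\sup_{\tau\ne\tau'}|\omega(\tau)-\omega(\tau')|\,|\tau-\tau'|_\beta^{-\sigma}\in[0,\infty]$. Let $\Omega=C_\beta^{\mathbb L}$ with the product topology and its Borel $\sigma$-algebra. Let $m,a>0$, and let $\chi$ be the centered Gaussian measure on $L^2_\beta$ with covariance operator $A^{-1}$, where $A=(-m\,\mathrm d^2/\mathrm d\tau^2+a)\otimes\mathbf I$, regarded as a measure on $C_\beta$. Let $J_{\ell\ell'}\in\mathbb R$ satisfy $J_{\ell\ell}=0$, $J_{\ell\ell'}=J_{\ell'\ell}$ and $\sup_\ell\sum_{\ell'}|J_{\ell\ell'}|<\infty$.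 Let $V_\ell:\mathbb R^\nu\to\mathbb R$ be continuous with $V_\ell(0)=0$, and suppose that there are $r>1$, $A_V>0$, $B_V\in\mathbb R$ and a continuous $V:\mathbb R^\nu\to\mathbb R$ with $V(0)=0$ such that $A_V|x|^{2r}+B_V\le V_\ell(x)\le V(x)$ for all $\ell$ and $x$. Assume moreover one of the following. 1. (Exponential case.) $\sup_\ell\sum_{\ell'}|J_{\ell\ell'}|e^{\alpha|\ell-\ell'|}<\infty$ for some $\alpha>0$. Let $\overline\alpha\in(0,\infty]$ be the supremum of such $\alpha$, and put $\mathcal I=(0,\overline\alpha)$ and $w_\alpha(\ell,\ell')=e^{-\alpha|\ell-\ell'|}$. 2. (Polynomial case.) Case 1 fails, but $\sup_\ell\sum_{\ell'}|J_{\ell\ell'}|(1+|\ell-\ell'|)^{\alpha d}<\infty$ for some $\alpha>1$. Let $\overline\alpha\in(1,\infty]$ be the supremum of such $\alpha$, and put $\mathcal I=(1,\overline\alpha)$ and $w_\alpha(\ell,\ell')=(1+\varepsilon|\ell-\ell'|)^{-\alpha d}$, where $\varepsilon>0$ is arbitrary. **Gibbs measures.** Let $\Omega^{\rm t}$ be the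 set of $\omega\in\Omega$ with $\sum_\ell|\omega_\ell|^2_{L^2_\beta}w_\alpha(0,\ell)<\infty$ for all $\alpha\in\mathcal I$. For non-empty finite $\Lambda\subset\mathbb L$ and $\xi\in\Omega^{\rm t}$ put $$I_\Lambda(\omega_\Lambda|\xi)=-\tfrac12\sum_{\ell,\ell'\in\Lambda}J_{\ell\ell'}(\omega_\ell,\omega_{\ell'})_{L^2_\beta}+\sum_{\ell\in\Lambda}\int_0^\beta V_\ell(\omega_\ell(\tau))\,\mathrm d\tau-\sum_{\ell\in\Lambda,\,\ell'\in\Lambda^c}J_{\ell\ell'}(\omega_\ell,\xi_{\ell'})_{L^2_\beta},$$ $$\pi_\Lambda(B|\xi)=\frac1{Z_\Lambda(\xi)}\int e^{-I_\Lambda(\omega_\Lambda|\xi)}\,\mathbb I_B(\omega_\Lambda\times\xi_{\Lambda^c})\prod_{\ell\in\Lambda}\chi(\mathrm d\omega_\ell),\qquad Z_\Lambda(\xi)=\int e^{-I_\Lambda(\omega_\Lambda|\xi)}\prod_{\ell\in\Lambda}\chi(\mathrm d\omega_\ell),$$ and $\pi_\Lambda(\cdot|\xi)=0$ for $\xi\in\Omega\setminus\Omega^{\rm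 t}$. Let $\mathcal G^{\rm t}$ be the set of Borel probability measures $\mu$ on $\Omega$ such that $\int_\Omega\pi_\Lambda(B|\omega)\,\mu(\mathrm d\omega)=\mu(B)$ for all non-empty finite $\Lambda\subset\mathbb L$ and all Borel $B\subset\Omega$. **Theorem.** For $b>0$ and $\sigma\in(0,1/2)$ let $\Xi(b,\sigma)$ be the set of all $\xi\in\Omega$ such that for every $\ell_0\in\mathbb L$ there is a finite $\Lambda_{\xi,\ell_0}\subset\mathbb L$ with $$|\xi_\ell|^2_{C^\sigma_\beta}\le b\log(1+|\ell-\ell_0|)\qquad\text{for all }\ell\notin\Lambda_{\xi,\ell_0}.$$ For every $\sigma\in(0,1/2)$ there is $b>0$, depending only on $\sigma$ and on the parameters $d,\nu,\beta,m,a,(V_\ell),(J_{\ell\ell'})$ of the model, such that $\Xi(b,\sigma)$ is a Borel set and $\mu(\Xi(b,\sigma))=1$ for all $\mu\in\mathcal G^{\rm t}$. -/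

import Mathlib

open MeasureTheory ProbabilityTheory
open scoped ENNReal NNReal RealInnerProductSpace

noncomputable section

namespace QuantumCrystal

/-! ### Lattice and loop spaces -/

/-- The lattice `ℤ^d`. -/
abbrev Lattice (d : ℕ) : Type := Fin d → ℤ

/-- The Euclidean distance `|ℓ - ℓ'|` on `ℤ^d`. -/
def latDist {d : ℕ} (l l' : Lattice d) : ℝ :=
  Real.sqrt (∑ i, ((l i : ℝ) - (l' i : ℝ)) ^ 2)

/-- The space `C_β` of continuous temperature loops `S_β → ℝ^ν`, with the supremum norm. The circle
`S_β` is `ℝ / βℤ`; the distance of `AddCircle β` is `min (|τ - τ'|) (β - |τ - τ'|)` and its volume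
is the Lebesgue measure of total mass `β`. -/
abbrev Loop (β : ℝ) (ν : ℕ) : Type := C(AddCircle β, EuclideanSpace ℝ (Fin ν))

/-- The Hilbert space `L²_β = L²(S_β → ℝ^ν, dτ)`. -/
abbrev L2Loop (β : ℝ) [Fact (0 < β)] (ν : ℕ) : Type :=
  Lp (EuclideanSpace ℝ (Fin ν)) 2 (volume : Measure (AddCircle β))

instance instMeasurableSpaceLoop (β : ℝ) (ν : ℕ) : MeasurableSpace (Loop β ν) := borel _

instance instBorelSpaceLoop (β : ℝ) (ν : ℕ) : BorelSpace (Loop β ν) := ⟨rfl⟩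

instance instMeasurableSpaceL2Loop (β : ℝ) [Fact (0 < β)] (ν : ℕ) :
    MeasurableSpace (L2Loop β ν) := borel _

instance instBorelSpaceL2Loop (β : ℝ) [Fact (0 < β)] (ν : ℕ) : BorelSpace (L2Loop β ν) := ⟨rfl⟩

/-- Configurations `Ω = (C_β)^{ℤ^d}`, with the product topology and (product = Borel) `σ`-algebra. -/
abbrev Config (d : ℕ) (β : ℝ) (ν : ℕ) : Type := Lattice d → Loop β ν

/-- Configurations in a finite set `Λ` of sites. -/
abbrev LocalConfig {d : ℕ} (Λ : Finset (Lattice d)) (β : ℝ) (ν : ℕ) : Type := Λ → Loop β ν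

section Loops

variable {β : ℝ} [Fact (0 < β)] {ν : ℕ}

/-- The embedding `C_β ↪ L²_β`. -/
def loopToL2 (β : ℝ) [Fact (0 < β)] (ν : ℕ) : Loop β ν →L[ℝ] L2Loop β ν :=
  ContinuousMap.toLp 2 (volume : Measure (AddCircle β)) ℝ

/-- The inner product `(ω, ω')` of `L²_β`, on continuous loops. -/
def l2Inner (ω ω' : Loop β ν) : ℝ := ∫ τ : AddCircle β, ⟪ω τ, ω' τ⟫

/-- The Hölder norm
`|ω|_{C_β} + sup_{τ ≠ τ'} |ω(τ) - ω(τ')| / |τ - τ'|_β^σ`, with values in `[0, ∞]`;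
it is infinite exactly when `ω` is not `σ`-Hölder. -/
def holderNorm (σ : ℝ) (ω : Loop β ν) : ℝ≥0∞ :=
  ENNReal.ofReal ‖ω‖ + ⨆ (τ : AddCircle β) (τ' : AddCircle β) (_ : τ ≠ τ'),
    ENNReal.ofReal ‖ω τ - ω τ'‖ / ENNReal.ofReal (dist τ τ' ^ σ)

end Loops

/-! ### The free measure -/

/-- The real trigonometric functions of period `β`, normalized in `L²(S_β)`: `√(1/β)` for `k = 0`,
`√(2/β) cos (2πkτ/β)` for `k > 0`, `√(2/β) sin (2πkτ/β)` for `k < 0`. -/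
def trigFun (β : ℝ) (k : ℤ) (τ : AddCircle β) : ℝ :=
  if k = 0 then Real.sqrt (1 / β)
  else if 0 < k then Real.sqrt (2 / β) * (fourier k τ).re
  else Real.sqrt (2 / β) * (fourier k τ).im

lemma continuous_trigFun (β : ℝ) (k : ℤ) : Continuous (trigFun β k) := by
  unfold trigFun
  split_ifs
  · exact continuous_const
  · exact continuous_const.mul (Complex.continuous_re.comp (fourier k).continuous)
  · exact continuous_const.mul (Complex.continuous_im.comp (fourier k).continuous)

/-- The eigenfunctions of the operator `A = (-m d²/dτ² + a) ⊗ I` in `L²(S_β → ℝ^ν)`. -/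
def eigenLoop (β : ℝ) (ν : ℕ) (p : ℤ × Fin ν) : Loop β ν :=
  ⟨fun τ => EuclideanSpace.single p.2 (trigFun β p.1 τ), by
    have h : (fun τ => EuclideanSpace.single p.2 (trigFun β p.1 τ)) =
        fun τ => trigFun β p.1 τ • (EuclideanSpace.single p.2 (1 : ℝ)) := by
      funext τ
      ext i
      simp
    rw [h]
    exact (continuous_trigFun β p.1).smul continuous_const⟩

/-- The eigenvalues `λ_k = m (2πk/β)² + a` of `A`. -/
def eigenval (m a β : ℝ) (k : ℤ) : ℝ := m * (2 * Real.pi * k / β) ^ 2 + a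

/-- The Gaussian random series `∑ λ_k^{-1/2} g_{k,i} e_{k,i}` in `L²_β`, where `e_{k,i}` are the
eigenfunctions of `A`. -/
def gaussSeries (m a β : ℝ) [Fact (0 < β)] (ν : ℕ) (g : ℤ × Fin ν → ℝ) : L2Loop β ν :=
  ∑' p : ℤ × Fin ν, (g p / Real.sqrt (eigenval m a β p.1)) • loopToL2 β ν (eigenLoop β ν p)

/-- The centered Gaussian measure on `L²_β` with covariance operator `A⁻¹`, as the law of
`∑ λ_k^{-1/2} g_{k,i} e_{k,i}` with independent standard normal `g_{k,i}`. That its Fourier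
transform is `exp (-(A⁻¹φ, φ)/2)` is proved in `charFun_freeMeasureL2`. -/
def freeMeasureL2 (m a β : ℝ) [Fact (0 < β)] (ν : ℕ) : Measure (L2Loop β ν) :=
  (Measure.infinitePi fun _ : ℤ × Fin ν => gaussianReal 0 1).map (gaussSeries m a β ν)

/-- The same Gaussian measure `χ` regarded as a measure on `C_β ⊆ L²_β`; the embedding is a
measurable embedding by `measurableEmbedding_loopToL2`. -/
def freeMeasure (m a β : ℝ) [Fact (0 < β)] (ν : ℕ) : Measure (Loop β ν) :=
  (freeMeasureL2 m a β ν).comap (loopToL2 β ν)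

/-! Facts showing that the two measures just defined are the intended ones. -/

section FreeMeasureFacts

set_option linter.unusedSimpArgs false
set_option linter.unusedSectionVars false
variable {β : ℝ} [Fact (0 < β)] {ν : ℕ}

lemma inner_loopToL2 (ω ω' : Loop β ν) :
    ⟪loopToL2 β ν ω, loopToL2 β ν ω'⟫ = l2Inner ω ω' := by
  rw [L2.inner_def]
  refine integral_congr_ae ?_
  filter_upwards [ContinuousMap.coeFn_toLp (p := 2) (𝕜 := ℝ) (volume : Measure (AddCircle β)) ω,
    ContinuousMap.coeFn_toLp (p := 2) (𝕜 := ℝ) (volume : Measure (AddCircle β)) ω'] with τ h h'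
  unfold loopToL2
  rw [h, h']

lemma integral_fourier_volume (n : ℤ) :
    ∫ τ : AddCircle β, fourier n τ = if n = 0 then (β : ℂ) else 0 := by
  have hβ : (0 : ℝ) < β := Fact.out
  split_ifs with hn
  · subst hn
    simp [Measure.real, AddCircle.measure_univ, hβ.le]
  · have h := fourier_add_half_inv_index hn hβ
    have h2 : ∫ τ : AddCircle β, fourier n τ = -∫ τ : AddCircle β, fourier n τ := by
      conv_lhs => rw [← integral_add_right_eq_self _ (↑(β / 2 / n) : AddCircle β)]
      rw [← integral_neg]
      exact integral_congr_ae (.of_forall fun τ => by simpa using h τ)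
    have h3 : (2 : ℂ) * ∫ τ : AddCircle β, fourier n τ = 0 := by linear_combination h2
    simpa using h3

lemma integral_fourier_re (n : ℤ) :
    ∫ τ : AddCircle β, (fourier n τ).re = if n = 0 then β else 0 := by
  have h := integral_re (𝕜 := ℂ) (μ := (volume : Measure (AddCircle β))) (f := fun τ => fourier n τ)
    ((fourier n).continuous.integrable_of_hasCompactSupport (HasCompactSupport.of_compactSpace _))
  have h2 : ∫ τ : AddCircle β, (fourier n τ).re = (∫ τ : AddCircle β, fourier n τ).re := h
  rw [h2, integral_fourier_volume]
  split_ifs <;> simp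

lemma integral_fourier_im (n : ℤ) : ∫ τ : AddCircle β, (fourier n τ).im = 0 := by
  have h := integral_im (𝕜 := ℂ) (μ := (volume : Measure (AddCircle β))) (f := fun τ => fourier n τ)
    ((fourier n).continuous.integrable_of_hasCompactSupport (HasCompactSupport.of_compactSpace _))
  have h2 : ∫ τ : AddCircle β, (fourier n τ).im = (∫ τ : AddCircle β, fourier n τ).im := h
  rw [h2, integral_fourier_volume]
  split_ifs <;> simp

lemma integral_trigFun_mul (k l : ℤ) :
    ∫ τ : AddCircle β, trigFun β k τ * trigFun β l τ = if k = l then 1 else 0 := by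
  have hβ : (0 : ℝ) < β := Fact.out
  have e1 : ∀ τ : AddCircle β, (fourier (k + l) τ).re =
      (fourier k τ).re * (fourier l τ).re - (fourier k τ).im * (fourier l τ).im := by
    intro τ; rw [fourier_add]; simp
  have e2 : ∀ τ : AddCircle β, (fourier (k - l) τ).re =
      (fourier k τ).re * (fourier l τ).re + (fourier k τ).im * (fourier l τ).im := by
    intro τ; rw [sub_eq_add_neg, fourier_add, fourier_neg]; simp
  have e3 : ∀ τ : AddCircle β, (fourier (k + l) τ).im =
      (fourier k τ).re * (fourier l τ).im + (fourier k τ).im * (fourier l τ).re := by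
    intro τ; rw [fourier_add]; simp
  have e4 : ∀ τ : AddCircle β, (fourier (k - l) τ).im =
      -(fourier k τ).re * (fourier l τ).im + (fourier k τ).im * (fourier l τ).re := by
    intro τ; rw [sub_eq_add_neg, fourier_add, fourier_neg]; simp
  have ire : ∀ n : ℤ, Integrable (fun τ : AddCircle β => (fourier n τ).re) := fun n =>
    (Complex.continuous_re.comp (fourier n).continuous).integrable_of_hasCompactSupport
      (HasCompactSupport.of_compactSpace _)
  have iim : ∀ n : ℤ, Integrable (fun τ : AddCircle β => (fourier n τ).im) := fun n =>
    (Complex.continuous_im.comp (fourier n).continuous).integrable_of_hasCompactSupport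
      (HasCompactSupport.of_compactSpace _)
  have s1 : Real.sqrt (1 / β) * Real.sqrt (1 / β) = 1 / β := Real.mul_self_sqrt (by positivity)
  have s2 : Real.sqrt (2 / β) * Real.sqrt (2 / β) = 2 / β := Real.mul_self_sqrt (by positivity)
  -- the general combination
  have key : ∀ (f : AddCircle β → ℝ) (x y z w : ℝ),
      (∀ τ, f τ = x * (fourier (k + l) τ).re + y * (fourier (k - l) τ).re
        + (z * (fourier (k + l) τ).im + w * (fourier (k - l) τ).im)) →
      ∫ τ, f τ = x * (if k + l = 0 then β else 0) + y * (if k - l = 0 then β else 0) := by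
    intro f x y z w hf
    rw [integral_congr_ae (.of_forall hf), integral_add, integral_add, integral_add,
      integral_const_mul, integral_const_mul, integral_const_mul, integral_const_mul,
      integral_fourier_re, integral_fourier_re, integral_fourier_im, integral_fourier_im]
    · ring
    · exact (iim _).const_mul _
    · exact (iim _).const_mul _
    · exact (ire _).const_mul _
    · exact (ire _).const_mul _
    · exact ((ire _).const_mul _).add ((ire _).const_mul _)
    · exact ((iim _).const_mul _).add ((iim _).const_mul _)
  have f0 : ∀ τ : AddCircle β, (fourier 0 τ).re = 1 := by intro τ; simp
  have f0' : ∀ τ : AddCircle β, (fourier 0 τ).im = 0 := by intro τ; simp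
  unfold trigFun
  by_cases hk : k = 0
  · by_cases hl : l = 0
    · subst hk; subst hl
      simp only [if_true, s1]
      simp [Measure.real, AddCircle.measure_univ, hβ.le, hβ.ne']
    · by_cases hl' : 0 < l
      · rw [key _ (Real.sqrt (1 / β) * Real.sqrt (2 / β)) 0 0 0 (fun τ => by
          rw [e1]; subst hk; simp [hl, hl', f0, f0', -one_div]; try ring)]
        subst hk; simp [hl, Ne.symm hl]
      · rw [key _ 0 0 (Real.sqrt (1 / β) * Real.sqrt (2 / β)) 0 (fun τ => by
          rw [e3]; subst hk; simp [hl, hl', f0, f0', -one_div]; try ring)]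
        subst hk; simp [hl, Ne.symm hl]
  · by_cases hl : l = 0
    · by_cases hk' : 0 < k
      · rw [key _ (Real.sqrt (1 / β) * Real.sqrt (2 / β)) 0 0 0 (fun τ => by
          rw [e1]; subst hl; simp [hk, hk', f0, f0', -one_div]; try ring)]
        subst hl; simp [hk]
      · rw [key _ 0 0 (Real.sqrt (1 / β) * Real.sqrt (2 / β)) 0 (fun τ => by
          rw [e3]; subst hl; simp [hk, hk', f0, f0', -one_div]; try ring)]
        subst hl; simp [hk]
    · by_cases hk' : 0 < k <;> by_cases hl' : 0 < l
      · rw [key _ (1 / β) (1 / β) 0 0 (fun τ => by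
          rw [e1, e2]; simp only [hk, hl, hk', hl', if_true, if_false]
          linear_combination (fourier k τ).re * (fourier l τ).re * s2)]
        have : k + l ≠ 0 := by omega
        simp [this, sub_eq_zero, hβ.ne']
      · rw [key _ 0 0 (1 / β) (-1 / β) (fun τ => by
          rw [e3, e4]; simp only [hk, hl, hk', hl', if_true, if_false]
          linear_combination (fourier k τ).re * (fourier l τ).im * s2)]
        have : k ≠ l := by omega
        simp [this]
      · rw [key _ 0 0 (1 / β) (1 / β) (fun τ => by
          rw [e3, e4]; simp only [hk, hl, hk', hl', if_true, if_false]
          linear_combination (fourier k τ).im * (fourier l τ).re * s2)]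
        have : k ≠ l := by omega
        simp [this]
      · rw [key _ (-1 / β) (1 / β) 0 0 (fun τ => by
          rw [e1, e2]; simp only [hk, hl, hk', hl', if_true, if_false]
          linear_combination (fourier k τ).im * (fourier l τ).im * s2)]
        have : k + l ≠ 0 := by omega
        simp [this, sub_eq_zero, hβ.ne']

lemma orthonormal_eigenLoop : Orthonormal ℝ (fun p => loopToL2 β ν (eigenLoop β ν p)) := by
  rw [orthonormal_iff_ite]
  intro p q
  rw [inner_loopToL2]
  unfold l2Inner eigenLoop
  simp only [ContinuousMap.coe_mk, EuclideanSpace.inner_single_left, conj_trivial]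
  by_cases h : p.2 = q.2
  · have : ∀ τ : AddCircle β, trigFun β p.1 τ *
        (EuclideanSpace.single q.2 (trigFun β q.1 τ)).ofLp p.2 =
        trigFun β p.1 τ * trigFun β q.1 τ := by intro τ; simp [h]
    rw [integral_congr_ae (.of_forall this), integral_trigFun_mul]
    simp [Prod.ext_iff, h]
  · simp [Prod.ext_iff, h]

lemma eigenval_pos {m a : ℝ} (hm : 0 < m) (ha : 0 < a) (k : ℤ) : 0 < eigenval m a β k := by
  unfold eigenval; positivity

lemma summable_inv_eigenval {m a : ℝ} (hm : 0 < m) (ha : 0 < a) :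
    Summable fun p : ℤ × Fin ν => (eigenval m a β p.1)⁻¹ := by
  have hβ : (0 : ℝ) < β := Fact.out
  have h1 : Summable fun k : ℤ => (eigenval m a β k)⁻¹ := by
    have h := (Real.summable_one_div_int_pow (p := 2)).2 (by norm_num)
    have hc : 0 < m * (2 * Real.pi / β) ^ 2 := by positivity
    refine Summable.of_norm_bounded_eventually
      (g := fun k : ℤ => (m * (2 * Real.pi / β) ^ 2)⁻¹ * (1 / (k : ℝ) ^ 2)) (h.mul_left _) ?_
    refine (Set.finite_singleton (0 : ℤ)).subset fun k hk => ?_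
    by_contra hk0
    refine hk ?_
    change ‖(eigenval m a β k)⁻¹‖ ≤ (m * (2 * Real.pi / β) ^ 2)⁻¹ * (1 / (k : ℝ) ^ 2)
    have hk0' : (k : ℝ) ≠ 0 := by exact_mod_cast hk0
    have hk2 : 0 < (k : ℝ) ^ 2 := by positivity
    rw [Real.norm_of_nonneg (inv_nonneg.2 (eigenval_pos hm ha k).le), one_div, ← mul_inv]
    refine inv_anti₀ (by positivity) ?_
    unfold eigenval
    have : m * (2 * Real.pi * k / β) ^ 2 = m * (2 * Real.pi / β) ^ 2 * (k : ℝ) ^ 2 := by ring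
    linarith
  have h2 : Summable fun p : ℤ × Fin ν => (eigenval m a β p.1)⁻¹ * (1 : ℝ) :=
    h1.mul_of_nonneg (g := fun _ : Fin ν => (1 : ℝ)) (Summable.of_finite)
      (fun k => inv_nonneg.2 (eigenval_pos hm ha k).le) (fun _ => zero_le_one)
  simpa using h2

lemma ae_summable_gauss {m a : ℝ} (hm : 0 < m) (ha : 0 < a) :
    ∀ᵐ g ∂(Measure.infinitePi fun _ : ℤ × Fin ν => gaussianReal 0 1),
      Summable fun p => (g p / Real.sqrt (eigenval m a β p.1)) •
        loopToL2 β ν (eigenLoop β ν p) := by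
  set P := Measure.infinitePi fun _ : ℤ × Fin ν => gaussianReal 0 1
  have hmeas : ∀ p : ℤ × Fin ν, Measurable fun g : ℤ × Fin ν → ℝ =>
      ENNReal.ofReal ((g p) ^ 2 * (eigenval m a β p.1)⁻¹) := fun p =>
    (((measurable_pi_apply p).pow_const 2).mul_const _).ennreal_ofReal
  have hint : ∫⁻ g, ∑' p, ENNReal.ofReal ((g p) ^ 2 * (eigenval m a β p.1)⁻¹) ∂P ≠ ∞ := by
    rw [lintegral_tsum (fun p => (hmeas p).aemeasurable)]
    have h1 : ∀ p : ℤ × Fin ν, ∫⁻ g, ENNReal.ofReal ((g p) ^ 2 * (eigenval m a β p.1)⁻¹) ∂P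
        = ENNReal.ofReal ((eigenval m a β p.1)⁻¹) := by
      intro p
      have hmp := measurePreserving_eval_infinitePi (fun _ : ℤ × Fin ν => gaussianReal 0 1) p
      have hcomp := hmp.lintegral_comp
        (f := fun x : ℝ => ENNReal.ofReal (x ^ 2 * (eigenval m a β p.1)⁻¹)) (by fun_prop)
      refine hcomp.trans ?_
      have hi : Integrable (fun x : ℝ => x ^ 2) (gaussianReal 0 1) :=
        (memLp_id_gaussianReal 2).integrable_sq
      have hv : ∫ x, x ^ 2 ∂(gaussianReal 0 1) = 1 := by
        have := variance_id_gaussianReal (μ := 0) (v := 1)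
        rw [variance_of_integral_eq_zero aemeasurable_id (by simp)] at this
        simpa using this
      rw [← ofReal_integral_eq_lintegral_ofReal (hi.mul_const _)
        (.of_forall fun x => mul_nonneg (sq_nonneg x) (inv_nonneg.2 (eigenval_pos hm ha p.1).le)),
        integral_mul_const, hv, one_mul]
    rw [tsum_congr h1]
    have h2 : ∀ p : ℤ × Fin ν, 0 ≤ (eigenval m a β p.1)⁻¹ := fun p =>
      inv_nonneg.2 (eigenval_pos hm ha p.1).le
    have h3 : Summable fun p : ℤ × Fin ν => (eigenval m a β p.1)⁻¹ := summable_inv_eigenval hm ha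
    rw [← ENNReal.ofReal_tsum_of_nonneg h2 h3]
    exact ENNReal.ofReal_ne_top
  have hae := ae_lt_top' (Measurable.tsum hmeas).aemeasurable hint
  filter_upwards [hae] with g hg
  have hs : Summable fun p : ℤ × Fin ν => (g p) ^ 2 * (eigenval m a β p.1)⁻¹ := by
    have h1 := ENNReal.summable_toReal hg.ne
    have h2 : (fun p : ℤ × Fin ν => (g p) ^ 2 * (eigenval m a β p.1)⁻¹) = fun p =>
        (ENNReal.ofReal ((g p) ^ 2 * (eigenval m a β p.1)⁻¹)).toReal := by
      funext p
      have h3 : 0 ≤ (g p) ^ 2 * (eigenval m a β p.1)⁻¹ :=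
        mul_nonneg (sq_nonneg _) (inv_nonneg.2 (eigenval_pos hm ha p.1).le)
      exact (ENNReal.toReal_ofReal h3).symm
    rw [h2]
    exact h1
  have ho := (orthonormal_eigenLoop (β := β) (ν := ν)).orthogonalFamily
  have hs2 : Summable fun p : ℤ × Fin ν => ‖g p / Real.sqrt (eigenval m a β p.1)‖ ^ 2 := by
    refine hs.congr fun p => ?_
    rw [Real.norm_eq_abs, sq_abs, div_pow, Real.sq_sqrt (eigenval_pos hm ha p.1).le, div_eq_mul_inv]
  have h3 := (ho.summable_iff_norm_sq_summable
    (fun p => g p / Real.sqrt (eigenval m a β p.1))).2 hs2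
  exact h3

lemma aemeasurable_gaussSeries {m a : ℝ} (hm : 0 < m) (ha : 0 < a) :
    AEMeasurable (gaussSeries m a β ν)
      (Measure.infinitePi fun _ : ℤ × Fin ν => gaussianReal 0 1) := by
  refine aemeasurable_of_tendsto_metrizable_ae (Filter.atTop : Filter (Finset (ℤ × Fin ν)))
    (f := fun s g => ∑ p ∈ s, (g p / Real.sqrt (eigenval m a β p.1)) •
        loopToL2 β ν (eigenLoop β ν p)) ?_ ?_
  · intro s
    refine Measurable.aemeasurable ?_
    have hc : Continuous fun g : ℤ × Fin ν → ℝ =>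
        ∑ p ∈ s, (g p / Real.sqrt (eigenval m a β p.1)) • loopToL2 β ν (eigenLoop β ν p) :=
      continuous_finsetSum _ fun p _ =>
        ((continuous_apply p).div_const _).smul continuous_const
    exact hc.measurable
  · filter_upwards [ae_summable_gauss (β := β) (ν := ν) hm ha] with g hg
    exact hg.hasSum

/-- The Fourier transform of `freeMeasureL2` at `φ` is `exp (-(A⁻¹ φ, φ) / 2)`, with `A⁻¹` given by
its spectral decomposition. -/
theorem charFun_freeMeasureL2 {m a : ℝ} (hm : 0 < m) (ha : 0 < a) (φ : L2Loop β ν) :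
    ∫ υ, Complex.exp (Complex.I * (⟪φ, υ⟫ : ℝ)) ∂(freeMeasureL2 m a β ν) =
      Complex.exp (-(1 / 2) * ((∑' p : ℤ × Fin ν,
        ⟪loopToL2 β ν (eigenLoop β ν p), φ⟫ ^ 2 / eigenval m a β p.1 : ℝ) : ℂ)) := by
  set P := Measure.infinitePi fun _ : ℤ × Fin ν => gaussianReal 0 1 with hP
  set e : ℤ × Fin ν → L2Loop β ν := fun p => loopToL2 β ν (eigenLoop β ν p) with he
  set c : ℤ × Fin ν → ℝ := fun p => ⟪e p, φ⟫ / Real.sqrt (eigenval m a β p.1) with hc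
  have hcsq : ∀ p, c p ^ 2 = ⟪e p, φ⟫ ^ 2 / eigenval m a β p.1 := fun p => by
    simp only [hc]
    rw [div_pow, Real.sq_sqrt (eigenval_pos hm ha p.1).le]
  have hcs : Summable fun p => c p ^ 2 := by
    have h1 := (orthonormal_eigenLoop (β := β) (ν := ν)).inner_products_summable φ
    refine Summable.of_nonneg_of_le (fun p => sq_nonneg _) (fun p => ?_) (h1.mul_left a⁻¹)
    rw [hcsq, Real.norm_eq_abs, sq_abs, div_eq_inv_mul]
    refine mul_le_mul_of_nonneg_right (inv_anti₀ ha ?_) (sq_nonneg _)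
    unfold eigenval
    have : 0 ≤ m * (2 * Real.pi * p.1 / β) ^ 2 := by positivity
    linarith
  have hfin : ∀ s : Finset (ℤ × Fin ν),
      ∫ g, Complex.exp (Complex.I * ((∑ p ∈ s, g p * c p : ℝ) : ℂ)) ∂P =
        Complex.exp (-(1 / 2) * ((∑ p ∈ s, c p ^ 2 : ℝ) : ℂ)) := by
    intro s
    have h1 := integral_restrict_infinitePi (μ := fun _ : ℤ × Fin ν => gaussianReal 0 1) (s := s)
      (f := fun y : s → ℝ => ∏ p : s, Complex.exp ((c p * y p : ℝ) * Complex.I))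
      (by
        refine Continuous.aestronglyMeasurable ?_
        fun_prop)
    have h2 : ∀ g : ℤ × Fin ν → ℝ, Complex.exp (Complex.I * ((∑ p ∈ s, g p * c p : ℝ) : ℂ)) =
        ∏ p : s, Complex.exp ((c p * s.restrict g p : ℝ) * Complex.I) := by
      intro g
      rw [← Complex.exp_sum, ← Finset.sum_coe_sort s]
      congr 1
      push_cast
      rw [Finset.mul_sum]
      refine Finset.sum_congr rfl fun p _ => ?_
      simp only [Finset.restrict]
      ring
    simp_rw [h2]
    rw [hP, h1, integral_fintype_prod_eq_prod
      (f := fun (p : s) (y : ℝ) => Complex.exp ((c p * y : ℝ) * Complex.I)),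
      ← Finset.sum_coe_sort s]
    push_cast
    rw [Finset.mul_sum, Complex.exp_sum]
    refine Finset.prod_congr rfl fun p _ => ?_
    have h3 := charFun_gaussianReal (μ := 0) (v := 1) (c p)
    rw [charFun_apply_real] at h3
    rw [h3]
    congr 1
    push_cast
    ring
  have hX := aemeasurable_gaussSeries (β := β) (ν := ν) hm ha
  have hcont : Continuous fun υ : L2Loop β ν => Complex.exp (Complex.I * (⟪φ, υ⟫ : ℝ)) := by
    fun_prop
  rw [freeMeasureL2, integral_map hX hcont.aestronglyMeasurable]
  have hlim : Filter.Tendsto (fun s : Finset (ℤ × Fin ν) =>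
      ∫ g, Complex.exp (Complex.I * ((∑ p ∈ s, g p * c p : ℝ) : ℂ)) ∂P) Filter.atTop
      (nhds (∫ g, Complex.exp (Complex.I * (⟪φ, gaussSeries m a β ν g⟫ : ℝ)) ∂P)) := by
    refine tendsto_integral_filter_of_dominated_convergence (fun _ => (1 : ℝ)) ?_ ?_
      (integrable_const _) ?_
    · refine .of_forall fun s => Continuous.aestronglyMeasurable ?_
      fun_prop
    · refine .of_forall fun s => .of_forall fun g => ?_
      rw [mul_comm, Complex.norm_exp_ofReal_mul_I]
    · filter_upwards [ae_summable_gauss (β := β) (ν := ν) hm ha] with g hg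
      have h1 := (hg.hasSum.mapL (innerSL ℝ φ))
      have h2 : HasSum (fun p => g p * c p) ⟪φ, gaussSeries m a β ν g⟫ := by
        have h4 : (fun p => g p * c p) = fun p => innerSL ℝ φ
            ((g p / Real.sqrt (eigenval m a β p.1)) • loopToL2 β ν (eigenLoop β ν p)) := by
          funext p
          simp only [innerSL_apply_apply, inner_smul_right, hc, he]
          rw [real_inner_comm]
          ring
        rw [h4]
        exact h1
      have h3 : Continuous fun x : ℝ => Complex.exp (Complex.I * (x : ℂ)) := by fun_prop
      exact (h3.tendsto _).comp h2
  have hlim2 : Filter.Tendsto (fun s : Finset (ℤ × Fin ν) =>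
      Complex.exp (-(1 / 2) * ((∑ p ∈ s, c p ^ 2 : ℝ) : ℂ))) Filter.atTop
      (nhds (Complex.exp (-(1 / 2) * ((∑' p, c p ^ 2 : ℝ) : ℂ)))) := by
    have h3 : Continuous fun x : ℝ => Complex.exp (-(1 / 2) * (x : ℂ)) := by fun_prop
    exact (h3.tendsto _).comp hcs.hasSum
  simp_rw [hfin] at hlim
  rw [tendsto_nhds_unique hlim hlim2]
  simp_rw [hcsq]
  rfl

lemma measurableEmbedding_loopToL2 : MeasurableEmbedding (loopToL2 β ν) :=
  (loopToL2 β ν).continuous.measurableEmbedding (ContinuousMap.toLp_injective _)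

end FreeMeasureFacts

/-! ### The model -/

/-- `sup_ℓ ∑_ℓ' |J_ℓℓ'| exp (α |ℓ - ℓ'|) < ∞`. -/
def ExpDecay {d : ℕ} (J : Lattice d → Lattice d → ℝ) (α : ℝ) : Prop :=
  (⨆ l, ∑' l', ‖J l l'‖ₑ * ENNReal.ofReal (Real.exp (α * latDist l l'))) < ∞

/-- `sup_ℓ ∑_ℓ' |J_ℓℓ'| (1 + |ℓ - ℓ'|)^{α d} < ∞`. -/
def PolyDecay {d : ℕ} (J : Lattice d → Lattice d → ℝ) (α : ℝ) : Prop :=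
  (⨆ l, ∑' l', ‖J l l'‖ₑ * ENNReal.ofReal ((1 + latDist l l') ^ (α * d))) < ∞

/-- The parameters of the quantum anharmonic crystal: mass `m`, rigidity `a`, self-interaction
potentials `V_ℓ`, dynamical matrix `J`, and the assumptions on them. -/
structure Model (d ν : ℕ) where
  m : ℝ
  a : ℝ
  V : Lattice d → EuclideanSpace ℝ (Fin ν) → ℝ
  J : Lattice d → Lattice d → ℝ
  m_pos : 0 < m
  a_pos : 0 < a
  J_diag : ∀ l, J l l = 0
  J_symm : ∀ l l', J l l' = J l' l
  V_continuous : ∀ l, Continuous (V l)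
  V_zero : ∀ l, V l 0 = 0
  V_bounds : ∃ (r A B : ℝ) (W : EuclideanSpace ℝ (Fin ν) → ℝ), 1 < r ∧ 0 < A ∧
    Continuous W ∧ W 0 = 0 ∧ ∀ l x, A * ‖x‖ ^ (2 * r) + B ≤ V l x ∧ V l x ≤ W x
  J_summable : (⨆ l, ∑' l', ‖J l l'‖ₑ) < ∞
  J_decay : (∃ α, 0 < α ∧ ExpDecay J α) ∨ (∃ α, 1 < α ∧ PolyDecay J α)

namespace Model

variable {d ν : ℕ} (M : Model d ν)

/-! ### Weights and tempered configurations -/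

/-- The first of the two cases for the decay of the interaction (exponential decay). In the
complementary case the decay is polynomial, by `J_decay`. -/
def IsExp : Prop := ∃ α, 0 < α ∧ ExpDecay M.J α

open Classical in
/-- The interval `𝓘`: it is `(0, ᾱ)` in the exponential and `(1, ᾱ)` in the polynomial case, `ᾱ ≤ ∞`
being the supremum of the exponents for which the respective bound holds. -/
def indexSet : Set ℝ :=
  if M.IsExp then
    {α | 0 < α ∧ (α : EReal) < sSup ((fun x : ℝ => (x : EReal)) '' {x | ExpDecay M.J x})}
  else
    {α | 1 < α ∧ (α : EReal) < sSup ((fun x : ℝ => (x : EReal)) '' {x | PolyDecay M.J x})}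

open Classical in
/-- The weights `w_α(ℓ, ℓ')`; the scale `ε > 0` enters in the polynomial case only. -/
def weight (ε α : ℝ) (l l' : Lattice d) : ℝ :=
  if M.IsExp then Real.exp (-(α * latDist l l')) else (1 + ε * latDist l l') ^ (-(α * d))

variable (β : ℝ) [Fact (0 < β)]

/-- The set `Ω^t` of tempered configurations: `∑_ℓ |ω_ℓ|²_{L²_β} w_α(0, ℓ) < ∞` for all `α ∈ 𝓘`. -/
def tempered (ε : ℝ) : Set (Config d β ν) :=
  {ω | ∀ α ∈ M.indexSet,
    (∑' l, ENNReal.ofReal (l2Inner (ω l) (ω l)) * ENNReal.ofReal (M.weight ε α 0 l)) < ∞}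

/-! ### Local Gibbs specification and tempered Gibbs measures -/

variable {β}

/-- The configuration `ω_Λ × ξ_{Λᶜ}`. -/
def glue (Λ : Finset (Lattice d)) (ω : LocalConfig Λ β ν) (ξ : Config d β ν) : Config d β ν :=
  fun l => if h : l ∈ Λ then ω ⟨l, h⟩ else ξ l

/-- The energy functional `I_Λ(ω_Λ)`. -/
def localEnergy (Λ : Finset (Lattice d)) (ω : LocalConfig Λ β ν) : ℝ :=
  -(1 / 2) * (∑ l : Λ, ∑ l' : Λ, M.J l l' * l2Inner (ω l) (ω l'))
    + ∑ l : Λ, ∫ τ : AddCircle β, M.V l (ω l τ)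

/-- The energy `I_Λ(ω_Λ | ξ)` including the interaction with `ξ` outside `Λ`; the series converges
absolutely for tempered `ξ`, the only ones for which it is used. -/
def energy (Λ : Finset (Lattice d)) (ω : LocalConfig Λ β ν) (ξ : Config d β ν) : ℝ :=
  M.localEnergy Λ ω
    - ∑ l : Λ, ∑' l' : {x : Lattice d // x ∉ Λ}, M.J l l' * l2Inner (ω l) (ξ l')

/-- The product measure `χ_Λ`. -/
def freeLocal (β : ℝ) [Fact (0 < β)] (Λ : Finset (Lattice d)) : Measure (LocalConfig Λ β ν) :=
  Measure.pi fun _ : Λ => freeMeasure M.m M.a β ν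

/-- The partition function `Z_Λ(ξ)`. -/
def partitionFn (Λ : Finset (Lattice d)) (ξ : Config d β ν) : ℝ≥0∞ :=
  ∫⁻ ω, ENNReal.ofReal (Real.exp (-M.energy Λ ω ξ)) ∂(M.freeLocal β Λ)

open Classical in
/-- The local Gibbs specification `π_Λ(B | ξ)`, which vanishes for non-tempered `ξ`. -/
def gibbsKernel (ε : ℝ) (Λ : Finset (Lattice d)) (B : Set (Config d β ν))
    (ξ : Config d β ν) : ℝ≥0∞ :=
  if ξ ∈ M.tempered β ε then
    (M.partitionFn Λ ξ)⁻¹ *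
      ∫⁻ ω, ENNReal.ofReal (Real.exp (-M.energy Λ ω ξ)) *
        B.indicator (fun _ => (1 : ℝ≥0∞)) (glue Λ ω ξ) ∂(M.freeLocal β Λ)
  else 0

variable (β)

/-- The set `𝒢^t` of tempered Euclidean Gibbs measures at inverse temperature `β`: the probability
measures on `Ω` that satisfy the Dobrushin–Lanford–Ruelle equation. -/
def temperedGibbs (ε : ℝ) : Set (Measure (Config d β ν)) :=
  {μ | IsProbabilityMeasure μ ∧ ∀ Λ : Finset (Lattice d), Λ.Nonempty →
    ∀ B : Set (Config d β ν), MeasurableSet B → ∫⁻ ω, M.gibbsKernel ε Λ B ω ∂μ = μ B}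

end Model

/-- The Lebowitz–Presutti set `Ξ(b, σ)`. -/
def lebowitzPresutti (d : ℕ) (β : ℝ) [Fact (0 < β)] (ν : ℕ) (b σ : ℝ) : Set (Config d β ν) :=
  {ξ | ∀ l₀ : Lattice d, ∃ Λ : Finset (Lattice d), ∀ l, l ∉ Λ →
    holderNorm σ (ξ l) ^ 2 ≤ ENNReal.ofReal (b * Real.log (1 + latDist l l₀))}

end QuantumCrystal

end

/-! The theorem follows, by the Borel–Cantelli lemma, from Gaussian tails
`μ (|ω_ℓ|_{C^σ} > R) ≤ C exp (-λ R²)` that are uniform in the site `ℓ` and in the tempered Gibbs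
measure `μ` (`exists_gibbs_tail`): with `b = (d + 1) / λ` the probabilities of
`|ω_ℓ|² > b log (1 + |ℓ - ℓ₀|)` are of order `(1 + |ℓ - ℓ₀|)^{-(d + 1)}` and hence summable.

For the free measure such a tail is a bound of Fernique type. The increments of the partial sums of
the Gaussian series have variance of order `|τ - τ'|^{2η}` for every `η < 1/2`, so a union bound over
the dyadic increments, combined with chaining, controls the Hölder norms of the partial sums
(`partialLoop_tail`). Hölder balls are compact in `C_β`, hence closed in `L²_β`, and the bound passes
to the limit; this also shows that the limit is continuous, so that `χ` charges a ball of `C_β`.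

For a single loop in the field of its neighbours, the superquadratic growth of `V_ℓ` absorbs any
multiple of `|ω|²`. Therefore a conditional expectation costs only a factor
`exp (C + θ ∑ |J_ℓℓ'| |ω_ℓ'|²)`, where `θ` is as small as desired (`exists_oneSiteBound`). Under
`π_Λ(· | ξ)` the quantities `n_ℓ = log ∫ exp |ω_ℓ|²` then satisfy, by Hölder's inequality,
`n_ℓ ≤ C + θ ∑_{ℓ' ∈ Λ} |J_ℓℓ'| n_ℓ' + θ ∑_{ℓ' ∉ Λ} |J_ℓℓ'| |ξ_ℓ'|²`. The weights turn `J` into a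
bounded operator on a weighted `ℓ¹` space, where for small `θ` this system is a contraction
(`IsWeight.sum_mul_le`). The resulting bound depends on `ξ` only through the tail over `Λᶜ` of a
weighted sum, finite as `ξ` is tempered; it vanishes as `Λ` exhausts the lattice, and the equation
`μ π_Λ = μ` hands the bound over to `μ`. -/

namespace QuantumCrystal

/-! ### Hölder balls and dyadic chaining -/

/-- The loops with `|ω(τ)| ≤ R` and `|ω(τ) - ω(τ')| ≤ R |τ - τ'|_β^σ`. -/
def holderBall (β : ℝ) (ν : ℕ) (σ R : ℝ) : Set (Loop β ν) :=
  {ω | (∀ τ, ‖ω τ‖ ≤ R) ∧ ∀ τ τ', ‖ω τ - ω τ'‖ ≤ R * dist τ τ' ^ σ}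

lemma isCompact_holderBall (β : ℝ) [Fact (0 < β)] (ν : ℕ) {σ : ℝ} (hσ : 0 < σ) (R : ℝ) :
    IsCompact (holderBall β ν σ R) := by
  have hmod : ∀ τ : AddCircle β,
      Filter.Tendsto (fun τ' => R * dist τ τ' ^ σ) (nhds τ) (nhds 0) := by
    intro τ
    have h : Continuous fun τ' : AddCircle β => R * dist τ τ' ^ σ :=
      continuous_const.mul ((continuous_const.dist continuous_id).rpow_const fun _ => Or.inr hσ.le)
    have := h.tendsto τ
    simpa [Real.zero_rpow hσ.ne'] using this
  refine ArzelaAscoli.isCompact_of_equicontinuous _ ?_ ?_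
  · have himg : ContinuousMap.toFun '' holderBall β ν σ R =
        {f : AddCircle β → EuclideanSpace ℝ (Fin ν) |
          (∀ τ, ‖f τ‖ ≤ R) ∧ ∀ τ τ', ‖f τ - f τ'‖ ≤ R * dist τ τ' ^ σ} := by
      ext f
      constructor
      · rintro ⟨ω, hω, rfl⟩
        exact hω
      · intro hf
        have hc : Continuous f := by
          rw [continuous_iff_continuousAt]
          intro τ
          rw [ContinuousAt, tendsto_iff_dist_tendsto_zero]
          refine squeeze_zero (fun _ => dist_nonneg) (fun τ' => ?_) (hmod τ)
          rw [dist_comm, dist_eq_norm]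
          exact hf.2 τ τ'
        exact ⟨⟨f, hc⟩, hf, rfl⟩
    rw [himg]
    refine IsCompact.of_isClosed_subset
      (isCompact_univ_pi fun _ : AddCircle β =>
        isCompact_closedBall (0 : EuclideanSpace ℝ (Fin ν)) R) ?_ ?_
    · simp only [Set.ofPred_and, Set.ofPred_forall]
      refine IsClosed.inter (isClosed_iInter fun τ => ?_)
        (isClosed_iInter fun τ => isClosed_iInter fun τ' => ?_)
      · exact isClosed_le (by fun_prop) continuous_const
      · exact isClosed_le (by fun_prop) continuous_const
    · intro f hf τ _
      simpa using hf.1 τ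
  · intro τ
    rw [Metric.equicontinuousAt_iff]
    intro ε hε
    obtain ⟨δ, hδ, h⟩ := Metric.tendsto_nhds_nhds.1 (hmod τ) ε hε
    refine ⟨δ, hδ, fun τ' hτ' ω => ?_⟩
    have h1 := h hτ'
    rw [Real.dist_0_eq_abs] at h1
    rw [dist_eq_norm]
    exact (ω.2.2 τ τ').trans_lt ((le_abs_self _).trans_lt h1)

lemma holderNorm_le_of_mem_holderBall {β : ℝ} [Fact (0 < β)] {ν : ℕ} {σ R : ℝ} (hR : 0 ≤ R)
    {ω : Loop β ν} (hω : ω ∈ holderBall β ν σ R) :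
    holderNorm σ ω ≤ ENNReal.ofReal (2 * R) := by
  have h1 : ‖ω‖ ≤ R := (ContinuousMap.norm_le _ hR).2 hω.1
  have h2 : (⨆ (τ : AddCircle β) (τ' : AddCircle β) (_ : τ ≠ τ'),
      ENNReal.ofReal ‖ω τ - ω τ'‖ / ENNReal.ofReal (dist τ τ' ^ σ)) ≤ ENNReal.ofReal R := by
    refine iSup_le fun τ => iSup_le fun τ' => iSup_le fun h => ?_
    refine ENNReal.div_le_of_le_mul ?_
    rw [← ENNReal.ofReal_mul hR]
    exact ENNReal.ofReal_le_ofReal (hω.2 τ τ')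
  calc holderNorm σ ω ≤ ENNReal.ofReal R + ENNReal.ofReal R :=
        add_le_add (ENNReal.ofReal_le_ofReal h1) h2
    _ = ENNReal.ofReal (2 * R) := by rw [← ENNReal.ofReal_add hR hR, two_mul]

/-- The constant of the dyadic chaining estimate: `1 / (1 - 2^{-σ})` sums the increments along the
binary expansion of each of two points, and `2^σ` compares their distance with a dyadic one. -/
noncomputable def chainConst (σ : ℝ) : ℝ := (1 + 2 / (1 - (2 : ℝ) ^ (-σ))) * 2 ^ σ

lemma two_rpow_neg_lt_one {σ : ℝ} (hσ : 0 < σ) : (2 : ℝ) ^ (-σ) < 1 :=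
  Real.rpow_lt_one_of_one_lt_of_neg one_lt_two (neg_lt_zero.2 hσ)

lemma chainConst_pos {σ : ℝ} (hσ : 0 < σ) : 0 < chainConst σ := by
  have := sub_pos.2 (two_rpow_neg_lt_one hσ)
  unfold chainConst
  positivity

/-- The binary expansion of `t` approximates `f t` along dyadic points. -/
lemma norm_sub_floor_le {E : Type*} [NormedAddCommGroup E] {f : ℝ → E} (hf : Continuous f)
    {K q : ℝ} (hK : 0 ≤ K) (hq0 : 0 < q) (hq : q < 1)
    (h : ∀ (n : ℕ) (j : ℤ), ‖f ((j + 1) / 2 ^ n) - f (j / 2 ^ n)‖ ≤ K * q ^ n) (t : ℝ) (n : ℕ) :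
    ‖f (⌊2 ^ n * t⌋ / 2 ^ n) - f t‖ ≤ K * q ^ n / (1 - q) := by
  have hlim : Filter.Tendsto (fun n : ℕ => (⌊(2 : ℝ) ^ n * t⌋ : ℝ) / 2 ^ n) Filter.atTop
      (nhds t) := by
    have h0 : Filter.Tendsto (fun n : ℕ => (1 / 2 : ℝ) ^ n) Filter.atTop (nhds 0) :=
      tendsto_pow_atTop_nhds_zero_of_lt_one (by norm_num) (by norm_num)
    rw [tendsto_iff_dist_tendsto_zero]
    refine squeeze_zero (fun _ => dist_nonneg) (fun k => ?_) h0
    have h2 : (0 : ℝ) < 2 ^ k := by positivity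
    have e : (⌊(2 : ℝ) ^ k * t⌋ : ℝ) / 2 ^ k - t = -(Int.fract ((2 : ℝ) ^ k * t) / 2 ^ k) := by
      rw [Int.fract]; field_simp; ring
    rw [Real.dist_eq, e, abs_neg, abs_of_nonneg (div_nonneg (Int.fract_nonneg _) h2.le),
      div_le_iff₀ h2, one_div, inv_pow, inv_mul_cancel₀ h2.ne']
    exact (Int.fract_lt_one _).le
  rw [← dist_eq_norm]
  refine dist_le_of_le_geometric_of_tendsto q K hq (fun k => ?_) ((hf.tendsto t).comp hlim) n
  have h2 : (0 : ℝ) < 2 ^ k := by positivity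
  have hpow : K * q ^ (k + 1) ≤ K * q ^ k :=
    mul_le_mul_of_nonneg_left (pow_le_pow_of_le_one hq0.le hq.le (Nat.le_succ k)) hK
  have hfl : ⌊(2 : ℝ) ^ (k + 1) * t⌋ = 2 * ⌊(2 : ℝ) ^ k * t⌋ ∨
      ⌊(2 : ℝ) ^ (k + 1) * t⌋ = 2 * ⌊(2 : ℝ) ^ k * t⌋ + 1 := by
    have a1 := Int.floor_le ((2 : ℝ) ^ k * t)
    have a2 := Int.lt_floor_add_one ((2 : ℝ) ^ k * t)
    have b1 : 2 * ⌊(2 : ℝ) ^ k * t⌋ ≤ ⌊(2 : ℝ) ^ (k + 1) * t⌋ := by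
      rw [Int.le_floor]; push_cast; rw [pow_succ]; linarith
    have b2 : ⌊(2 : ℝ) ^ (k + 1) * t⌋ < 2 * ⌊(2 : ℝ) ^ k * t⌋ + 2 := by
      rw [Int.floor_lt]; push_cast; rw [pow_succ]; linarith
    omega
  simp only [Function.comp_apply]
  rw [dist_comm, dist_eq_norm]
  have e : (⌊(2 : ℝ) ^ k * t⌋ : ℝ) / 2 ^ k = ((2 * ⌊(2 : ℝ) ^ k * t⌋ : ℤ) : ℝ) / 2 ^ (k + 1) := by
    push_cast; rw [pow_succ]; field_simp
  rw [e]
  rcases hfl with h1 | h1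
  · rw [h1, sub_self, norm_zero]; positivity
  · rw [h1]
    have := h (k + 1) (2 * ⌊(2 : ℝ) ^ k * t⌋)
    push_cast at this ⊢
    exact this.trans hpow

/-- A continuous function whose dyadic increments of level `n` are at most `K 2^{-σ n}` is
`σ`-Hölder. -/
lemma norm_sub_le_of_dyadic {E : Type*} [NormedAddCommGroup E] {f : ℝ → E} (hf : Continuous f)
    {K σ : ℝ} (hK : 0 ≤ K) (hσ : 0 < σ)
    (h : ∀ (n : ℕ) (j : ℤ), ‖f ((j + 1) / 2 ^ n) - f (j / 2 ^ n)‖ ≤ K * ((2 : ℝ) ^ (-σ)) ^ n)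
    {s t : ℝ} (hst : |s - t| ≤ 1) : ‖f s - f t‖ ≤ K * chainConst σ * |s - t| ^ σ := by
  set q : ℝ := (2 : ℝ) ^ (-σ) with hq
  have hq0 : 0 < q := by positivity
  have hq1 : q < 1 := two_rpow_neg_lt_one hσ
  wlog hle : t ≤ s generalizing s t
  · rw [norm_sub_rev, abs_sub_comm]
    exact this (by rwa [abs_sub_comm]) (le_of_not_ge hle)
  rcases hle.eq_or_lt with rfl | hlt
  · simp [Real.zero_rpow hσ.ne']
  have habs : |s - t| = s - t := abs_of_pos (sub_pos.2 hlt)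
  rw [habs] at hst ⊢
  obtain ⟨n, hn1, hn2⟩ := exists_nat_pow_near_of_lt_one (sub_pos.2 hlt) hst
    (by norm_num : (0 : ℝ) < 1 / 2) (by norm_num)
  have h2 : (0 : ℝ) < 2 ^ n := by positivity
  -- `q ^ n` is comparable to `|s - t| ^ σ`
  have hqn : q ^ n ≤ 2 ^ σ * (s - t) ^ σ := by
    have e1 : q ^ n = 2 ^ σ * ((1 / 2 : ℝ) ^ (n + 1)) ^ σ := by
      have hb : q = (1 / 2 : ℝ) ^ σ := by
        rw [hq, one_div, Real.inv_rpow (by norm_num), Real.rpow_neg (by norm_num)]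
      have hc : (2 : ℝ) ^ σ * (1 / 2 : ℝ) ^ σ = 1 := by
        rw [← Real.mul_rpow (by norm_num) (by norm_num)]; norm_num
      have hd : ((1 / 2 : ℝ) ^ (n + 1)) ^ σ = q ^ (n + 1) := by
        rw [hb, ← Real.rpow_natCast, ← Real.rpow_natCast, ← Real.rpow_mul (by norm_num),
          ← Real.rpow_mul (by norm_num), mul_comm]
      rw [hd, pow_succ]
      rw [← hb] at hc
      linear_combination -(q ^ n) * hc
    rw [e1]
    gcongr
  have hn2' : s - t ≤ 1 / 2 ^ n := by simpa [one_div, inv_pow] using hn2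
  have hfl : ⌊(2 : ℝ) ^ n * s⌋ = ⌊(2 : ℝ) ^ n * t⌋ ∨
      ⌊(2 : ℝ) ^ n * s⌋ = ⌊(2 : ℝ) ^ n * t⌋ + 1 := by
    have a1 := Int.lt_floor_add_one ((2 : ℝ) ^ n * t)
    have hm : (2 : ℝ) ^ n * t ≤ (2 : ℝ) ^ n * s := by gcongr
    have b1 : ⌊(2 : ℝ) ^ n * t⌋ ≤ ⌊(2 : ℝ) ^ n * s⌋ := Int.floor_le_floor hm
    have b2 : ⌊(2 : ℝ) ^ n * s⌋ < ⌊(2 : ℝ) ^ n * t⌋ + 2 := by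
      rw [Int.floor_lt]; push_cast
      rw [le_div_iff₀ h2] at hn2'
      nlinarith
    omega
  have hs := norm_sub_floor_le hf hK hq0 hq1 h s n
  have ht := norm_sub_floor_le hf hK hq0 hq1 h t n
  have hmid : ‖f (⌊(2 : ℝ) ^ n * s⌋ / 2 ^ n) - f (⌊(2 : ℝ) ^ n * t⌋ / 2 ^ n)‖ ≤ K * q ^ n := by
    rcases hfl with h1 | h1
    · rw [h1, sub_self, norm_zero]; positivity
    · rw [h1]; have := h n ⌊(2 : ℝ) ^ n * t⌋; push_cast; exact this
  have htri : ‖f s - f t‖ ≤ K * q ^ n / (1 - q) + K * q ^ n + K * q ^ n / (1 - q) := by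
    have e : f s - f t = -(f (⌊(2 : ℝ) ^ n * s⌋ / 2 ^ n) - f s)
        + (f (⌊(2 : ℝ) ^ n * s⌋ / 2 ^ n) - f (⌊(2 : ℝ) ^ n * t⌋ / 2 ^ n))
        + (f (⌊(2 : ℝ) ^ n * t⌋ / 2 ^ n) - f t) := by abel
    rw [e]
    refine (norm_add₃_le).trans ?_
    rw [norm_neg]
    gcongr
  have h1q : 0 < 1 - q := sub_pos.2 hq1
  calc ‖f s - f t‖ ≤ K * (1 + 2 / (1 - q)) * q ^ n := by
        refine htri.trans (le_of_eq ?_); ring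
    _ ≤ K * (1 + 2 / (1 - q)) * (2 ^ σ * (s - t) ^ σ) := by gcongr
    _ = K * chainConst σ * (s - t) ^ σ := by rw [chainConst, ← hq]; ring

lemma norm_le_sum_abs {ν : ℕ} (x : EuclideanSpace ℝ (Fin ν)) : ‖x‖ ≤ ∑ i, |x i| := by
  have h := (EuclideanSpace.basisFun (Fin ν) ℝ).sum_repr x
  conv_lhs => rw [← h]
  refine (norm_sum_le _ _).trans (Finset.sum_le_sum fun i _ => ?_)
  simp [norm_smul]

/-- The points `β j / 2^n` of the circle. -/
noncomputable def dyadicPt (β : ℝ) (n : ℕ) (j : ℤ) : AddCircle β := ((β * (j / 2 ^ n) : ℝ) : AddCircle β)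

/-- A Hölder criterion on the circle: it suffices to control the coordinates at `0` and the
coordinates of the finitely many dyadic increments of each level. -/
lemma mem_holderBall_of_dyadic {β : ℝ} [Fact (0 < β)] {ν : ℕ} {σ K : ℝ} (hσ : 0 < σ) (hK : 0 ≤ K)
    {ω : Loop β ν} (h0 : ∀ i, |ω 0 i| ≤ K)
    (h : ∀ (n j : ℕ) (i : Fin ν), j < 2 ^ n →
      |ω (dyadicPt β n (j + 1)) i - ω (dyadicPt β n j) i| ≤ K * ((2 : ℝ) ^ (-σ)) ^ n) :
    ω ∈ holderBall β ν σ (ν * (1 + chainConst σ) * (1 + β ^ (-σ)) * K) := by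
  have hβ : (0 : ℝ) < β := Fact.out
  have hc := chainConst_pos hσ
  set f : ℝ → EuclideanSpace ℝ (Fin ν) := fun t => ω ((β * t : ℝ) : AddCircle β) with hf
  have hfc : Continuous f :=
    ω.continuous.comp ((AddCircle.continuous_mk' β).comp (continuous_const.mul continuous_id))
  have hper : Function.Periodic f 1 := by
    intro t
    simp only [hf]
    rw [mul_add, mul_one, AddCircle.coe_add_period]
  have hd : ∀ (n : ℕ) (j : ℤ),
      ‖f ((j + 1) / 2 ^ n) - f (j / 2 ^ n)‖ ≤ (ν * K) * ((2 : ℝ) ^ (-σ)) ^ n := by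
    intro n j
    have h2 : (0 : ℤ) < 2 ^ n := by positivity
    obtain ⟨k, hk⟩ := Int.eq_ofNat_of_zero_le (Int.emod_nonneg j h2.ne')
    have hk2 : k < 2 ^ n := by
      have := Int.emod_lt_of_pos j h2
      rw [hk] at this
      exact_mod_cast this
    have hj : (j : ℝ) = k + 2 ^ n * (j / 2 ^ n : ℤ) := by
      have := Int.emod_add_mul_ediv j (2 ^ n)
      rw [hk] at this
      exact_mod_cast this.symm
    have e1 : f (j / 2 ^ n) = f (k / 2 ^ n) := by
      rw [hj, add_div, mul_div_cancel_left₀ _ (by positivity)]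
      simpa using hper.int_mul (j / 2 ^ n : ℤ) (k / 2 ^ n)
    have e2 : f ((j + 1) / 2 ^ n) = f ((k + 1) / 2 ^ n) := by
      rw [hj, show (k : ℝ) + 2 ^ n * (j / 2 ^ n : ℤ) + 1 = (k + 1) + 2 ^ n * (j / 2 ^ n : ℤ) by ring,
        add_div, mul_div_cancel_left₀ _ (by positivity)]
      simpa using hper.int_mul (j / 2 ^ n : ℤ) ((k + 1) / 2 ^ n)
    rw [e1, e2]
    refine (norm_le_sum_abs _).trans ?_
    calc ∑ i, |(f ((k + 1) / 2 ^ n) - f (k / 2 ^ n)) i| ≤ ∑ _i : Fin ν, K * ((2 : ℝ) ^ (-σ)) ^ n :=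
          Finset.sum_le_sum fun i _ => by
            have := h n k i hk2
            simpa [hf, dyadicPt] using this
      _ = _ := by simp; ring
  have hkey : ∀ s t : ℝ, |s - t| ≤ 1 → ‖f s - f t‖ ≤ ν * K * chainConst σ * |s - t| ^ σ :=
    fun s t hst => norm_sub_le_of_dyadic hfc (by positivity) hσ hd hst
  -- representatives of two points of the circle at the right distance
  have hrep : ∀ τ τ' : AddCircle β, ∃ s t : ℝ, ω τ = f s ∧ ω τ' = f t ∧ |s - t| ≤ 1 ∧
      dist τ τ' = β * |s - t| := by
    intro τ τ'
    obtain ⟨x, rfl⟩ := QuotientAddGroup.mk_surjective τ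
    obtain ⟨y, rfl⟩ := QuotientAddGroup.mk_surjective τ'
    have hn : dist (x : AddCircle β) (y : AddCircle β) =
        |x - y - round (β⁻¹ * (x - y)) * β| := by
      rw [dist_eq_norm, ← AddCircle.coe_sub, AddCircle.norm_eq]
    set r : ℤ := round (β⁻¹ * (x - y)) with hr
    have hst : (x / β - r) - y / β = β⁻¹ * (x - y - r * β) := by field_simp; ring
    have hd2 : dist (x : AddCircle β) (y : AddCircle β) ≤ β := by
      rw [dist_eq_norm]
      have := AddCircle.norm_le_half_period β (x := (x : AddCircle β) - y) hβ.ne'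
      rw [abs_of_pos hβ] at this
      linarith
    refine ⟨x / β - r, y / β, ?_, ?_, ?_, ?_⟩
    · have := hper.int_mul r (x / β - r)
      simp only [mul_one, sub_add_cancel] at this
      rw [← this]
      simp only [hf, mul_div_cancel₀ _ hβ.ne']
    · simp only [hf, mul_div_cancel₀ _ hβ.ne']
    · rw [hst, abs_mul, ← hn, abs_of_pos (inv_pos.2 hβ), inv_mul_le_iff₀ hβ, mul_one]
      exact hd2
    · rw [hst, abs_mul, abs_of_pos (inv_pos.2 hβ), mul_inv_cancel_left₀ hβ.ne']
      exact hn
  have hβσ : 0 < β ^ (-σ) := by positivity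
  constructor
  · intro τ
    obtain ⟨s, t, hs, ht, hst, -⟩ := hrep τ 0
    have h1 : ‖ω (0 : AddCircle β)‖ ≤ ν * K := by
      refine (norm_le_sum_abs _).trans ?_
      calc ∑ i, |ω 0 i| ≤ ∑ _i : Fin ν, K := Finset.sum_le_sum fun i _ => h0 i
        _ = _ := by simp
    have h2 : ‖ω τ - ω 0‖ ≤ ν * K * chainConst σ := by
      rw [hs, ht]
      refine (hkey s t hst).trans ?_
      have := Real.rpow_le_one (abs_nonneg (s - t)) hst hσ.le
      exact mul_le_of_le_one_right (by positivity) this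
    calc ‖ω τ‖ ≤ ‖ω 0‖ + ‖ω τ - ω 0‖ := by
          have := norm_add_le (ω 0) (ω τ - ω 0); rwa [add_sub_cancel] at this
      _ ≤ ν * K + ν * K * chainConst σ := add_le_add h1 h2
      _ = ν * (1 + chainConst σ) * 1 * K := by ring
      _ ≤ _ := by gcongr; linarith
  · intro τ τ'
    obtain ⟨s, t, hs, ht, hst, hdist⟩ := hrep τ τ'
    rw [hs, ht, hdist, Real.mul_rpow hβ.le (abs_nonneg _)]
    refine (hkey s t hst).trans ?_
    have e : β ^ (-σ) * β ^ σ = 1 := by rw [← Real.rpow_add hβ]; simp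
    have hp : 0 ≤ |s - t| ^ σ := by positivity
    calc ν * K * chainConst σ * |s - t| ^ σ
        ≤ ν * (1 + chainConst σ) * (β ^ (-σ)) * K * (β ^ σ * |s - t| ^ σ) := by
          have e2 : ν * (1 + chainConst σ) * (β ^ (-σ)) * K * (β ^ σ * |s - t| ^ σ) =
            ν * K * (1 + chainConst σ) * |s - t| ^ σ := by
              linear_combination (ν * (1 + chainConst σ) * K * |s - t| ^ σ) * e
          rw [e2]
          gcongr
          linarith
      _ ≤ _ := by gcongr; linarith

/-! ### Gaussian tails of the free loop -/

/-- Gaussian tail of a finite linear combination of independent standard normal variables. -/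
lemma measure_lt_abs_sum_gaussian_le {ι : Type*} (s : Finset ι) (c : ι → ℝ) {v : ℝ} (hv : 0 < v)
    (hc : ∑ p ∈ s, c p ^ 2 ≤ v) {r : ℝ} (hr : 0 ≤ r) :
    (Measure.infinitePi fun _ : ι => gaussianReal 0 1) {g | r < |∑ p ∈ s, c p * g p|} ≤
      ENNReal.ofReal (2 * Real.exp (-(r ^ 2 / (2 * v)))) := by
  set P := Measure.infinitePi fun _ : ι => gaussianReal 0 1 with hP
  have h1 : ∀ p : ι, HasSubgaussianMGF (fun g : ι → ℝ => g p) 1 P := by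
    intro p
    have hmap : Measure.map (fun g : ι → ℝ => g p) P = gaussianReal 0 1 :=
      (measurePreserving_eval_infinitePi (fun _ : ι => gaussianReal 0 1) p).map_eq
    refine ⟨fun t => ?_, fun t => ?_⟩
    · have := (integrable_exp_mul_gaussianReal (μ := 0) (v := 1) t)
      rw [← hmap] at this
      exact this.comp_measurable (measurable_pi_apply p)
    · rw [mgf_gaussianReal hmap]; simp
  have hind : iIndepFun (fun (p : ι) (g : ι → ℝ) => c p * g p) P :=
    iIndepFun_infinitePi (P := fun _ : ι => gaussianReal 0 1) (X := fun p (x : ℝ) => c p * x)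
      (fun p => by fun_prop)
  have hsum := HasSubgaussianMGF.sum_of_iIndepFun hind (s := s)
    (fun p _ => (h1 p).const_mul (c p))
  have hle : ∀ {Y : (ι → ℝ) → ℝ} {w : ℝ≥0}, HasSubgaussianMGF Y w P → (w : ℝ) ≤ v →
      P {g | r ≤ Y g} ≤ ENNReal.ofReal (Real.exp (-(r ^ 2 / (2 * v)))) := by
    intro Y w hY hw
    have h3 : HasSubgaussianMGF Y ⟨v, hv.le⟩ P :=
      ⟨hY.integrable_exp_mul, fun t => (hY.mgf_le t).trans (Real.exp_le_exp.2 (by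
        have := mul_le_mul_of_nonneg_right hw (sq_nonneg t)
        change (w : ℝ) * t ^ 2 / 2 ≤ v * t ^ 2 / 2
        linarith))⟩
    have h4 := h3.measure_ge_le hr
    rw [← ofReal_measureReal]
    refine ENNReal.ofReal_le_ofReal (h4.trans (le_of_eq ?_))
    rw [neg_div]
    rfl
  have hw : ((∑ p ∈ s, (⟨c p ^ 2, sq_nonneg _⟩ * 1 : ℝ≥0) : ℝ≥0) : ℝ) ≤ v := by
    rw [NNReal.coe_sum]
    exact (Finset.sum_congr rfl fun p _ => mul_one (c p ^ 2)).trans_le hc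
  have hsub : {g : ι → ℝ | r < |∑ p ∈ s, c p * g p|} ⊆
      {g | r ≤ ∑ p ∈ s, c p * g p} ∪ {g | r ≤ -∑ p ∈ s, c p * g p} := by
    intro g hg
    have hg' : r < |∑ p ∈ s, c p * g p| := hg
    rcases lt_abs.1 hg' with h | h
    · exact Or.inl h.le
    · exact Or.inr h.le
  calc P {g | r < |∑ p ∈ s, c p * g p|} ≤ _ := measure_mono hsub
    _ ≤ _ := measure_union_le _ _
    _ ≤ ENNReal.ofReal (Real.exp (-(r ^ 2 / (2 * v)))) +
        ENNReal.ofReal (Real.exp (-(r ^ 2 / (2 * v)))) :=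
      add_le_add (hle hsum hw) (hle hsum.neg hw)
    _ = _ := by rw [← ENNReal.ofReal_add (by positivity) (by positivity), ← two_mul]

lemma min_two_le_rpow {u η : ℝ} (hu : 0 ≤ u) (hη : 0 < η) (hη1 : η ≤ 1) : min 2 u ≤ 2 * u ^ η := by
  rcases le_total u 1 with h | h
  · have h1 : u ^ (1 : ℝ) ≤ u ^ η := by
      rcases hu.eq_or_lt with rfl | hu'
      · simp [Real.zero_rpow hη.ne']
      · exact Real.rpow_le_rpow_of_exponent_ge hu' h hη1
    rw [Real.rpow_one] at h1
    have : 0 ≤ u ^ η := by positivity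
    exact (min_le_right _ _).trans (by linarith)
  · have h1 : 1 ≤ u ^ η := Real.one_le_rpow h hη.le
    exact (min_le_left _ _).trans (by linarith)

/-- The Hölder continuity of the trigonometric functions, with explicit dependence on the
frequency. -/
lemma abs_trigFun_sub_le {β : ℝ} [Fact (0 < β)] (k : ℤ) (x y : ℝ) {η : ℝ} (hη : 0 < η)
    (hη1 : η ≤ 1) :
    |trigFun β k (x : AddCircle β) - trigFun β k (y : AddCircle β)| ≤
      Real.sqrt (2 / β) * (2 * (2 * Real.pi * |(k : ℝ)| * (|x - y| / β)) ^ η) := by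
  have hβ : (0 : ℝ) < β := Fact.out
  set u : ℝ := 2 * Real.pi * |(k : ℝ)| * (|x - y| / β) with hu
  have hu0 : 0 ≤ u := by positivity
  have hF : ‖fourier k (x : AddCircle β) - fourier k (y : AddCircle β)‖ ≤ 2 * u ^ η := by
    refine le_trans (le_min ?_ ?_) (min_two_le_rpow hu0 hη hη1)
    · refine (norm_sub_le _ _).trans ?_
      have : ∀ z : AddCircle β, ‖fourier k z‖ = 1 := fun z => by
        rw [fourier_apply]; exact Circle.norm_coe _
      rw [this, this]; norm_num
    · have e : fourier k (x : AddCircle β) - fourier k (y : AddCircle β) =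
          fourier k (y : AddCircle β) *
            (Complex.exp (.I * ((2 * Real.pi * k * ((x - y) / β) : ℝ) : ℂ)) - 1) := by
        rw [fourier_coe_apply, fourier_coe_apply, mul_sub, ← Complex.exp_add, mul_one]
        congr 2
        push_cast
        ring
      have hn : ‖fourier k (y : AddCircle β)‖ = 1 := by
        rw [fourier_apply]; exact Circle.norm_coe _
      rw [e, norm_mul, hn, one_mul]
      refine Real.norm_exp_I_mul_ofReal_sub_one_le.trans (le_of_eq ?_)
      rw [Real.norm_eq_abs, abs_mul, abs_mul, abs_div, abs_of_pos hβ,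
        abs_of_pos (by positivity : 0 < 2 * Real.pi)]
  have hs : 0 ≤ Real.sqrt (2 / β) := Real.sqrt_nonneg _
  unfold trigFun
  split_ifs with h0 h1
  · rw [sub_self, abs_zero]; positivity
  · rw [← mul_sub, abs_mul, abs_of_nonneg hs, ← Complex.sub_re]
    exact mul_le_mul_of_nonneg_left ((Complex.abs_re_le_norm _).trans hF) hs
  · rw [← mul_sub, abs_mul, abs_of_nonneg hs, ← Complex.sub_im]
    exact mul_le_mul_of_nonneg_left ((Complex.abs_im_le_norm _).trans hF) hs

lemma trigFun_sq_le {β : ℝ} [Fact (0 < β)] (k : ℤ) (τ : AddCircle β) :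
    trigFun β k τ ^ 2 ≤ 2 / β := by
  have hβ : (0 : ℝ) < β := Fact.out
  have hn : ‖fourier k τ‖ = 1 := by rw [fourier_apply]; exact Circle.norm_coe _
  have hre : (fourier k τ).re ^ 2 ≤ 1 := by
    have := Complex.abs_re_le_norm (fourier k τ)
    rw [hn] at this
    rw [← sq_abs]; exact pow_le_one₀ (abs_nonneg _) this
  have him : (fourier k τ).im ^ 2 ≤ 1 := by
    have := Complex.abs_im_le_norm (fourier k τ)
    rw [hn] at this
    rw [← sq_abs]; exact pow_le_one₀ (abs_nonneg _) this
  have h2 : 0 < 2 / β := by positivity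
  unfold trigFun
  split_ifs
  · rw [Real.sq_sqrt (by positivity)]; gcongr; norm_num
  · rw [mul_pow, Real.sq_sqrt h2.le]; nlinarith
  · rw [mul_pow, Real.sq_sqrt h2.le]; nlinarith

/-- The variance series of the increments of the free loop converges for `η < 1/2`. -/
lemma summable_rpow_div_eigenval {β : ℝ} [Fact (0 < β)] {ν : ℕ} {m a : ℝ} (hm : 0 < m) (ha : 0 < a)
    {η : ℝ} (hη : 0 < η) (hη2 : η < 1 / 2) :
    Summable fun p : ℤ × Fin ν => ((2 * Real.pi * |(p.1 : ℝ)|) ^ η) ^ 2 / eigenval m a β p.1 := by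
  have hβ : (0 : ℝ) < β := Fact.out
  have h1 : Summable fun k : ℤ => ((2 * Real.pi * |(k : ℝ)|) ^ η) ^ 2 / eigenval m a β k := by
    have hs := (Real.summable_abs_int_rpow (b := 2 - 2 * η) (by linarith)).mul_left
      (((2 * Real.pi) ^ η) ^ 2 * (m * (2 * Real.pi / β) ^ 2)⁻¹)
    refine Summable.of_nonneg_of_le (fun k => div_nonneg (sq_nonneg _) (eigenval_pos hm ha k).le)
      (fun k => ?_) hs
    by_cases hk : k = 0
    · subst hk
      simp only [Int.cast_zero, abs_zero, mul_zero, Real.zero_rpow hη.ne']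
      have h2 : (-(2 - 2 * η)) ≠ 0 := by linarith
      rw [Real.zero_rpow h2]
      simp
    · have hk' : 0 < |(k : ℝ)| := abs_pos.2 (by exact_mod_cast hk)
      have he : m * (2 * Real.pi / β) ^ 2 * |(k : ℝ)| ^ 2 ≤ eigenval m a β k := by
        have : m * (2 * Real.pi / β) ^ 2 * |(k : ℝ)| ^ 2 = m * (2 * Real.pi * k / β) ^ 2 := by
          rw [sq_abs]; ring
        unfold eigenval
        linarith
      have e3 : |(k : ℝ)| ^ (-(2 - 2 * η)) = (|(k : ℝ)| ^ η) ^ 2 / |(k : ℝ)| ^ 2 := by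
        rw [neg_sub, Real.rpow_sub hk', mul_comm, Real.rpow_mul hk'.le]
        norm_num [Real.rpow_two]
      rw [e3, Real.mul_rpow (by positivity) hk'.le]
      calc _ ≤ ((2 * Real.pi) ^ η * |(k : ℝ)| ^ η) ^ 2 /
            (m * (2 * Real.pi / β) ^ 2 * |(k : ℝ)| ^ 2) := by gcongr
        _ = _ := by field_simp
  have h2 := h1.mul_of_nonneg (g := fun _ : Fin ν => (1 : ℝ)) (Summable.of_finite)
      (fun k => div_nonneg (sq_nonneg _) (eigenval_pos hm ha k).le) (fun _ => zero_le_one)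
  simpa using h2

/-- The partial sums of the Gaussian series, as continuous loops. -/
noncomputable def partialLoop (m a β : ℝ) (ν : ℕ) (s : Finset (ℤ × Fin ν)) (g : ℤ × Fin ν → ℝ) :
    Loop β ν :=
  ∑ p ∈ s, (g p / Real.sqrt (eigenval m a β p.1)) • eigenLoop β ν p

lemma partialLoop_apply (m a β : ℝ) {ν : ℕ} (s : Finset (ℤ × Fin ν)) (g : ℤ × Fin ν → ℝ)
    (τ : AddCircle β) (i : Fin ν) : partialLoop m a β ν s g τ i =
      ∑ p ∈ s, (if p.2 = i then trigFun β p.1 τ else 0) / Real.sqrt (eigenval m a β p.1) * g p := by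
  unfold partialLoop
  rw [ContinuousMap.sum_apply, WithLp.ofLp_sum, Finset.sum_apply]
  refine Finset.sum_congr rfl fun p _ => ?_
  simp only [ContinuousMap.smul_apply, PiLp.smul_apply, eigenLoop, ContinuousMap.coe_mk,
    smul_eq_mul, PiLp.single_apply]
  by_cases h : p.2 = i
  · simp [h]; ring
  · simp [h, Ne.symm h]

/-- The series of the union bound for the dyadic increments converges. -/
lemma summable_two_pow_mul_exp {b ρ : ℝ} (hb : 0 < b) (hρ : 1 < ρ) :
    Summable fun n : ℕ => (2 : ℝ) ^ n * Real.exp (-(b * ρ ^ n)) := by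
  obtain ⟨N, hN⟩ := pow_unbounded_of_one_lt 2 hρ
  have hρ0 : 0 < ρ := by linarith
  have hg : Summable fun n : ℕ => (N.factorial / b ^ N : ℝ) * (2 / ρ ^ N) ^ n :=
    (summable_geometric_of_lt_one (by positivity) ((div_lt_one (by positivity)).2 hN)).mul_left _
  refine Summable.of_nonneg_of_le (fun n => by positivity) (fun n => ?_) hg
  have hx : 0 < b * ρ ^ n := by positivity
  have h1 := Real.pow_div_factorial_le_exp (b * ρ ^ n) hx.le N
  have h2 : Real.exp (-(b * ρ ^ n)) ≤ N.factorial / (b * ρ ^ n) ^ N := by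
    rw [Real.exp_neg, ← inv_div]
    exact inv_anti₀ (by positivity) h1
  calc (2 : ℝ) ^ n * Real.exp (-(b * ρ ^ n)) ≤ 2 ^ n * (N.factorial / (b * ρ ^ n) ^ N) := by gcongr
    _ = _ := by rw [mul_pow, div_pow, ← pow_mul, ← pow_mul, mul_comm n N]; field_simp

/-- Fernique-type bound, uniform over the partial sums of the Gaussian series. -/
lemma partialLoop_tail {β : ℝ} [Fact (0 < β)] {ν : ℕ} (hν : 0 < ν) {m a : ℝ} (hm : 0 < m)
    (ha : 0 < a) {σ : ℝ} (hσ : σ ∈ Set.Ioo (0 : ℝ) (1 / 2)) :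
    ∃ C lam : ℝ, 0 < C ∧ 0 < lam ∧ ∀ (s : Finset (ℤ × Fin ν)) (R : ℝ), 0 ≤ R →
      (Measure.infinitePi fun _ : ℤ × Fin ν => gaussianReal 0 1)
        {g | partialLoop m a β ν s g ∉ holderBall β ν σ R} ≤
        ENNReal.ofReal (C * Real.exp (-(lam * R ^ 2))) := by
  have hβ : (0 : ℝ) < β := Fact.out
  obtain ⟨hσ0, hσ2⟩ := hσ
  set P := Measure.infinitePi fun _ : ℤ × Fin ν => gaussianReal 0 1 with hP
  -- an intermediate exponent between `σ` and `1/2`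
  set η : ℝ := (σ + 1 / 2) / 2 with hη
  have hη0 : 0 < η := by linarith
  have hη2 : η < 1 / 2 := by linarith
  have hση : σ < η := by linarith
  set S1 : ℝ := ∑' p : ℤ × Fin ν, ((2 * Real.pi * |(p.1 : ℝ)|) ^ η) ^ 2 / eigenval m a β p.1
    with hS1
  set S0 : ℝ := ∑' p : ℤ × Fin ν, (eigenval m a β p.1)⁻¹ with hS0
  have hsum1 := summable_rpow_div_eigenval (β := β) (ν := ν) hm ha hη0 hη2
  have hsum0 := summable_inv_eigenval (β := β) (ν := ν) hm ha
  have hS1' : 0 ≤ S1 := tsum_nonneg fun p => div_nonneg (sq_nonneg _) (eigenval_pos hm ha _).le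
  have hS0' : 0 ≤ S0 := tsum_nonneg fun p => inv_nonneg.2 (eigenval_pos hm ha _).le
  set v : ℝ := 8 / β * (S1 + S0) + 1 with hv
  have hv0 : 0 < v := by positivity
  set qσ : ℝ := (2 : ℝ) ^ (-σ) with hqσ
  set qη : ℝ := (2 : ℝ) ^ (-η) with hqη
  have hqσ0 : 0 < qσ := by positivity
  have hqη0 : 0 < qη := by positivity
  have hlt : qη < qσ := Real.rpow_lt_rpow_of_exponent_lt one_lt_two (by linarith)
  set ρ : ℝ := (qσ / qη) ^ 2 with hρ
  have hρ1 : 1 < ρ := one_lt_pow₀ ((one_lt_div hqη0).2 hlt) two_ne_zero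
  set b : ℝ := 1 / (2 * v) with hb
  have hb0 : 0 < b := by positivity
  have hsum := summable_two_pow_mul_exp hb0 hρ1
  set S : ℝ := ∑' n : ℕ, (2 : ℝ) ^ n * Real.exp (-(b * ρ ^ n)) with hS
  have hS' : 0 ≤ S := tsum_nonneg fun n => by positivity
  set c : ℝ := ν * (1 + chainConst σ) * (1 + β ^ (-σ)) with hcdef
  have hc0 : 0 < c := by have := chainConst_pos hσ0; positivity
  -- tails of the value at `0`
  have tail0 : ∀ (s : Finset (ℤ × Fin ν)) (i : Fin ν) (K : ℝ), 0 ≤ K →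
      P {g | K < |partialLoop m a β ν s g 0 i|} ≤
        ENNReal.ofReal (2 * Real.exp (-(b * K ^ 2))) := by
    intro s i K hK
    simp_rw [partialLoop_apply]
    have := measure_lt_abs_sum_gaussian_le s (fun p : ℤ × Fin ν =>
      (if p.2 = i then trigFun β p.1 0 else 0) / Real.sqrt (eigenval m a β p.1)) hv0 ?_ hK
    · refine this.trans (le_of_eq ?_)
      rw [hb]; congr 4; ring
    · calc _ ≤ ∑ p ∈ s, 2 / β * (eigenval m a β p.1)⁻¹ := by
            refine Finset.sum_le_sum fun p _ => ?_
            rw [div_pow, Real.sq_sqrt (eigenval_pos hm ha _).le, div_eq_mul_inv]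
            refine mul_le_mul_of_nonneg_right ?_ (inv_nonneg.2 (eigenval_pos hm ha _).le)
            split_ifs
            · exact trigFun_sq_le _ _
            · have : 0 < 2 / β := by positivity
              simpa using this.le
        _ = 2 / β * ∑ p ∈ s, (eigenval m a β p.1)⁻¹ := by rw [Finset.mul_sum]
        _ ≤ 2 / β * S0 := by
            gcongr
            exact hsum0.sum_le_tsum s fun p _ => inv_nonneg.2 (eigenval_pos hm ha _).le
        _ ≤ v := by
            have h1 : 0 ≤ 8 / β * S1 := by positivity
            have h2 : 0 ≤ 6 / β * S0 := by positivity
            have h3 : v = 2 / β * S0 + 8 / β * S1 + 6 / β * S0 + 1 := by rw [hv]; ring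
            linarith
  -- tails of the dyadic increments
  have tailD : ∀ (s : Finset (ℤ × Fin ν)) (n j : ℕ) (i : Fin ν) (K : ℝ), 0 ≤ K →
      P {g | K * qσ ^ n < |partialLoop m a β ν s g (dyadicPt β n (j + 1)) i -
          partialLoop m a β ν s g (dyadicPt β n j) i|} ≤
        ENNReal.ofReal (2 * Real.exp (-(b * K ^ 2 * ρ ^ n))) := by
    intro s n j i K hK
    simp_rw [partialLoop_apply, ← Finset.sum_sub_distrib, ← sub_mul, ← sub_div]
    have := measure_lt_abs_sum_gaussian_le (v := v * (qη ^ n) ^ 2) s (fun p : ℤ × Fin ν =>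
      ((if p.2 = i then trigFun β p.1 (dyadicPt β n (j + 1)) else 0) -
        (if p.2 = i then trigFun β p.1 (dyadicPt β n j) else 0)) /
          Real.sqrt (eigenval m a β p.1)) (by positivity) ?_
          (mul_nonneg hK (pow_nonneg hqσ0.le n))
    · refine this.trans (le_of_eq ?_)
      have e0 : ((qσ / qη) ^ 2) ^ n = (qσ ^ n) ^ 2 / (qη ^ n) ^ 2 := by
        rw [← pow_mul, mul_comm 2 n, pow_mul, div_pow, div_pow]
      have e1 : (K * qσ ^ n) ^ 2 / (2 * (v * (qη ^ n) ^ 2)) = b * K ^ 2 * ρ ^ n := by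
        rw [hb, hρ, e0]; field_simp
      rw [e1]
    · have hterm : ∀ p : ℤ × Fin ν,
          (((if p.2 = i then trigFun β p.1 (dyadicPt β n (j + 1)) else 0) -
          (if p.2 = i then trigFun β p.1 (dyadicPt β n j) else 0)) /
            Real.sqrt (eigenval m a β p.1)) ^ 2 ≤
          8 / β * (qη ^ n) ^ 2 *
            (((2 * Real.pi * |(p.1 : ℝ)|) ^ η) ^ 2 / eigenval m a β p.1) := by
        intro p
        have hE := eigenval_pos (β := β) hm ha p.1
        rw [div_pow, Real.sq_sqrt hE.le, ← mul_div_assoc]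
        refine div_le_div_of_nonneg_right ?_ hE.le
        by_cases hpi : p.2 = i
        · simp only [hpi, if_true]
          have h1 := abs_trigFun_sub_le (β := β) p.1 (β * (((j : ℤ) + 1 : ℤ) / 2 ^ n))
            (β * ((j : ℤ) / 2 ^ n)) hη0 (by linarith)
          have e1 : |β * ((((j : ℤ) + 1 : ℤ) : ℝ) / 2 ^ n) - β * (((j : ℤ) : ℝ) / 2 ^ n)| / β =
              1 / 2 ^ n := by
            rw [← mul_sub, abs_mul, abs_of_pos hβ, mul_div_cancel_left₀ _ hβ.ne']
            push_cast
            rw [← sub_div, add_sub_cancel_left, abs_of_pos (by positivity)]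
          have e2 : ((1 : ℝ) / 2 ^ n) ^ η = qη ^ n := by
            rw [hqη, one_div, Real.inv_rpow (by positivity), ← Real.rpow_natCast 2 n,
              ← Real.rpow_natCast _ n, ← Real.rpow_mul (by norm_num),
              ← Real.rpow_mul (by norm_num), ← Real.rpow_neg (by norm_num)]
            congr 1; ring
          rw [e1, Real.mul_rpow (by positivity) (by positivity), e2] at h1
          rw [← sq_abs]
          calc _ ≤ (Real.sqrt (2 / β) * (2 * ((2 * Real.pi * |(p.1 : ℝ)|) ^ η * qη ^ n))) ^ 2 :=
                pow_le_pow_left₀ (abs_nonneg _) h1 2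
            _ = _ := by
                rw [mul_pow, Real.sq_sqrt (by positivity)]; ring
        · simp only [hpi, if_false, sub_self]
          have h8 : 0 ≤ 8 / β := by positivity
          rw [zero_pow two_ne_zero]
          exact mul_nonneg (mul_nonneg h8 (sq_nonneg _)) (sq_nonneg _)
      calc _ ≤ ∑ p ∈ s, 8 / β * (qη ^ n) ^ 2 *
            (((2 * Real.pi * |(p.1 : ℝ)|) ^ η) ^ 2 / eigenval m a β p.1) :=
            Finset.sum_le_sum fun p _ => hterm p
        _ = 8 / β * (qη ^ n) ^ 2 *
            ∑ p ∈ s, (((2 * Real.pi * |(p.1 : ℝ)|) ^ η) ^ 2 / eigenval m a β p.1) := by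
            rw [Finset.mul_sum]
        _ ≤ 8 / β * (qη ^ n) ^ 2 * S1 := by
            gcongr
            exact hsum1.sum_le_tsum s fun p _ =>
              div_nonneg (sq_nonneg _) (eigenval_pos hm ha _).le
        _ = (8 / β * S1) * (qη ^ n) ^ 2 := by ring
        _ ≤ v * (qη ^ n) ^ 2 := by
            gcongr
            have h2 : 0 ≤ 8 / β * S0 := by positivity
            have h3 : v = 8 / β * S1 + 8 / β * S0 + 1 := by rw [hv]; ring
            linarith
  -- the summand `exp b` of the constant makes the bound trivial for `K < 1`
  refine ⟨2 * ν * (1 + S * Real.exp b) + Real.exp b, b / c ^ 2, by positivity, by positivity,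
    fun s R hR => ?_⟩
  set K : ℝ := R / c with hK
  have hK0 : 0 ≤ K := by positivity
  have hRK : b / c ^ 2 * R ^ 2 = b * K ^ 2 := by rw [hK, div_pow]; ring
  rw [hRK]
  rcases lt_or_ge K 1 with hK1 | hK1
  · refine prob_le_one.trans ?_
    rw [← ENNReal.ofReal_one]
    refine ENNReal.ofReal_le_ofReal ?_
    calc (1 : ℝ) ≤ Real.exp b * Real.exp (-(b * K ^ 2)) := by
          rw [← Real.exp_add]
          refine Real.one_le_exp ?_
          have : K ^ 2 ≤ 1 := pow_le_one₀ hK0 hK1.le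
          nlinarith
      _ ≤ _ := by
          gcongr
          have : 0 ≤ 2 * ν * (1 + S * Real.exp b) := by positivity
          linarith
  · have hcK : c * K = R := by rw [hK]; field_simp
    have hsub : {g | partialLoop m a β ν s g ∉ holderBall β ν σ R} ⊆
        (⋃ i : Fin ν, {g | K < |partialLoop m a β ν s g 0 i|}) ∪
        ⋃ n : ℕ, ⋃ j ∈ Finset.range (2 ^ n), ⋃ i : Fin ν,
          {g | K * qσ ^ n < |partialLoop m a β ν s g (dyadicPt β n (j + 1)) i -
          partialLoop m a β ν s g (dyadicPt β n j) i|} := by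
      intro g hg
      by_contra hcon
      refine hg ?_
      simp only [Set.mem_union, Set.mem_iUnion, not_or, not_exists, Set.mem_ofPred_eq, not_lt,
        Finset.mem_range] at hcon
      rw [← hcK]
      exact mem_holderBall_of_dyadic hσ0 hK0 hcon.1 fun n j i hj => hcon.2 n j hj i
    have hK2 : 1 ≤ K ^ 2 := one_le_pow₀ hK1
    have hexp : ∀ n : ℕ, Real.exp (-(b * K ^ 2 * ρ ^ n)) ≤
        Real.exp b * Real.exp (-(b * K ^ 2)) * Real.exp (-(b * ρ ^ n)) := by
      intro n
      rw [← Real.exp_add, ← Real.exp_add]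
      refine Real.exp_le_exp.2 ?_
      have h1 : 1 ≤ ρ ^ n := one_le_pow₀ hρ1.le
      have h2 : 0 ≤ b * ((K ^ 2 - 1) * (ρ ^ n - 1)) :=
        mul_nonneg hb0.le (mul_nonneg (by linarith) (by linarith))
      nlinarith
    have hA : P (⋃ i : Fin ν, {g | K < |partialLoop m a β ν s g 0 i|}) ≤
        ENNReal.ofReal (2 * ν * Real.exp (-(b * K ^ 2))) := by
      refine (measure_iUnion_fintype_le _ _).trans ?_
      refine (Finset.sum_le_sum fun i _ => tail0 s i K hK0).trans (le_of_eq ?_)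
      rw [Finset.sum_const, Finset.card_univ, Fintype.card_fin, nsmul_eq_mul,
        ← ENNReal.ofReal_natCast, ← ENNReal.ofReal_mul (by positivity)]
      congr 1; ring
    have hB : ∀ n : ℕ, P (⋃ j ∈ Finset.range (2 ^ n), ⋃ i : Fin ν,
          {g | K * qσ ^ n < |partialLoop m a β ν s g (dyadicPt β n (j + 1)) i -
          partialLoop m a β ν s g (dyadicPt β n j) i|}) ≤
        ENNReal.ofReal (2 * ν * (Real.exp b * Real.exp (-(b * K ^ 2))) *
          (2 ^ n * Real.exp (-(b * ρ ^ n)))) := by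
      intro n
      calc _ ≤ ∑ j ∈ Finset.range (2 ^ n), ∑ i : Fin ν, ENNReal.ofReal
            (2 * (Real.exp b * Real.exp (-(b * K ^ 2)) * Real.exp (-(b * ρ ^ n)))) := by
            refine (measure_biUnion_finset_le _ _).trans (Finset.sum_le_sum fun j _ => ?_)
            refine (measure_iUnion_fintype_le _ _).trans (Finset.sum_le_sum fun i _ => ?_)
            refine (tailD s n j i K hK0).trans (ENNReal.ofReal_le_ofReal ?_)
            exact mul_le_mul_of_nonneg_left (hexp n) (by norm_num)
        _ = _ := by
            rw [Finset.sum_const, Finset.sum_const, Finset.card_univ, Fintype.card_fin,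
              Finset.card_range, nsmul_eq_mul, nsmul_eq_mul, ← ENNReal.ofReal_natCast,
              ← ENNReal.ofReal_natCast, ← ENNReal.ofReal_mul (by positivity),
              ← ENNReal.ofReal_mul (by positivity)]
            congr 1
            push_cast
            ring
    calc _ ≤ _ := measure_mono hsub
      _ ≤ _ := measure_union_le _ _
      _ ≤ ENNReal.ofReal (2 * ν * Real.exp (-(b * K ^ 2))) +
          ∑' n : ℕ, ENNReal.ofReal (2 * ν * (Real.exp b * Real.exp (-(b * K ^ 2))) *
          (2 ^ n * Real.exp (-(b * ρ ^ n)))) :=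
        add_le_add hA ((measure_iUnion_le _).trans (ENNReal.tsum_le_tsum hB))
      _ = ENNReal.ofReal (2 * ν * Real.exp (-(b * K ^ 2)) +
          2 * ν * (Real.exp b * Real.exp (-(b * K ^ 2))) * S) := by
        rw [← ENNReal.ofReal_tsum_of_nonneg (fun n => by positivity) (hsum.mul_left _),
          tsum_mul_left, ← ENNReal.ofReal_add (by positivity) (by positivity)]
      _ ≤ _ := by
        refine ENNReal.ofReal_le_ofReal ?_
        have h1 : 0 ≤ Real.exp b * Real.exp (-(b * K ^ 2)) := by positivity
        refine le_of_le_of_eq (le_add_of_nonneg_right h1) ?_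
        ring

lemma loopToL2_partialLoop (m a β : ℝ) [Fact (0 < β)] (ν : ℕ) (s : Finset (ℤ × Fin ν))
    (g : ℤ × Fin ν → ℝ) : loopToL2 β ν (partialLoop m a β ν s g) =
      ∑ p ∈ s, (g p / Real.sqrt (eigenval m a β p.1)) • loopToL2 β ν (eigenLoop β ν p) := by
  simp [partialLoop, map_sum]

/-- Fernique-type bound for the free measure: up to a Gaussian tail it sits on Hölder balls. The
compactness of these balls carries the bound from the partial sums to the `L²` limit, and shows that
the limit has a continuous representative. -/
lemma freeMeasureL2_tail {β : ℝ} [Fact (0 < β)] {ν : ℕ} (hν : 0 < ν) {m a : ℝ} (hm : 0 < m)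
    (ha : 0 < a) {σ : ℝ} (hσ : σ ∈ Set.Ioo (0 : ℝ) (1 / 2)) :
    ∃ C lam : ℝ, 0 < C ∧ 0 < lam ∧ ∀ R : ℝ, 0 ≤ R →
      freeMeasureL2 m a β ν (loopToL2 β ν '' holderBall β ν σ R)ᶜ ≤
        ENNReal.ofReal (C * Real.exp (-(lam * R ^ 2))) := by
  obtain ⟨C, lam, hC, hlam, h⟩ := partialLoop_tail (β := β) hν hm ha hσ
  refine ⟨C, lam, hC, hlam, fun R hR => ?_⟩
  set P := Measure.infinitePi fun _ : ℤ × Fin ν => gaussianReal 0 1 with hP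
  have hclosed : IsClosed (loopToL2 β ν '' holderBall β ν σ R) :=
    ((isCompact_holderBall β ν hσ.1 R).image (loopToL2 β ν).continuous).isClosed
  rw [freeMeasureL2, Measure.map_apply_of_aemeasurable (aemeasurable_gaussSeries hm ha)
    hclosed.measurableSet.compl]
  obtain ⟨s, hs⟩ := Filter.exists_seq_tendsto (Filter.atTop : Filter (Finset (ℤ × Fin ν)))
  set A : ℕ → Set (ℤ × Fin ν → ℝ) := fun n =>
    {g | ∀ k, n ≤ k → partialLoop m a β ν (s k) g ∉ holderBall β ν σ R} with hA
  have hAmono : Monotone A := fun n n' hnn' g hg k hk => hg k (hnn'.trans hk)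
  have hAsub : ∀ n, A n ⊆ {g | partialLoop m a β ν (s n) g ∉ holderBall β ν σ R} :=
    fun n g hg => by
      have hg' : ∀ k, n ≤ k → partialLoop m a β ν (s k) g ∉ holderBall β ν σ R := hg
      exact hg' n le_rfl
  have hAle : P (⋃ n, A n) ≤ ENNReal.ofReal (C * Real.exp (-(lam * R ^ 2))) := by
    rw [hAmono.measure_iUnion]
    exact iSup_le fun n => (measure_mono (hAsub n)).trans (h (s n) R hR)
  refine le_trans (measure_mono_ae ?_) hAle
  filter_upwards [ae_summable_gauss (β := β) (ν := ν) hm ha] with g hg hgU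
  have hlim := hg.hasSum.comp hs
  have hev := hlim.eventually (hclosed.isOpen_compl.mem_nhds hgU)
  obtain ⟨n, hn⟩ := Filter.eventually_atTop.1 hev
  refine Set.mem_iUnion.2 ⟨n, fun k hk hmem => hn k hk ?_⟩
  refine ⟨_, hmem, ?_⟩
  rw [loopToL2_partialLoop]
  rfl

lemma isProbabilityMeasure_freeMeasureL2 {β : ℝ} [Fact (0 < β)] {ν : ℕ} {m a : ℝ}
    (hm : 0 < m) (ha : 0 < a) : IsProbabilityMeasure (freeMeasureL2 m a β ν) :=
  Measure.isProbabilityMeasure_map (aemeasurable_gaussSeries hm ha)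

lemma freeMeasure_apply (m a β : ℝ) [Fact (0 < β)] (ν : ℕ) (B : Set (Loop β ν)) :
    freeMeasure m a β ν B = freeMeasureL2 m a β ν (loopToL2 β ν '' B) :=
  measurableEmbedding_loopToL2.comap_apply _ _

lemma freeMeasure_tail {β : ℝ} [Fact (0 < β)] {ν : ℕ} (hν : 0 < ν) {m a : ℝ} (hm : 0 < m)
    (ha : 0 < a) {σ : ℝ} (hσ : σ ∈ Set.Ioo (0 : ℝ) (1 / 2)) :
    ∃ C lam : ℝ, 0 < C ∧ 0 < lam ∧ ∀ R : ℝ, 0 ≤ R →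
      freeMeasure m a β ν {ω | ENNReal.ofReal R < holderNorm σ ω} ≤
        ENNReal.ofReal (C * Real.exp (-(lam * R ^ 2))) := by
  obtain ⟨C, lam, hC, hlam, h⟩ := freeMeasureL2_tail (β := β) hν hm ha hσ
  refine ⟨C, lam / 4, hC, by positivity, fun R hR => ?_⟩
  rw [freeMeasure_apply]
  have h1 := h (R / 2) (by positivity)
  rw [show lam * (R / 2) ^ 2 = lam / 4 * R ^ 2 by ring] at h1
  refine (measure_mono ?_).trans h1
  rintro _ ⟨ω, hω, rfl⟩ ⟨ω', hω', he⟩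
  have hinj : Function.Injective (loopToL2 β ν) := measurableEmbedding_loopToL2.injective
  rw [← hinj he] at hω
  have := holderNorm_le_of_mem_holderBall (by positivity) hω'
  rw [mul_div_cancel₀ _ two_ne_zero] at this
  exact absurd hω (not_lt.2 this)

/-- The free measure charges a ball of `C_β`: Gaussian loops have continuous versions. -/
lemma exists_freeMeasure_ball_ne_zero {β : ℝ} [Fact (0 < β)] {ν : ℕ} (hν : 0 < ν) {m a : ℝ}
    (hm : 0 < m) (ha : 0 < a) :
    ∃ R : ℝ, 0 < R ∧ freeMeasure m a β ν {ω | ‖ω‖ ≤ R} ≠ 0 := by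
  have := isProbabilityMeasure_freeMeasureL2 (β := β) (ν := ν) hm ha
  obtain ⟨C, lam, hC, hlam, h⟩ := freeMeasureL2_tail (β := β) hν hm ha
    (σ := 1 / 4) ⟨by norm_num, by norm_num⟩
  have hlim : Filter.Tendsto (fun R : ℝ => C * Real.exp (-(lam * R ^ 2))) Filter.atTop (nhds 0) := by
    have h1 : Filter.Tendsto (fun R : ℝ => lam * R ^ 2) Filter.atTop Filter.atTop :=
      (Filter.tendsto_pow_atTop two_ne_zero).const_mul_atTop hlam
    have := (Real.tendsto_exp_neg_atTop_nhds_zero.comp h1).const_mul C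
    simpa using this
  obtain ⟨R, hR1, hR0⟩ := ((hlim.eventually (gt_mem_nhds one_pos)).and
    (Filter.eventually_gt_atTop 0)).exists
  refine ⟨R, hR0, fun h0 => ?_⟩
  rw [freeMeasure_apply] at h0
  have hK : freeMeasureL2 m a β ν (loopToL2 β ν '' holderBall β ν (1 / 4) R) = 0 := by
    refine measure_mono_null (Set.image_mono fun ω hω => ?_) h0
    exact (ContinuousMap.norm_le _ hR0.le).2 hω.1
  have h1 := h R hR0.le
  rw [prob_compl_eq_one_iff₀ ?_ |>.2 hK] at h1
  · rw [ENNReal.one_le_ofReal] at h1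
    linarith
  · exact (((isCompact_holderBall β ν (by norm_num) R).image
      (loopToL2 β ν).continuous).isClosed).measurableSet.nullMeasurableSet

lemma freeMeasure_univ_le_one {β : ℝ} [Fact (0 < β)] {ν : ℕ} {m a : ℝ} (hm : 0 < m)
    (ha : 0 < a) : freeMeasure m a β ν Set.univ ≤ 1 := by
  have := isProbabilityMeasure_freeMeasureL2 (β := β) (ν := ν) hm ha
  rw [freeMeasure_apply]
  exact prob_le_one

/-! ### Lattice sums and weights -/

lemma latDist_eq_dist {d : ℕ} (l l' : Lattice d) : latDist l l' =
    dist (WithLp.toLp 2 fun i => (l i : ℝ) : EuclideanSpace ℝ (Fin d))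
      (WithLp.toLp 2 fun i => (l' i : ℝ)) := by
  rw [EuclideanSpace.dist_eq, latDist]
  simp [Real.dist_eq, sq_abs]

lemma latDist_nonneg {d : ℕ} (l l' : Lattice d) : 0 ≤ latDist l l' := Real.sqrt_nonneg _

lemma latDist_self {d : ℕ} (l : Lattice d) : latDist l l = 0 := by simp [latDist]

lemma latDist_comm {d : ℕ} (l l' : Lattice d) : latDist l l' = latDist l' l := by
  rw [latDist_eq_dist, latDist_eq_dist, dist_comm]

lemma latDist_triangle {d : ℕ} (l l' l'' : Lattice d) :
    latDist l l'' ≤ latDist l l' + latDist l' l'' := by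
  simp_rw [latDist_eq_dist]
  exact dist_triangle _ _ _

lemma abs_sub_le_latDist {d : ℕ} (l l' : Lattice d) (i : Fin d) :
    |((l' i - l i : ℤ) : ℝ)| ≤ latDist l l' := by
  rw [latDist]
  refine Real.abs_le_sqrt ?_
  refine le_trans (le_of_eq ?_) (Finset.single_le_sum
    (f := fun i => ((l i : ℝ) - (l' i : ℝ)) ^ 2) (fun i _ => sq_nonneg _) (Finset.mem_univ i))
  push_cast
  ring

lemma summable_one_add_abs_int_rpow {b : ℝ} (hb : 1 < b) :
    Summable fun k : ℤ => (1 + |(k : ℝ)|) ^ (-b) := by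
  refine Summable.of_norm_bounded_eventually (Real.summable_abs_int_rpow hb) ?_
  refine (Set.finite_singleton (0 : ℤ)).subset fun k hk => ?_
  by_contra hk0
  refine hk ?_
  change ‖(1 + |(k : ℝ)|) ^ (-b)‖ ≤ |(k : ℝ)| ^ (-b)
  have hk' : 0 < |(k : ℝ)| := abs_pos.2 (by exact_mod_cast hk0)
  rw [Real.norm_of_nonneg (by positivity)]
  exact Real.rpow_le_rpow_of_nonpos hk' (by linarith) (by linarith)

/-- `∑_ℓ (1 + |ℓ₀ - ℓ|)^{-p}` converges for `p > d`, uniformly in `ℓ₀`. -/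
lemma exists_sum_one_add_latDist_rpow_le {d : ℕ} (hd : 0 < d) {p : ℝ} (hp : d < p) :
    ∃ W : ℝ, ∀ (l₀ : Lattice d) (s : Finset (Lattice d)),
      ∑ l ∈ s, (1 + latDist l₀ l) ^ (-p) ≤ W := by
  have hd' : (0 : ℝ) < d := by exact_mod_cast hd
  set g : ℤ → ℝ := fun k => (1 + |(k : ℝ)|) ^ (-(p / d)) with hg
  have hg0 : ∀ k, 0 ≤ g k := fun k => by positivity
  have hgs : Summable g := summable_one_add_abs_int_rpow ((one_lt_div hd').2 hp)
  refine ⟨(∑' k, g k) ^ d, fun l₀ s => ?_⟩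
  have hterm : ∀ l : Lattice d, (1 + latDist l₀ l) ^ (-p) ≤ ∏ i, g (l i - l₀ i) := by
    intro l
    have hD := latDist_nonneg l₀ l
    calc (1 + latDist l₀ l) ^ (-p) = ∏ _i : Fin d, (1 + latDist l₀ l) ^ (-(p / d)) := by
          rw [Finset.prod_const, Finset.card_univ, Fintype.card_fin, ← Real.rpow_natCast,
            ← Real.rpow_mul (by linarith)]
          congr 1
          field_simp
      _ ≤ ∏ i, g (l i - l₀ i) := by
          refine Finset.prod_le_prod (fun i _ => by positivity) fun i _ => ?_
          refine Real.rpow_le_rpow_of_nonpos (by positivity) ?_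
            (neg_nonpos.2 (div_nonneg (by linarith) hd'.le))
          have := abs_sub_le_latDist l₀ l i
          linarith
  have hsub : s ⊆ Fintype.piFinset fun i => s.image fun l => l i := by
    intro l hl
    rw [Fintype.mem_piFinset]
    exact fun i => Finset.mem_image_of_mem (fun l : Lattice d => l i) hl
  calc ∑ l ∈ s, (1 + latDist l₀ l) ^ (-p) ≤ ∑ l ∈ s, ∏ i, g (l i - l₀ i) :=
        Finset.sum_le_sum fun l _ => hterm l
    _ ≤ ∑ l ∈ Fintype.piFinset fun i => s.image fun l => l i, ∏ i, g (l i - l₀ i) :=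
        Finset.sum_le_sum_of_subset_of_nonneg hsub fun l _ _ =>
          Finset.prod_nonneg fun i _ => hg0 _
    _ = ∏ i, ∑ k ∈ s.image fun l => l i, g (k - l₀ i) :=
        (Finset.prod_univ_sum (fun i => s.image fun l => l i) fun i k => g (k - l₀ i)).symm
    _ ≤ ∏ _i : Fin d, ∑' k, g k := by
        refine Finset.prod_le_prod (fun i _ => Finset.sum_nonneg fun k _ => hg0 _) fun i _ => ?_
        have hs : Summable fun k => g (k - l₀ i) := (Equiv.subRight (l₀ i)).summable_iff.2 hgs
        refine (hs.sum_le_tsum _ fun k _ => hg0 _).trans (le_of_eq ?_)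
        exact (Equiv.subRight (l₀ i)).tsum_eq g
    _ = _ := by simp

lemma exp_neg_le_one_add_rpow {α : ℝ} (hα : 0 < α) (N : ℕ) {x : ℝ} (hx : 0 ≤ x) :
    Real.exp (-(α * x)) ≤ N.factorial * Real.exp α / α ^ N * (1 + x) ^ (-(N : ℝ)) := by
  have h1 := Real.pow_div_factorial_le_exp (α * (1 + x)) (by positivity) N
  have h2 : Real.exp (α * (1 + x)) = Real.exp α * Real.exp (α * x) := by
    rw [← Real.exp_add]; ring_nf
  rw [h2, div_le_iff₀ (by positivity), mul_pow] at h1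
  rw [Real.exp_neg, Real.rpow_neg (by positivity), Real.rpow_natCast, ← div_eq_mul_inv,
    le_div_iff₀ (by positivity), le_div_iff₀ (by positivity), inv_mul_eq_div, div_mul_eq_mul_div,
    div_le_iff₀ (by positivity)]
  linarith

section Weights

variable {d ν : ℕ}

/-- The properties of a family of weights `w(ℓ, ℓ')` on which the estimates are based. The constant
`W` bounds the sums of the weights, and `D` bounds the interaction in the norm weighted by `1/w`. -/
structure IsWeight (M : Model d ν) (w : Lattice d → Lattice d → ℝ) (W D : ℝ) : Prop where
  pos : ∀ l l', 0 < w l l'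
  self : ∀ l, w l l = 1
  mul_le : ∀ l l' l'', w l l' * w l' l'' ≤ w l l''
  sum_le : ∀ l (s : Finset (Lattice d)), ∑ l' ∈ s, w l l' ≤ W
  J_le : ∀ l (s : Finset (Lattice d)), ∑ l' ∈ s, |M.J l l'| ≤ D
  J_div_le : ∀ l' (s : Finset (Lattice d)), ∑ l ∈ s, |M.J l l'| / w l l' ≤ D

lemma sum_abs_mul_le_of_iSup_lt_top {J : Lattice d → Lattice d → ℝ} {f : Lattice d → Lattice d → ℝ}
    (hf : ∀ l l', 0 ≤ f l l') (h : (⨆ l, ∑' l', ‖J l l'‖ₑ * ENNReal.ofReal (f l l')) < ∞) :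
    ∃ D : ℝ, ∀ l (s : Finset (Lattice d)), ∑ l' ∈ s, |J l l'| * f l l' ≤ D := by
  refine ⟨(⨆ l, ∑' l', ‖J l l'‖ₑ * ENNReal.ofReal (f l l')).toReal, fun l s => ?_⟩
  rw [← ENNReal.ofReal_le_iff_le_toReal h.ne,
    ENNReal.ofReal_sum_of_nonneg fun l' _ => mul_nonneg (abs_nonneg _) (hf _ _)]
  refine le_trans ?_ ((ENNReal.sum_le_tsum s).trans
    (le_iSup (fun l => ∑' l', ‖J l l'‖ₑ * ENNReal.ofReal (f l l')) l))
  refine Finset.sum_le_sum fun l' _ => ?_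
  rw [ENNReal.ofReal_mul (abs_nonneg _), ← Real.norm_eq_abs, ofReal_norm]

lemma sum_abs_le_of_iSup_lt_top (M : Model d ν) :
    ∃ D : ℝ, ∀ l (s : Finset (Lattice d)), ∑ l' ∈ s, |M.J l l'| ≤ D := by
  have := sum_abs_mul_le_of_iSup_lt_top (J := M.J) (f := fun _ _ => 1) (fun _ _ => zero_le_one)
    (by simpa using M.J_summable)
  simpa using this

/-- A summable weight of the form `w = φ(|ℓ - ℓ'|)` with `φ` supermultiplicative, controlled by the
decay of the interaction. -/
lemma exists_isWeight_of_profile (M : Model d ν) {φ : ℝ → ℝ} (hpos : ∀ x, 0 ≤ x → 0 < φ x)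
    (h0 : φ 0 = 1) (hanti : ∀ x y, 0 ≤ x → x ≤ y → φ y ≤ φ x)
    (hmul : ∀ x y, 0 ≤ x → 0 ≤ y → φ x * φ y ≤ φ (x + y)) {W : ℝ}
    (hsum : ∀ (l : Lattice d) (s : Finset (Lattice d)), ∑ l' ∈ s, φ (latDist l l') ≤ W)
    (hJ : (⨆ l, ∑' l', ‖M.J l l'‖ₑ * ENNReal.ofReal ((φ (latDist l l'))⁻¹)) < ∞) :
    ∃ D, IsWeight M (fun l l' => φ (latDist l l')) W D := by
  obtain ⟨D₁, hD₁⟩ := sum_abs_le_of_iSup_lt_top M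
  obtain ⟨D₂, hD₂⟩ := sum_abs_mul_le_of_iSup_lt_top
    (fun l l' => inv_nonneg.2 (hpos _ (latDist_nonneg l l')).le) hJ
  refine ⟨max D₁ D₂, fun l l' => hpos _ (latDist_nonneg l l'), fun l => by rw [latDist_self, h0],
    fun l l' l'' => ?_, hsum, fun l s => (hD₁ l s).trans (le_max_left _ _), fun l' s => ?_⟩
  · exact (hmul _ _ (latDist_nonneg _ _) (latDist_nonneg _ _)).trans
      (hanti _ _ (latDist_nonneg _ _) (latDist_triangle _ _ _))
  · refine le_trans (le_of_eq ?_) ((hD₂ l' s).trans (le_max_right _ _))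
    refine Finset.sum_congr rfl fun l _ => ?_
    rw [M.J_symm l l', latDist_comm l l', div_eq_mul_inv]

/-- There is an admissible weight that does not depend on the scale `ε`, but is dominated, for each
`ε`, by one of the weights `w_α` with `α ∈ 𝓘` that define temperedness. The exponent
`α` is taken strictly smaller than some exponent for which the interaction decays. -/
lemma exists_isWeight (hd : 0 < d) (M : Model d ν) :
    ∃ (w : Lattice d → Lattice d → ℝ) (W D : ℝ), IsWeight M w W D ∧
      ∀ ε : ℝ, 0 < ε → ∃ α ∈ M.indexSet, ∃ c : ℝ, ∀ l, w 0 l ≤ c * M.weight ε α 0 l := by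
  have hd' : (0 : ℝ) < d := by exact_mod_cast hd
  by_cases hexp : M.IsExp
  · obtain ⟨α₀, hα₀, hdec⟩ := hexp
    have hα : 0 < α₀ / 2 := by positivity
    obtain ⟨W, hW⟩ := exists_sum_one_add_latDist_rpow_le hd (p := ((d + 1 : ℕ) : ℝ))
      (by push_cast; linarith)
    obtain ⟨D, hD⟩ := exists_isWeight_of_profile M (φ := fun x => Real.exp (-(α₀ / 2 * x)))
      (W := (d + 1).factorial * Real.exp (α₀ / 2) / (α₀ / 2) ^ (d + 1) * W)
      (fun x _ => Real.exp_pos _) (by simp)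
      (fun x y _ hxy => Real.exp_le_exp.2 (by nlinarith))
      (fun x y _ _ => by rw [← Real.exp_add]; exact Real.exp_le_exp.2 (by linarith))
      (fun l s => by
        calc _ ≤ ∑ l' ∈ s, (d + 1).factorial * Real.exp (α₀ / 2) / (α₀ / 2) ^ (d + 1) *
              (1 + latDist l l') ^ (-((d + 1 : ℕ) : ℝ)) :=
              Finset.sum_le_sum fun l' _ =>
                exp_neg_le_one_add_rpow hα (d + 1) (latDist_nonneg l l')
          _ ≤ _ := by
              rw [← Finset.mul_sum]
              exact mul_le_mul_of_nonneg_left (hW l s) (by positivity))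
      (by
        refine lt_of_le_of_lt (iSup_mono fun l => ENNReal.tsum_le_tsum fun l' => ?_) hdec
        refine mul_le_mul_right (ENNReal.ofReal_le_ofReal ?_) _
        rw [← Real.exp_neg, neg_neg]
        have := latDist_nonneg l l'
        exact Real.exp_le_exp.2 (by nlinarith))
    refine ⟨_, _, D, hD, fun ε _ => ⟨α₀ / 2, ?_, 1, fun l => ?_⟩⟩
    · have hI : M.IsExp := ⟨α₀, hα₀, hdec⟩
      rw [Model.indexSet, if_pos hI]
      refine ⟨hα, lt_of_lt_of_le ?_ (le_sSup ⟨α₀, hdec, rfl⟩)⟩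
      exact EReal.coe_lt_coe_iff.2 (by linarith : α₀ / 2 < α₀)
    · have hI : M.IsExp := ⟨α₀, hα₀, hdec⟩
      rw [Model.weight, if_pos hI, one_mul]
  · obtain ⟨α₀, hα₀, hdec⟩ := M.J_decay.resolve_left hexp
    set α : ℝ := (1 + α₀) / 2 with hα
    have hα1 : 1 < α := by linarith
    have hαd : (d : ℝ) < α * d := by nlinarith
    obtain ⟨W, hW⟩ := exists_sum_one_add_latDist_rpow_le hd hαd
    obtain ⟨D, hD⟩ := exists_isWeight_of_profile M (φ := fun x => (1 + x) ^ (-(α * d)))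
      (W := W) (fun x hx => by positivity) (by simp)
      (fun x y hx hxy => Real.rpow_le_rpow_of_nonpos (by linarith) (by linarith) (by nlinarith))
      (fun x y hx hy => by
        rw [← Real.mul_rpow (by linarith) (by linarith)]
        exact Real.rpow_le_rpow_of_nonpos (by linarith) (by nlinarith) (by nlinarith))
      hW
      (by
        refine lt_of_le_of_lt (iSup_mono fun l => ENNReal.tsum_le_tsum fun l' => ?_) hdec
        refine mul_le_mul_right (ENNReal.ofReal_le_ofReal ?_) _
        have := latDist_nonneg l l'
        rw [Real.rpow_neg (by linarith), inv_inv]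
        exact Real.rpow_le_rpow_of_exponent_le (by linarith) (by nlinarith))
    refine ⟨_, _, D, hD, fun ε hε => ⟨α, ?_, max 1 ε ^ (α * d), fun l => ?_⟩⟩
    · rw [Model.indexSet, if_neg hexp]
      refine ⟨hα1, lt_of_lt_of_le ?_ (le_sSup ⟨α₀, hdec, rfl⟩)⟩
      exact EReal.coe_lt_coe_iff.2 (by linarith : α < α₀)
    · have hl := latDist_nonneg 0 l
      have hm : 0 < max 1 ε := lt_of_lt_of_le one_pos (le_max_left _ _)
      rw [Model.weight, if_neg hexp]
      have h1 : 1 + ε * latDist 0 l ≤ max 1 ε * (1 + latDist 0 l) := by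
        have h2 := mul_le_mul_of_nonneg_right (le_max_right 1 ε) hl
        have h3 := le_max_left 1 ε
        linarith
      have h4 := Real.rpow_le_rpow_of_nonpos (z := -(α * d)) (by positivity) h1 (by nlinarith)
      rw [Real.mul_rpow hm.le (by linarith)] at h4
      calc (1 + latDist 0 l) ^ (-(α * d)) =
            max 1 ε ^ (α * d) * (max 1 ε ^ (-(α * d)) * (1 + latDist 0 l) ^ (-(α * d))) := by
            rw [← mul_assoc, ← Real.rpow_add hm, add_neg_cancel, Real.rpow_zero, one_mul]
        _ ≤ _ := mul_le_mul_of_nonneg_left h4 (by positivity)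

namespace IsWeight

variable {M : Model d ν} {w : Lattice d → Lattice d → ℝ} {W D : ℝ}

lemma D_nonneg (hw : IsWeight M w W D) : 0 ≤ D := by simpa using hw.J_le 0 ∅

lemma abs_J_le (hw : IsWeight M w W D) (l l' : Lattice d) : |M.J l l'| ≤ D * w l l' := by
  have := hw.J_div_le l' {l}
  rwa [Finset.sum_singleton, div_le_iff₀ (hw.pos _ _)] at this

lemma sum_mul_abs_J_le (hw : IsWeight M w W D) (l₀ l' : Lattice d) (s : Finset (Lattice d)) :
    ∑ l ∈ s, w l₀ l * |M.J l l'| ≤ D * w l₀ l' := by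
  calc ∑ l ∈ s, w l₀ l * |M.J l l'| ≤ ∑ l ∈ s, w l₀ l' * (|M.J l l'| / w l l') := by
        refine Finset.sum_le_sum fun l _ => ?_
        rw [← mul_div_assoc, le_div_iff₀ (hw.pos _ _)]
        have := mul_le_mul_of_nonneg_right (hw.mul_le l₀ l l') (abs_nonneg (M.J l l'))
        linarith
    _ = w l₀ l' * ∑ l ∈ s, |M.J l l'| / w l l' := by rw [Finset.mul_sum]
    _ ≤ w l₀ l' * D := mul_le_mul_of_nonneg_left (hw.J_div_le l' s) (hw.pos _ _).le
    _ = _ := mul_comm _ _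

/-- Tempered configurations have square-summable norms with respect to `w(ℓ₀, ·)`. -/
lemma summable_of_tempered (hw : IsWeight M w W D) {β : ℝ} [Fact (0 < β)]
    (hdom : ∀ ε : ℝ, 0 < ε → ∃ α ∈ M.indexSet, ∃ c : ℝ, ∀ l, w 0 l ≤ c * M.weight ε α 0 l)
    {ε : ℝ} (hε : 0 < ε) {ξ : Config d β ν} (hξ : ξ ∈ M.tempered β ε) (l₀ : Lattice d) :
    Summable fun l => w l₀ l * l2Inner (ξ l) (ξ l) := by
  obtain ⟨α, hα, c, hc⟩ := hdom ε hε
  have hfin := hξ α hα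
  have hnn : ∀ l, 0 ≤ l2Inner (ξ l) (ξ l) := fun l => by
    rw [← inner_loopToL2]; exact real_inner_self_nonneg
  have hwt : ∀ l, 0 ≤ M.weight ε α 0 l := fun l => by
    have := latDist_nonneg 0 l
    unfold Model.weight
    split_ifs <;> positivity
  have h1 : Summable fun l => l2Inner (ξ l) (ξ l) * M.weight ε α 0 l := by
    refine (ENNReal.summable_toReal hfin.ne).congr fun l => ?_
    rw [← ENNReal.ofReal_mul (hnn l), ENNReal.toReal_ofReal (mul_nonneg (hnn l) (hwt l))]
  refine Summable.of_nonneg_of_le (fun l => mul_nonneg (hw.pos _ _).le (hnn l)) (fun l => ?_)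
    (h1.mul_left (c / w 0 l₀))
  have h2 : w l₀ l ≤ c / w 0 l₀ * M.weight ε α 0 l := by
    rw [div_mul_eq_mul_div, le_div_iff₀ (hw.pos _ _), mul_comm]
    exact (hw.mul_le 0 l₀ l).trans (hc l)
  calc w l₀ l * l2Inner (ξ l) (ξ l) ≤ c / w 0 l₀ * M.weight ε α 0 l * l2Inner (ξ l) (ξ l) :=
        mul_le_mul_of_nonneg_right h2 (hnn l)
    _ = _ := by ring

end IsWeight

end Weights

/-! ### The one-site estimate -/

section OneSite

variable {d ν : ℕ} {β : ℝ} [Fact (0 < β)]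

lemma l2Inner_self_eq (ω : Loop β ν) : l2Inner ω ω = ‖loopToL2 β ν ω‖ ^ 2 := by
  rw [← inner_loopToL2, real_inner_self_eq_norm_sq]

lemma l2Inner_self_nonneg (ω : Loop β ν) : 0 ≤ l2Inner ω ω := by
  rw [l2Inner_self_eq]; positivity

lemma l2Inner_comm (ω ω' : Loop β ν) : l2Inner ω ω' = l2Inner ω' ω := by
  rw [← inner_loopToL2, ← inner_loopToL2, real_inner_comm]

lemma l2Inner_zero_left (ω : Loop β ν) : l2Inner 0 ω = 0 := by
  rw [← inner_loopToL2, map_zero, inner_zero_left]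

lemma continuous_l2Inner : Continuous fun p : Loop β ν × Loop β ν => l2Inner p.1 p.2 := by
  simp_rw [← inner_loopToL2]
  exact ((loopToL2 β ν).continuous.comp continuous_fst).inner
    ((loopToL2 β ν).continuous.comp continuous_snd)

/-- Weighted Cauchy–Schwarz and Young inequality. -/
lemma abs_l2Inner_le {δ : ℝ} (hδ : 0 < δ) (ω ω' : Loop β ν) :
    |l2Inner ω ω'| ≤ l2Inner ω ω / (4 * δ) + δ * l2Inner ω' ω' := by
  rw [l2Inner_self_eq, l2Inner_self_eq, ← inner_loopToL2]
  refine (abs_real_inner_le_norm _ _).trans ?_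
  set x := ‖loopToL2 β ν ω‖
  set y := ‖loopToL2 β ν ω'‖
  have h : x ^ 2 / (4 * δ) + δ * y ^ 2 - x * y = (x - 2 * δ * y) ^ 2 / (4 * δ) := by
    field_simp; ring
  have h2 : 0 ≤ (x - 2 * δ * y) ^ 2 / (4 * δ) := by positivity
  linarith

lemma integrable_of_continuous_circle {E : Type*} [NormedAddCommGroup E] {f : AddCircle β → E}
    (hf : Continuous f) : Integrable f :=
  hf.integrable_of_hasCompactSupport (HasCompactSupport.of_compactSpace _)

lemma integral_const_circle (c : ℝ) : ∫ _τ : AddCircle β, c = β * c := by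
  have hβ : (0 : ℝ) < β := Fact.out
  simp [Measure.real, AddCircle.measure_univ, hβ.le]

lemma l2Inner_self_le (ω : Loop β ν) : l2Inner ω ω ≤ β * ‖ω‖ ^ 2 := by
  rw [← integral_const_circle (β := β)]
  refine integral_mono (integrable_of_continuous_circle ?_) (integrable_const _) fun τ => ?_
  · exact ω.continuous.inner ω.continuous
  · simp only [real_inner_self_eq_norm_sq]
    have := ω.norm_coe_le_norm τ
    gcongr

lemma continuous_integral_comp {V : EuclideanSpace ℝ (Fin ν) → ℝ} (hV : Continuous V) :
    Continuous fun ω : Loop β ν => ∫ τ : AddCircle β, V (ω τ) := by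
  have h1 : Continuous fun ω : Loop β ν => (ContinuousMap.comp ⟨V, hV⟩ ω : C(AddCircle β, ℝ)) :=
    ContinuousMap.continuous_postcomp _
  have h2 : Continuous fun f : C(AddCircle β, ℝ) => ∫ τ : AddCircle β, f τ := by
    have hβ : (0 : ℝ) < β := Fact.out
    refine (LipschitzWith.of_dist_le_mul (K := ⟨β, hβ.le⟩) fun f g => ?_).continuous
    rw [dist_eq_norm, ← integral_sub (integrable_of_continuous_circle f.continuous)
      (integrable_of_continuous_circle g.continuous)]
    refine (norm_integral_le_of_norm_le_const (C := dist f g) (.of_forall fun τ => ?_)).trans ?_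
    · rw [← dist_eq_norm]; exact ContinuousMap.dist_apply_le_dist τ
    · rw [Measure.real, AddCircle.measure_univ, ENNReal.toReal_ofReal hβ.le, mul_comm]
      rfl
  exact h2.comp h1

/-- Superquadratic growth. -/
lemma exists_forall_mul_sq_le_rpow {r A : ℝ} (hr : 1 < r) (hA : 0 < A) {c : ℝ} (hc : 0 ≤ c) :
    ∃ D : ℝ, ∀ x : ℝ, 0 ≤ x → c * x ^ 2 - D ≤ A * x ^ (2 * r) := by
  set X : ℝ := (c / A) ^ (1 / (r - 1)) with hX
  have hr1 : 0 < r - 1 := by linarith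
  have hcA : 0 ≤ c / A := by positivity
  have hX0 : 0 ≤ X := by positivity
  have hXp : X ^ (r - 1) = c / A := by
    rw [hX, ← Real.rpow_mul hcA, one_div, inv_mul_cancel₀ hr1.ne', Real.rpow_one]
  refine ⟨c * X, fun x hx => ?_⟩
  have hx2 : 0 ≤ x ^ 2 := sq_nonneg x
  have hpos : 0 ≤ A * x ^ (2 * r) := by positivity
  rcases le_total (x ^ 2) X with h | h
  · have := mul_le_mul_of_nonneg_left h hc
    linarith
  · have h1 : c / A ≤ (x ^ 2) ^ (r - 1) := by
      rw [← hXp]; exact Real.rpow_le_rpow hX0 h hr1.le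
    have h2 : x ^ (2 * r) = (x ^ 2) ^ (r - 1) * x ^ 2 := by
      rw [Real.rpow_mul hx, Real.rpow_two]
      nth_rewrite 3 [← Real.rpow_one (x ^ 2)]
      rw [← Real.rpow_add' hx2 (by linarith)]
      congr 1; ring
    rw [h2]
    have h3 := mul_le_mul_of_nonneg_right h1 hx2
    rw [div_mul_eq_mul_div, div_le_iff₀ hA] at h3
    have h4 : 0 ≤ c * X := by positivity
    linarith

/-- Whatever the constant `c`, the self-interaction dominates `c |ω|²`, uniformly in the site. -/
lemma exists_mul_l2Inner_self_sub_le (M : Model d ν) {c : ℝ} (hc : 0 ≤ c) :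
    ∃ D : ℝ, ∀ (l : Lattice d) (ω : Loop β ν),
      c * l2Inner ω ω - D ≤ ∫ τ : AddCircle β, M.V l (ω τ) := by
  obtain ⟨r, A, B, U, hr, hA, -, -, h⟩ := M.V_bounds
  obtain ⟨D, hD⟩ := exists_forall_mul_sq_le_rpow hr hA hc
  refine ⟨β * (D - B), fun l ω => ?_⟩
  have i1 : Integrable fun τ : AddCircle β => c * ⟪ω τ, ω τ⟫ :=
    integrable_of_continuous_circle (continuous_const.mul (ω.continuous.inner ω.continuous))
  have hi : c * l2Inner ω ω - β * (D - B) = ∫ τ : AddCircle β, (c * ⟪ω τ, ω τ⟫ - (D - B)) := by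
    rw [integral_sub i1 (integrable_const _), integral_const_mul, integral_const_circle]
    rfl
  rw [hi]
  refine integral_mono (i1.sub (integrable_const _)) (integrable_of_continuous_circle
    ((M.V_continuous l).comp ω.continuous)) fun τ => ?_
  have h1 := (h l (ω τ)).1
  have h2 := hD ‖ω τ‖ (norm_nonneg _)
  simp only [real_inner_self_eq_norm_sq]
  linarith

/-- On balls of `C_β` the self-interaction is bounded above, uniformly in the site. -/
lemma exists_integral_V_le (M : Model d ν) (R : ℝ) :
    ∃ D : ℝ, ∀ (l : Lattice d) (ω : Loop β ν), ‖ω‖ ≤ R → ∫ τ : AddCircle β, M.V l (ω τ) ≤ D := by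
  have hβ : (0 : ℝ) < β := Fact.out
  obtain ⟨r, A, B, U, -, -, hU, -, h⟩ := M.V_bounds
  obtain ⟨K, hK⟩ := (isCompact_closedBall (0 : EuclideanSpace ℝ (Fin ν)) R).bddAbove_image
    hU.continuousOn
  refine ⟨β * K, fun l ω hω => ?_⟩
  rw [← integral_const_circle (β := β)]
  refine integral_mono (integrable_of_continuous_circle
    ((M.V_continuous l).comp ω.continuous)) (integrable_const _) fun τ => ?_
  refine (h l (ω τ)).2.trans (hK ⟨ω τ, ?_, rfl⟩)
  rw [mem_closedBall_zero_iff]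
  exact (ω.norm_coe_le_norm τ).trans hω

/-- The one-site estimate with constant `C`: for a loop in an external field `H`, whose strength is
measured by `T`, the unnormalized expectation of `F` is at most `exp (C + θ T)` times the
expectation of `F exp (-|ω|²)` under the free measure, times the partition function. -/
def OneSiteBound (M : Model d ν) (β : ℝ) [Fact (0 < β)] (θ J₀ C : ℝ) : Prop :=
  ∀ (l : Lattice d) (H : Loop β ν → ℝ) (T : ℝ),
    (∀ δ : ℝ, 0 < δ → ∀ ω, |H ω| ≤ J₀ * (l2Inner ω ω / (4 * δ)) + δ * T) →
    ∀ F : Loop β ν → ℝ≥0∞,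
      ∫⁻ ω, F ω * ENNReal.ofReal (Real.exp (H ω - ∫ τ : AddCircle β, M.V l (ω τ)))
        ∂(freeMeasure M.m M.a β ν) ≤
      ENNReal.ofReal (Real.exp (C + θ * T)) *
        (∫⁻ ω, F ω * ENNReal.ofReal (Real.exp (-l2Inner ω ω)) ∂(freeMeasure M.m M.a β ν)) *
        ∫⁻ ω, ENNReal.ofReal (Real.exp (H ω - ∫ τ : AddCircle β, M.V l (ω τ)))
          ∂(freeMeasure M.m M.a β ν)

/-- The superquadratic growth of the self-interaction yields the Gaussian factor `exp (-|ω|²)` and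
leaves the dependence `exp (θ T)` on the field, with `θ` as small as desired. The partition function
is bounded below by restriction to a ball of `C_β`. -/
lemma exists_oneSiteBound (hν : 0 < ν) (M : Model d ν) {θ J₀ : ℝ} (hθ : 0 < θ) (hJ₀ : 0 ≤ J₀) :
    ∃ C : ℝ, OneSiteBound M β θ J₀ C := by
  have hβ : (0 : ℝ) < β := Fact.out
  set χ := freeMeasure M.m M.a β ν with hχ
  obtain ⟨R, hR0, hR⟩ := exists_freeMeasure_ball_ne_zero (β := β) hν M.m_pos M.a_pos
  rw [← hχ] at hR
  obtain ⟨D, hD⟩ := exists_mul_l2Inner_self_sub_le (β := β) M (c := 1 + J₀ / (2 * θ))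
    (by positivity)
  obtain ⟨K, hK⟩ := exists_integral_V_le (β := β) M R
  set B : Set (Loop β ν) := {ω | ‖ω‖ ≤ R} with hB
  have hBfin : χ B ≠ ∞ :=
    ((measure_mono (Set.subset_univ _)).trans_lt
      ((freeMeasure_univ_le_one M.m_pos M.a_pos).trans_lt ENNReal.one_lt_top)).ne
  have hBpos : 0 < (χ B).toReal := ENNReal.toReal_pos hR hBfin
  have hBmeas : MeasurableSet B := (isClosed_le continuous_norm continuous_const).measurableSet
  set K' : ℝ := K + J₀ / (2 * θ) * (β * R ^ 2) with hK'
  refine ⟨D + K' - Real.log (χ B).toReal, fun l H T hH F => ?_⟩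
  have hH' : ∀ ω, |H ω| ≤ J₀ / (2 * θ) * l2Inner ω ω + θ / 2 * T := fun ω => by
    refine (hH (θ / 2) (by positivity) ω).trans (le_of_eq ?_)
    ring
  have hup : ∀ ω, F ω * ENNReal.ofReal (Real.exp (H ω - ∫ τ : AddCircle β, M.V l (ω τ))) ≤
      ENNReal.ofReal (Real.exp (D + θ / 2 * T)) *
        (F ω * ENNReal.ofReal (Real.exp (-l2Inner ω ω))) := by
    intro ω
    rw [mul_left_comm, ← ENNReal.ofReal_mul (Real.exp_pos _).le, ← Real.exp_add]
    gcongr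
    have h1 := (le_abs_self _).trans (hH' ω)
    have h2 := hD l ω
    linarith
  have hlow : ENNReal.ofReal (Real.exp (-(K' + θ / 2 * T))) * χ B ≤
      ∫⁻ ω, ENNReal.ofReal (Real.exp (H ω - ∫ τ : AddCircle β, M.V l (ω τ))) ∂χ := by
    rw [← setLIntegral_const]
    refine le_trans (setLIntegral_mono' hBmeas fun ω hω => ?_) (setLIntegral_le_lintegral B _)
    gcongr
    have hω' : ‖ω‖ ≤ R := hω
    have h1 := (neg_abs_le _).trans' (neg_le_neg (hH' ω))
    have h2 := hK l ω hω'
    have h3 : J₀ / (2 * θ) * l2Inner ω ω ≤ J₀ / (2 * θ) * (β * R ^ 2) := by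
      refine mul_le_mul_of_nonneg_left ((l2Inner_self_le ω).trans ?_) (by positivity)
      gcongr
    linarith
  -- the lower bound of the partition function absorbs the other half of `θ T`
  have hconst : ENNReal.ofReal (Real.exp (D + θ / 2 * T)) =
      ENNReal.ofReal (Real.exp (D + K' - Real.log (χ B).toReal + θ * T)) *
        (ENNReal.ofReal (Real.exp (-(K' + θ / 2 * T))) * χ B) := by
    nth_rewrite 2 [← ENNReal.ofReal_toReal hBfin]
    rw [← ENNReal.ofReal_mul (Real.exp_pos _).le, ← ENNReal.ofReal_mul (Real.exp_pos _).le]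
    congr 1
    conv_rhs => rw [← Real.exp_log hBpos]
    simp only [Real.log_exp]
    rw [← Real.exp_add, ← Real.exp_add]
    congr 1
    ring
  calc _ ≤ ∫⁻ ω, ENNReal.ofReal (Real.exp (D + θ / 2 * T)) *
        (F ω * ENNReal.ofReal (Real.exp (-l2Inner ω ω))) ∂χ := lintegral_mono hup
    _ = ENNReal.ofReal (Real.exp (D + θ / 2 * T)) *
        ∫⁻ ω, F ω * ENNReal.ofReal (Real.exp (-l2Inner ω ω)) ∂χ :=
        lintegral_const_mul' _ _ ENNReal.ofReal_ne_top
    _ ≤ _ := by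
        rw [hconst, mul_assoc, mul_assoc, mul_assoc,
          mul_comm (∫⁻ ω, F ω * ENNReal.ofReal (Real.exp (-l2Inner ω ω)) ∂χ), ← mul_assoc (ENNReal.ofReal (Real.exp (-(K' + θ / 2 * T))))]
        gcongr

end OneSite

/-! ### Conditioning on all sites but one -/

section Conditioning

variable {d ν : ℕ} {β : ℝ} [Fact (0 < β)]

instance isFiniteMeasure_freeMeasure (M : Model d ν) :
    IsFiniteMeasure (freeMeasure M.m M.a β ν) :=
  ⟨(freeMeasure_univ_le_one M.m_pos M.a_pos).trans_lt ENNReal.one_lt_top⟩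

/-- An inequality between integrals over a finite product follows from the inequality between the
integrals over one of the variables. -/
lemma lintegral_pi_le_of_update {ι X : Type*} [Fintype ι] [DecidableEq ι] [MeasurableSpace X]
    (χ : Measure X) [SigmaFinite χ] (i : ι) {f g : (ι → X) → ℝ≥0∞} (hf : Measurable f)
    (hg : Measurable g)
    (h : ∀ x, ∫⁻ y, f (Function.update x i y) ∂χ ≤ ∫⁻ y, g (Function.update x i y) ∂χ) :
    ∫⁻ x, f x ∂(Measure.pi fun _ : ι => χ) ≤ ∫⁻ x, g x ∂(Measure.pi fun _ : ι => χ) := by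
  rcases isEmpty_or_nonempty (ι → X) with hE | ⟨⟨x⟩⟩
  · simp [Measure.eq_zero_of_isEmpty]
  rw [lintegral_eq_lmarginal_univ x, lintegral_eq_lmarginal_univ x,
    lmarginal_erase' f hf (Finset.mem_univ i), lmarginal_erase' g hg (Finset.mem_univ i)]
  exact lmarginal_mono h x

/-- The field acting at the site `l`: the interaction of a loop `y` there with the loops `ω` in `Λ`
and the loops `ξ` outside. -/
noncomputable def siteField (M : Model d ν) (Λ : Finset (Lattice d)) (l : Lattice d)
    (ω : LocalConfig Λ β ν) (ξ : Config d β ν) (y : Loop β ν) : ℝ :=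
  ∑ l' : Λ, M.J l l' * l2Inner y (ω l') +
    ∑' l' : {x : Lattice d // x ∉ Λ}, M.J l l' * l2Inner y (ξ l')

/-- The strength at the site `l` of the field caused by the loops outside `Λ`. -/
noncomputable def outerStrength (M : Model d ν) (Λ : Finset (Lattice d)) (l : Lattice d)
    (ξ : Config d β ν) : ℝ :=
  ∑' l' : {x : Lattice d // x ∉ Λ}, |M.J l l'| * l2Inner (ξ l') (ξ l')

/-- The strength `∑ |J_ℓℓ'| |ω_ℓ'|²` of the field acting at the site `l`. -/
noncomputable def fieldStrength (M : Model d ν) (Λ : Finset (Lattice d)) (l : Lattice d)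
    (ω : LocalConfig Λ β ν) (ξ : Config d β ν) : ℝ :=
  ∑ l' : Λ, |M.J l l'| * l2Inner (ω l') (ω l') + outerStrength M Λ l ξ

variable {M : Model d ν} {J₀ : ℝ}

lemma summable_abs_J (hJ : ∀ l (s : Finset (Lattice d)), ∑ l' ∈ s, |M.J l l'| ≤ J₀)
    (l : Lattice d) : Summable fun l' => |M.J l l'| :=
  summable_of_sum_le (fun _ => abs_nonneg _) (hJ l)

lemma abs_J_mul_l2Inner_le {δ : ℝ} (hδ : 0 < δ) (l l' : Lattice d) (y x : Loop β ν) :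
    |M.J l l' * l2Inner y x| ≤
      |M.J l l'| * (l2Inner y y / (4 * δ)) + δ * (|M.J l l'| * l2Inner x x) := by
  rw [abs_mul]
  refine (mul_le_mul_of_nonneg_left (abs_l2Inner_le hδ y x) (abs_nonneg _)).trans (le_of_eq ?_)
  ring

lemma abs_tsum_J_mul_l2Inner_le
    (hJ : ∀ l (s : Finset (Lattice d)), ∑ l' ∈ s, |M.J l l'| ≤ J₀) {Λ : Finset (Lattice d)}
    {l : Lattice d} {ξ : Config d β ν}
    (hξ : Summable fun l' => |M.J l l'| * l2Inner (ξ l') (ξ l')) {δ : ℝ} (hδ : 0 < δ)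
    (y : Loop β ν) :
    |∑' l' : {x : Lattice d // x ∉ Λ}, M.J l l' * l2Inner y (ξ l')| ≤
      (∑' l' : {x : Lattice d // x ∉ Λ}, |M.J l l'|) * (l2Inner y y / (4 * δ)) +
        δ * outerStrength M Λ l ξ := by
  have h1 : Summable fun l' : {x : Lattice d // x ∉ Λ} => |M.J l l'| * (l2Inner y y / (4 * δ)) :=
    ((summable_abs_J hJ l).subtype _).mul_right _
  have h2 : Summable fun l' : {x : Lattice d // x ∉ Λ} =>
      δ * (|M.J l l'| * l2Inner (ξ l') (ξ l')) := (hξ.subtype _).mul_left _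
  rw [outerStrength, ← tsum_mul_right, ← tsum_mul_left, ← h1.tsum_add h2, ← Real.norm_eq_abs]
  refine tsum_of_norm_bounded (h1.add h2).hasSum fun l' => ?_
  rw [Real.norm_eq_abs]
  exact abs_J_mul_l2Inner_le hδ l l' y (ξ l')

lemma tsum_outer_abs_J_le (hJ : ∀ l (s : Finset (Lattice d)), ∑ l' ∈ s, |M.J l l'| ≤ J₀)
    (Λ : Finset (Lattice d)) (l : Lattice d) :
    ∑ l' : Λ, |M.J l l'| + ∑' l' : {x : Lattice d // x ∉ Λ}, |M.J l l'| ≤ J₀ := by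
  rw [Finset.sum_coe_sort Λ fun l' => |M.J l l'|, (summable_abs_J hJ l).sum_add_tsum_subtype_compl]
  exact (summable_abs_J hJ l).tsum_le_of_sum_le (hJ l)

lemma abs_siteField_le (hJ : ∀ l (s : Finset (Lattice d)), ∑ l' ∈ s, |M.J l l'| ≤ J₀)
    {Λ : Finset (Lattice d)} {l : Lattice d} (ω : LocalConfig Λ β ν) {ξ : Config d β ν}
    (hξ : Summable fun l' => |M.J l l'| * l2Inner (ξ l') (ξ l')) {δ : ℝ} (hδ : 0 < δ)
    (y : Loop β ν) :
    |siteField M Λ l ω ξ y| ≤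
      J₀ * (l2Inner y y / (4 * δ)) + δ * fieldStrength M Λ l ω ξ := by
  have h1 : |∑ l' : Λ, M.J l l' * l2Inner y (ω l')| ≤
      (∑ l' : Λ, |M.J l l'|) * (l2Inner y y / (4 * δ)) +
        δ * ∑ l' : Λ, |M.J l l'| * l2Inner (ω l') (ω l') := by
    rw [Finset.sum_mul, Finset.mul_sum, ← Finset.sum_add_distrib]
    exact (Finset.abs_sum_le_sum_abs _ _).trans
      (Finset.sum_le_sum fun l' _ => abs_J_mul_l2Inner_le hδ l l' y (ω l'))
  have h2 := abs_tsum_J_mul_l2Inner_le (Λ := Λ) hJ hξ hδ y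
  have h3 : 0 ≤ l2Inner y y / (4 * δ) := div_nonneg (l2Inner_self_nonneg y) (by positivity)
  have h4 := mul_le_mul_of_nonneg_right (tsum_outer_abs_J_le hJ Λ l) h3
  refine (abs_add_le _ _).trans ((add_le_add h1 h2).trans ?_)
  rw [fieldStrength]
  linarith

lemma sum_update_eq {ι X : Type*} [Fintype ι] [DecidableEq ι] (g : ι → X → ℝ) (ω : ι → X) (i : ι)
    (y : X) : ∑ a, g a (Function.update ω i y a) =
      g i y + ∑ a ∈ Finset.univ.erase i, g a (ω a) := by
  rw [← Finset.add_sum_erase _ _ (Finset.mem_univ i), Function.update_self]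
  congr 1
  refine Finset.sum_congr rfl fun a ha => ?_
  rw [Function.update_of_ne (Finset.ne_of_mem_erase ha)]

lemma siteField_zero (Λ : Finset (Lattice d)) (l : Lattice d) (ω : LocalConfig Λ β ν)
    (ξ : Config d β ν) : siteField M Λ l ω ξ 0 = 0 := by
  simp [siteField, l2Inner_zero_left]

lemma fieldStrength_update (Λ : Finset (Lattice d)) (l : Λ) (ω : LocalConfig Λ β ν)
    (ξ : Config d β ν) (z : Loop β ν) :
    fieldStrength M Λ l (Function.update ω l z) ξ = fieldStrength M Λ l ω ξ := by
  rw [fieldStrength, fieldStrength, sum_update_eq (fun l' : Λ => fun x => |M.J l l'| * l2Inner x x),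
    M.J_diag, abs_zero, zero_mul, zero_add, ← Finset.add_sum_erase _ _ (Finset.mem_univ l),
    M.J_diag, abs_zero, zero_mul, zero_add]

/-- The part of the energy that involves the loop at the site `l`. -/
lemma energy_update (M : Model d ν) (Λ : Finset (Lattice d)) (l : Λ) (ω : LocalConfig Λ β ν)
    (ξ : Config d β ν) (y : Loop β ν) :
    M.energy Λ (Function.update ω l y) ξ =
      (∫ τ : AddCircle β, M.V l (y τ)) - siteField M Λ l ω ξ y +
        M.energy Λ (Function.update ω l 0) ξ := by
  -- the energy of a configuration, split with respect to the loop at `l`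
  have key : ∀ z : Loop β ν, M.energy Λ (Function.update ω l z) ξ =
      (∫ τ : AddCircle β, M.V l (z τ)) - siteField M Λ l ω ξ z +
      (-(1 / 2) * (∑ a ∈ Finset.univ.erase l, ∑ b ∈ Finset.univ.erase l,
          M.J a b * l2Inner (ω a) (ω b))
        + (∑ a ∈ Finset.univ.erase l, ∫ τ : AddCircle β, M.V a (ω a τ))
        - ∑ a ∈ Finset.univ.erase l, ∑' l' : {x : Lattice d // x ∉ Λ},
            M.J a l' * l2Inner (ω a) (ξ l')) := by
    intro z
    have hQ : ∑ a : Λ, ∑ b : Λ,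
        M.J a b * l2Inner (Function.update ω l z a) (Function.update ω l z b) =
        2 * ∑ b ∈ Finset.univ.erase l, M.J l b * l2Inner z (ω b) +
          ∑ a ∈ Finset.univ.erase l, ∑ b ∈ Finset.univ.erase l,
            M.J a b * l2Inner (ω a) (ω b) := by
      have h1 : ∀ a : Λ, ∑ b : Λ,
          M.J a b * l2Inner (Function.update ω l z a) (Function.update ω l z b) =
          M.J a l * l2Inner (Function.update ω l z a) z +
            ∑ b ∈ Finset.univ.erase l, M.J a b * l2Inner (Function.update ω l z a) (ω b) :=
        fun a => sum_update_eq (fun b : Λ => fun x =>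
          M.J a b * l2Inner (Function.update ω l z a) x) ω l z
      rw [Finset.sum_congr rfl fun a _ => h1 a,
        sum_update_eq (fun a : Λ => fun x => M.J a l * l2Inner x z +
          ∑ b ∈ Finset.univ.erase l, M.J a b * l2Inner x (ω b)) ω l z,
        M.J_diag, zero_mul, zero_add, Finset.sum_add_distrib]
      have h2 : ∑ a ∈ Finset.univ.erase l, M.J a l * l2Inner (ω a) z =
          ∑ b ∈ Finset.univ.erase l, M.J l b * l2Inner z (ω b) :=
        Finset.sum_congr rfl fun a _ => by rw [M.J_symm, l2Inner_comm]
      rw [h2]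
      ring
    have hF : ∑ b : Λ, M.J l b * l2Inner z (ω b) =
        ∑ b ∈ Finset.univ.erase l, M.J l b * l2Inner z (ω b) := by
      rw [← Finset.add_sum_erase _ _ (Finset.mem_univ l), M.J_diag, zero_mul, zero_add]
    rw [Model.energy, Model.localEnergy, hQ, siteField, hF,
      sum_update_eq (fun a : Λ => fun x => ∫ τ : AddCircle β, M.V a (x τ)) ω l z,
      sum_update_eq (fun a : Λ => fun x => ∑' l' : {x : Lattice d // x ∉ Λ},
        M.J a l' * l2Inner x (ξ l')) ω l z]
    ring
  rw [key y, key 0, siteField_zero]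
  simp [M.V_zero]

lemma measurable_l2Inner {Ω : Type*} [MeasurableSpace Ω] {f g : Ω → Loop β ν} (hf : Measurable f)
    (hg : Measurable g) : Measurable fun x => l2Inner (f x) (g x) :=
  continuous_l2Inner.measurable.comp (hf.prodMk hg)

lemma measurable_energy (M : Model d ν) (Λ : Finset (Lattice d)) (ξ : Config d β ν) :
    Measurable fun ω : LocalConfig Λ β ν => M.energy Λ ω ξ := by
  have hcoord : ∀ a : Λ, Measurable fun ω : LocalConfig Λ β ν => ω a := measurable_pi_apply
  unfold Model.energy Model.localEnergy
  refine ((measurable_const.mul ?_).add ?_).sub ?_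
  · exact Finset.measurable_fun_sum _ fun a _ => Finset.measurable_fun_sum _ fun b _ =>
      (measurable_l2Inner (hcoord a) (hcoord b)).const_mul _
  · exact Finset.measurable_fun_sum _ fun a _ =>
      (continuous_integral_comp (M.V_continuous a)).measurable.comp (hcoord a)
  · exact Finset.measurable_fun_sum _ fun a _ => Measurable.tsum fun b =>
      (measurable_l2Inner (hcoord a) measurable_const).const_mul _

lemma measurable_fieldStrength (M : Model d ν) (Λ : Finset (Lattice d)) (l : Lattice d)
    (ξ : Config d β ν) : Measurable fun ω : LocalConfig Λ β ν => fieldStrength M Λ l ω ξ := by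
  have hcoord : ∀ a : Λ, Measurable fun ω : LocalConfig Λ β ν => ω a := measurable_pi_apply
  unfold fieldStrength
  exact (Finset.measurable_fun_sum _ fun b _ =>
    (measurable_l2Inner (hcoord b) (hcoord b)).const_mul _).add
      measurable_const

/-- The one-site estimate inside a finite volume. -/
lemma lintegral_site_le (hJ : ∀ l (s : Finset (Lattice d)), ∑ l' ∈ s, |M.J l l'| ≤ J₀)
    {θ C : ℝ} (hC : OneSiteBound M β θ J₀ C) {Λ : Finset (Lattice d)} (l : Λ) {ξ : Config d β ν}
    (hξ : Summable fun l' => |M.J l l'| * l2Inner (ξ l') (ξ l')) {F : Loop β ν → ℝ≥0∞}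
    (hF : Measurable F) :
    ∫⁻ ω, F (ω l) * ENNReal.ofReal (Real.exp (-M.energy Λ ω ξ)) ∂(M.freeLocal β Λ) ≤
      ∫⁻ ω, ENNReal.ofReal (Real.exp (C + θ * fieldStrength M Λ l ω ξ)) *
        (∫⁻ y, F y * ENNReal.ofReal (Real.exp (-l2Inner y y)) ∂(freeMeasure M.m M.a β ν)) *
        ENNReal.ofReal (Real.exp (-M.energy Λ ω ξ)) ∂(M.freeLocal β Λ) := by
  have hdens : Measurable fun ω : LocalConfig Λ β ν =>
      ENNReal.ofReal (Real.exp (-M.energy Λ ω ξ)) :=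
    (Real.measurable_exp.comp (measurable_energy M Λ ξ).neg).ennreal_ofReal
  refine lintegral_pi_le_of_update (freeMeasure M.m M.a β ν) l
    ((hF.comp (measurable_pi_apply l)).mul hdens) ?_ fun ω => ?_
  · refine (Measurable.mul_const ?_ _).mul hdens
    exact (Real.measurable_exp.comp
      (((measurable_fieldStrength M Λ l ξ).const_mul θ).const_add C)).ennreal_ofReal
  · obtain ⟨c, hc, hsplit⟩ : ∃ c ≠ ∞, ∀ y : Loop β ν,
        ENNReal.ofReal (Real.exp (-M.energy Λ (Function.update ω l y) ξ)) =
        ENNReal.ofReal (Real.exp (siteField M Λ l ω ξ y - ∫ τ : AddCircle β, M.V l (y τ))) *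
          c := by
      refine ⟨ENNReal.ofReal (Real.exp (-M.energy Λ (Function.update ω l 0) ξ)),
        ENNReal.ofReal_ne_top, fun y => ?_⟩
      rw [energy_update, ← ENNReal.ofReal_mul (Real.exp_pos _).le, ← Real.exp_add]
      congr 2
      ring
    simp only [hsplit, Function.update_self, fieldStrength_update]
    simp only [← mul_assoc]
    rw [lintegral_mul_const' _ _ hc, lintegral_mul_const' _ _ hc]
    refine mul_le_mul_left ?_ _
    refine (hC l (siteField M Λ l ω ξ) (fieldStrength M Λ l ω ξ)
      (fun δ hδ y => abs_siteField_le hJ ω hξ hδ y) F).trans ?_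
    rw [lintegral_const_mul]
    refine (Real.measurable_exp.comp (Measurable.sub ?_ ?_)).ennreal_ofReal
    · unfold siteField
      exact (Finset.measurable_fun_sum _ fun b _ =>
        (measurable_l2Inner measurable_id measurable_const).const_mul _).add
        (Measurable.tsum fun b => (measurable_l2Inner measurable_id measurable_const).const_mul _)
    · exact (continuous_integral_comp (M.V_continuous l)).measurable

/-- Stability: the energy dominates the sum of the squared norms. -/
lemma exists_sum_sub_energy_le
    (hJ : ∀ l (s : Finset (Lattice d)), ∑ l' ∈ s, |M.J l l'| ≤ J₀) (Λ : Finset (Lattice d))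
    {ξ : Config d β ν} (hξ : ∀ l, Summable fun l' => |M.J l l'| * l2Inner (ξ l') (ξ l')) :
    ∃ C : ℝ, ∀ ω : LocalConfig Λ β ν, ∑ l : Λ, l2Inner (ω l) (ω l) - M.energy Λ ω ξ ≤ C := by
  have hJ0 : 0 ≤ J₀ := by simpa using hJ 0 ∅
  obtain ⟨D, hD⟩ := exists_mul_l2Inner_self_sub_le (β := β) M (c := 1 + J₀ / 2 + J₀ / 4)
    (by positivity)
  refine ⟨∑ l : Λ, (D + outerStrength M Λ l ξ), fun ω => ?_⟩
  have hJΛ : ∀ a : Λ, ∑ b : Λ, |M.J a b| ≤ J₀ := fun a => by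
    rw [Finset.sum_coe_sort Λ fun l' => |M.J a l'|]; exact hJ a Λ
  have hQ : ∑ a : Λ, ∑ b : Λ, M.J a b * l2Inner (ω a) (ω b) ≤
      ∑ a : Λ, J₀ * l2Inner (ω a) (ω a) := by
    have h1 : ∑ a : Λ, ∑ b : Λ, M.J a b * l2Inner (ω a) (ω b) ≤
        ∑ a : Λ, ∑ b : Λ, |M.J a b| * (l2Inner (ω a) (ω a) / 2) +
        ∑ a : Λ, ∑ b : Λ, |M.J a b| * (l2Inner (ω b) (ω b) / 2) := by
      rw [← Finset.sum_add_distrib]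
      refine Finset.sum_le_sum fun a _ => ?_
      rw [← Finset.sum_add_distrib]
      refine Finset.sum_le_sum fun b _ => ?_
      refine (le_abs_self _).trans ((abs_J_mul_l2Inner_le (δ := 1 / 2) (by norm_num) _ _ _
        _).trans (le_of_eq ?_))
      ring
    have h2 : ∑ a : Λ, ∑ b : Λ, |M.J a b| * (l2Inner (ω b) (ω b) / 2) =
        ∑ a : Λ, ∑ b : Λ, |M.J a b| * (l2Inner (ω a) (ω a) / 2) := by
      rw [Finset.sum_comm]
      refine Finset.sum_congr rfl fun a _ => Finset.sum_congr rfl fun b _ => ?_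
      rw [M.J_symm]
    rw [h2, ← two_mul, Finset.mul_sum] at h1
    refine h1.trans (Finset.sum_le_sum fun a _ => ?_)
    rw [← Finset.sum_mul]
    have := mul_le_mul_of_nonneg_right (hJΛ a) (l2Inner_self_nonneg (ω a))
    linarith
  have hO : ∀ a : Λ, ∑' l' : {x : Lattice d // x ∉ Λ}, M.J a l' * l2Inner (ω a) (ξ l') ≤
      J₀ / 4 * l2Inner (ω a) (ω a) + outerStrength M Λ a ξ := by
    intro a
    have h1 := (le_abs_self _).trans
      (abs_tsum_J_mul_l2Inner_le (Λ := Λ) hJ (hξ a) one_pos (ω a))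
    have h2 := tsum_outer_abs_J_le hJ Λ a
    have h3 : 0 ≤ ∑ b : Λ, |M.J a b| := Finset.sum_nonneg fun b _ => abs_nonneg _
    have h4 : 0 ≤ l2Inner (ω a) (ω a) / (4 * 1) :=
      div_nonneg (l2Inner_self_nonneg _) (by norm_num)
    have h5 := mul_le_mul_of_nonneg_right (by linarith :
      ∑' l' : {x : Lattice d // x ∉ Λ}, |M.J a l'| ≤ J₀) h4
    linarith
  have hO' := Finset.sum_le_sum fun (a : Λ) (_ : a ∈ Finset.univ) => hO a
  have hV' := Finset.sum_le_sum fun (a : Λ) (_ : a ∈ Finset.univ) => hD a (ω a)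
  rw [Model.energy, Model.localEnergy]
  simp only [Finset.sum_add_distrib, Finset.sum_sub_distrib, ← Finset.mul_sum] at hO' hV' hQ ⊢
  linarith

lemma freeLocal_univ_le_one (M : Model d ν) (Λ : Finset (Lattice d)) :
    M.freeLocal β Λ Set.univ ≤ 1 := by
  rw [Model.freeLocal, Measure.pi_univ]
  exact Finset.prod_le_one' fun _ _ => freeMeasure_univ_le_one M.m_pos M.a_pos

lemma freeLocal_univ_ne_zero (hν : 0 < ν) (M : Model d ν) (Λ : Finset (Lattice d)) :
    M.freeLocal β Λ Set.univ ≠ 0 := by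
  rw [Model.freeLocal, Measure.pi_univ]
  obtain ⟨R, -, hR⟩ := exists_freeMeasure_ball_ne_zero (β := β) hν M.m_pos M.a_pos
  exact Finset.prod_ne_zero_iff.2 fun _ _ h0 => hR (measure_mono_null (Set.subset_univ _) h0)

end Conditioning

/-! ### Uniform bounds for finite-volume Gibbs measures -/

section FiniteVolume

variable {d ν : ℕ} {β : ℝ} [Fact (0 < β)] {M : Model d ν} {J₀ : ℝ}

lemma measurable_density (M : Model d ν) (Λ : Finset (Lattice d)) (ξ : Config d β ν) :
    Measurable fun ω : LocalConfig Λ β ν => ENNReal.ofReal (Real.exp (-M.energy Λ ω ξ)) :=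
  (Real.measurable_exp.comp (measurable_energy M Λ ξ).neg).ennreal_ofReal

lemma partitionFn_ne_zero (hν : 0 < ν) (M : Model d ν) (Λ : Finset (Lattice d))
    (ξ : Config d β ν) : M.partitionFn Λ ξ ≠ 0 := by
  intro h
  rw [Model.partitionFn, lintegral_eq_zero_iff (measurable_density M Λ ξ)] at h
  refine freeLocal_univ_ne_zero (β := β) hν M Λ ?_
  have hF : ∀ᵐ _ω ∂(M.freeLocal β Λ), False := h.mono fun ω hω =>
    (ENNReal.ofReal_pos.2 (Real.exp_pos _)).ne' hω
  exact Measure.measure_univ_eq_zero.2 (ae_eq_bot.1 (Filter.eventually_false_iff_eq_bot.1 hF))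

lemma partitionFn_ne_top (hJ : ∀ l (s : Finset (Lattice d)), ∑ l' ∈ s, |M.J l l'| ≤ J₀)
    (Λ : Finset (Lattice d)) {ξ : Config d β ν}
    (hξ : ∀ l, Summable fun l' => |M.J l l'| * l2Inner (ξ l') (ξ l')) :
    M.partitionFn Λ ξ ≠ ∞ := by
  obtain ⟨C, hC⟩ := exists_sum_sub_energy_le hJ Λ hξ
  refine ne_top_of_le_ne_top (b := ENNReal.ofReal (Real.exp C) * 1)
    (by simp) ?_
  calc M.partitionFn Λ ξ ≤ ∫⁻ _ω, ENNReal.ofReal (Real.exp C) ∂(M.freeLocal β Λ) := by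
        refine lintegral_mono fun ω => ENNReal.ofReal_le_ofReal (Real.exp_le_exp.2 ?_)
        have h1 : 0 ≤ ∑ l : Λ, l2Inner (ω l) (ω l) :=
          Finset.sum_nonneg fun l _ => l2Inner_self_nonneg _
        have := hC ω
        linarith
    _ ≤ _ := by
        rw [lintegral_const]
        exact mul_le_mul_right (freeLocal_univ_le_one M Λ) _

/-- The distribution under `π_Λ(· | ξ)` of the loops in `Λ`. -/
noncomputable def localGibbs (M : Model d ν) (Λ : Finset (Lattice d)) (ξ : Config d β ν) :
    Measure (LocalConfig Λ β ν) :=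
  (M.partitionFn Λ ξ)⁻¹ •
    (M.freeLocal β Λ).withDensity fun ω => ENNReal.ofReal (Real.exp (-M.energy Λ ω ξ))

lemma lintegral_localGibbs (Λ : Finset (Lattice d)) (ξ : Config d β ν)
    {f : LocalConfig Λ β ν → ℝ≥0∞} (hf : Measurable f) :
    ∫⁻ ω, f ω ∂(localGibbs M Λ ξ) = (M.partitionFn Λ ξ)⁻¹ *
      ∫⁻ ω, f ω * ENNReal.ofReal (Real.exp (-M.energy Λ ω ξ)) ∂(M.freeLocal β Λ) := by
  rw [localGibbs, lintegral_smul_measure, smul_eq_mul,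
    lintegral_withDensity_eq_lintegral_mul _ (measurable_density M Λ ξ) hf]
  simp only [Pi.mul_apply, mul_comm]

lemma isProbabilityMeasure_localGibbs (hν : 0 < ν)
    (hJ : ∀ l (s : Finset (Lattice d)), ∑ l' ∈ s, |M.J l l'| ≤ J₀)
    (Λ : Finset (Lattice d)) {ξ : Config d β ν}
    (hξ : ∀ l, Summable fun l' => |M.J l l'| * l2Inner (ξ l') (ξ l')) :
    IsProbabilityMeasure (localGibbs M Λ ξ) := by
  refine ⟨?_⟩
  rw [← lintegral_one, lintegral_localGibbs Λ ξ measurable_const]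
  simp only [one_mul]
  exact ENNReal.inv_mul_cancel (partitionFn_ne_zero hν M Λ ξ) (partitionFn_ne_top hJ Λ hξ)

/-- The exponential moment `∫ exp |ω_ℓ|² dπ_Λ(· | ξ)`. -/
noncomputable def expMoment (M : Model d ν) (Λ : Finset (Lattice d)) (ξ : Config d β ν) (l : Λ) :
    ℝ≥0∞ :=
  ∫⁻ ω, ENNReal.ofReal (Real.exp (l2Inner (ω l) (ω l))) ∂(localGibbs M Λ ξ)

lemma measurable_exp_l2Inner_self :
    Measurable fun y : Loop β ν => ENNReal.ofReal (Real.exp (l2Inner y y)) :=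
  (Real.measurable_exp.comp (measurable_l2Inner measurable_id measurable_id)).ennreal_ofReal

lemma measurable_exp_l2Inner_coord (Λ : Finset (Lattice d)) (l : Λ) :
    Measurable fun ω : LocalConfig Λ β ν => ENNReal.ofReal (Real.exp (l2Inner (ω l) (ω l))) :=
  measurable_exp_l2Inner_self.comp (measurable_pi_apply l)

lemma expMoment_ne_top (hν : 0 < ν)
    (hJ : ∀ l (s : Finset (Lattice d)), ∑ l' ∈ s, |M.J l l'| ≤ J₀)
    {Λ : Finset (Lattice d)} {ξ : Config d β ν}
    (hξ : ∀ l, Summable fun l' => |M.J l l'| * l2Inner (ξ l') (ξ l')) (l : Λ) :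
    expMoment M Λ ξ l ≠ ∞ := by
  obtain ⟨C, hC⟩ := exists_sum_sub_energy_le hJ Λ hξ
  rw [expMoment, lintegral_localGibbs Λ ξ (measurable_exp_l2Inner_coord Λ l)]
  refine ENNReal.mul_ne_top (ENNReal.inv_ne_top.2 (partitionFn_ne_zero hν M Λ ξ)) ?_
  refine ne_top_of_le_ne_top (b := ENNReal.ofReal (Real.exp C) * 1) (by simp) ?_
  calc _ ≤ ∫⁻ _ω, ENNReal.ofReal (Real.exp C) ∂(M.freeLocal β Λ) := by
        refine lintegral_mono fun ω => ?_
        rw [← ENNReal.ofReal_mul (Real.exp_pos _).le, ← Real.exp_add]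
        refine ENNReal.ofReal_le_ofReal (Real.exp_le_exp.2 ?_)
        have h1 : l2Inner (ω l) (ω l) ≤ ∑ a : Λ, l2Inner (ω a) (ω a) :=
          Finset.single_le_sum (f := fun a : Λ => l2Inner (ω a) (ω a))
            (fun a _ => l2Inner_self_nonneg _) (Finset.mem_univ l)
        have := hC ω
        linarith
    _ ≤ _ := by
        rw [lintegral_const]
        exact mul_le_mul_right (freeLocal_univ_le_one M Λ) _

lemma exists_expMoment_eq (hν : 0 < ν)
    (hJ : ∀ l (s : Finset (Lattice d)), ∑ l' ∈ s, |M.J l l'| ≤ J₀)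
    {Λ : Finset (Lattice d)} {ξ : Config d β ν}
    (hξ : ∀ l, Summable fun l' => |M.J l l'| * l2Inner (ξ l') (ξ l')) (l : Λ) :
    ∃ n : ℝ, 0 ≤ n ∧ expMoment M Λ ξ l = ENNReal.ofReal (Real.exp n) := by
  have := isProbabilityMeasure_localGibbs hν hJ Λ hξ
  have hfin := expMoment_ne_top hν hJ hξ l
  have h1 : 1 ≤ expMoment M Λ ξ l := by
    calc (1 : ℝ≥0∞) = ∫⁻ _ω, 1 ∂(localGibbs M Λ ξ) := by simp
      _ ≤ _ := lintegral_mono fun ω => by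
          rw [← ENNReal.ofReal_one]
          exact ENNReal.ofReal_le_ofReal (Real.one_le_exp (l2Inner_self_nonneg _))
  have h2 : 1 ≤ (expMoment M Λ ξ l).toReal := by
    have := ENNReal.toReal_mono hfin h1
    simpa using this
  refine ⟨Real.log (expMoment M Λ ξ l).toReal, Real.log_nonneg h2, ?_⟩
  rw [Real.exp_log (by linarith), ENNReal.ofReal_toReal hfin]

/-- Hölder's inequality for the exponential of the field strength. -/
lemma lintegral_exp_fieldStrength_le (hν : 0 < ν)
    (hJ : ∀ l (s : Finset (Lattice d)), ∑ l' ∈ s, |M.J l l'| ≤ J₀)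
    {θ C : ℝ} (hθ : 0 ≤ θ) (hθJ : θ * J₀ ≤ 1) {Λ : Finset (Lattice d)} (l : Lattice d)
    {ξ : Config d β ν} (hξ : ∀ l, Summable fun l' => |M.J l l'| * l2Inner (ξ l') (ξ l'))
    {n : Λ → ℝ} (hn : ∀ a, expMoment M Λ ξ a = ENNReal.ofReal (Real.exp (n a))) :
    ∫⁻ ω, ENNReal.ofReal (Real.exp (C + θ * fieldStrength M Λ l ω ξ)) ∂(localGibbs M Λ ξ) ≤
      ENNReal.ofReal (Real.exp
        (C + θ * (∑ a : Λ, |M.J l a| * n a + outerStrength M Λ l ξ))) := by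
  have := isProbabilityMeasure_localGibbs hν hJ Λ hξ
  have hpow : ∀ x p : ℝ, ENNReal.ofReal (Real.exp x) ^ p = ENNReal.ofReal (Real.exp (p * x)) := by
    intro x p
    rw [ENNReal.ofReal_rpow_of_pos (Real.exp_pos _), ← Real.exp_mul, mul_comm]
  have hprod : ∀ x : Λ → ℝ, ∏ a : Λ, ENNReal.ofReal (Real.exp (x a)) ^ (θ * |M.J l a|) =
      ENNReal.ofReal (Real.exp (θ * ∑ a : Λ, |M.J l a| * x a)) := by
    intro x
    rw [Finset.mul_sum, Real.exp_sum, ENNReal.ofReal_prod_of_nonneg fun a _ => (Real.exp_pos _).le]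
    refine Finset.prod_congr rfl fun a _ => ?_
    rw [hpow]; congr 2; ring
  -- the exponents `θ |J_ℓℓ'|` add up to at most one; the constant `1` takes the remainder
  have hsum : ∑ a : Λ, θ * |M.J l a| ≤ 1 := by
    rw [← Finset.mul_sum, Finset.sum_coe_sort Λ fun l' => |M.J l l'|]
    exact (mul_le_mul_of_nonneg_left (hJ l Λ) hθ).trans hθJ
  have hH := ENNReal.lintegral_mul_prod_norm_pow_le (μ := localGibbs M Λ ξ) Finset.univ
    (g := fun _ => 1) (f := fun (a : Λ) ω => ENNReal.ofReal (Real.exp (l2Inner (ω a) (ω a))))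
    aemeasurable_const (fun a _ => (measurable_exp_l2Inner_coord Λ a).aemeasurable)
    (1 - ∑ a : Λ, θ * |M.J l a|) (p := fun a => θ * |M.J l a|) (by ring) (by linarith)
    (fun a _ => mul_nonneg hθ (abs_nonneg _))
  simp only [ENNReal.one_rpow, one_mul, lintegral_one, measure_univ] at hH
  have hn' : ∀ a : Λ, ∫⁻ ω, ENNReal.ofReal (Real.exp (l2Inner (ω a) (ω a))) ∂(localGibbs M Λ ξ) =
    ENNReal.ofReal (Real.exp (n a)) := hn
  simp only [hn', hprod] at hH
  have hsplit : ∀ ω : LocalConfig Λ β ν,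
      ENNReal.ofReal (Real.exp (C + θ * fieldStrength M Λ l ω ξ)) =
      ENNReal.ofReal (Real.exp (C + θ * outerStrength M Λ l ξ)) *
        ENNReal.ofReal (Real.exp (θ * ∑ a : Λ, |M.J l a| * l2Inner (ω a) (ω a))) := by
    intro ω
    rw [← ENNReal.ofReal_mul (Real.exp_pos _).le, ← Real.exp_add, fieldStrength]
    congr 2; ring
  have hjoin : ENNReal.ofReal (Real.exp
        (C + θ * (∑ a : Λ, |M.J l a| * n a + outerStrength M Λ l ξ))) =
      ENNReal.ofReal (Real.exp (C + θ * outerStrength M Λ l ξ)) *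
        ENNReal.ofReal (Real.exp (θ * ∑ a : Λ, |M.J l a| * n a)) := by
    rw [← ENNReal.ofReal_mul (Real.exp_pos _).le, ← Real.exp_add]
    congr 2; ring
  simp only [hsplit]
  rw [hjoin, lintegral_const_mul' _ _ ENNReal.ofReal_ne_top]
  exact mul_le_mul_right hH _

lemma lintegral_localGibbs_site_le
    (hJ : ∀ l (s : Finset (Lattice d)), ∑ l' ∈ s, |M.J l l'| ≤ J₀)
    {θ C : ℝ} (hC : OneSiteBound M β θ J₀ C) {Λ : Finset (Lattice d)} (l : Λ) {ξ : Config d β ν}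
    (hξ : ∀ l, Summable fun l' => |M.J l l'| * l2Inner (ξ l') (ξ l')) {F : Loop β ν → ℝ≥0∞}
    (hF : Measurable F) :
    ∫⁻ ω, F (ω l) ∂(localGibbs M Λ ξ) ≤
      (∫⁻ y, F y * ENNReal.ofReal (Real.exp (-l2Inner y y)) ∂(freeMeasure M.m M.a β ν)) *
      ∫⁻ ω, ENNReal.ofReal (Real.exp (C + θ * fieldStrength M Λ l ω ξ)) ∂(localGibbs M Λ ξ) := by
  have hmeas : Measurable fun ω : LocalConfig Λ β ν =>
      ENNReal.ofReal (Real.exp (C + θ * fieldStrength M Λ l ω ξ)) :=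
    (Real.measurable_exp.comp
      (((measurable_fieldStrength M Λ l ξ).const_mul θ).const_add C)).ennreal_ofReal
  rw [← lintegral_const_mul _ hmeas, lintegral_localGibbs Λ ξ (f := fun ω => F (ω l)) (hF.comp (measurable_pi_apply l)),
    lintegral_localGibbs Λ ξ (hmeas.const_mul _)]
  refine mul_le_mul_right ((lintegral_site_le hJ hC l (hξ l) hF).trans (le_of_eq ?_)) _
  refine lintegral_congr fun ω => ?_
  rw [mul_comm (ENNReal.ofReal (Real.exp (C + θ * fieldStrength M Λ l ω ξ)))]

/-- The weighted norm of a configuration outside `Λ`. -/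
noncomputable def outerWeight (w : Lattice d → Lattice d → ℝ) (Λ : Finset (Lattice d))
    (l₀ : Lattice d) (ξ : Config d β ν) : ℝ :=
  ∑' l : {x : Lattice d // x ∉ Λ}, w l₀ l * l2Inner (ξ l) (ξ l)

variable {w : Lattice d → Lattice d → ℝ} {W D : ℝ}

lemma IsWeight.summable_abs_J_mul (hw : IsWeight M w W D) {ξ : Config d β ν}
    (hξ : ∀ l₀, Summable fun l => w l₀ l * l2Inner (ξ l) (ξ l)) (l : Lattice d) :
    Summable fun l' => |M.J l l'| * l2Inner (ξ l') (ξ l') := by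
  refine Summable.of_nonneg_of_le
    (fun l' => mul_nonneg (abs_nonneg _) (l2Inner_self_nonneg _)) (fun l' => ?_)
    ((hξ l).mul_left D)
  rw [← mul_assoc]
  exact mul_le_mul_of_nonneg_right (hw.abs_J_le l l') (l2Inner_self_nonneg _)

/-- A system of inequalities `n_ℓ ≤ C + θ ∑ |J_ℓℓ'| n_ℓ' + …` with small `θ` is solved in the
weighted norm. -/
lemma IsWeight.sum_mul_le (hw : IsWeight M w W D) {θ C : ℝ} (hC : 0 ≤ C) (hθ : 0 ≤ θ)
    (hθD : θ * D ≤ 1 / 2) {Λ : Finset (Lattice d)} {n : Λ → ℝ} (hn : ∀ l, 0 ≤ n l)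
    {ξ : Config d β ν} (hξ : ∀ l₀, Summable fun l => w l₀ l * l2Inner (ξ l) (ξ l))
    (h : ∀ l : Λ, n l ≤ C + θ * (∑ a : Λ, |M.J l a| * n a + outerStrength M Λ l ξ))
    (l₀ : Lattice d) :
    ∑ l : Λ, w l₀ l * n l ≤ 2 * C * W + outerWeight w Λ l₀ ξ := by
  set S := ∑ l : Λ, w l₀ l * n l with hS
  have hJx := hw.summable_abs_J_mul hξ
  have hS0 : 0 ≤ S := Finset.sum_nonneg fun l _ => mul_nonneg (hw.pos _ _).le (hn l)
  have hT0 : 0 ≤ outerWeight w Λ l₀ ξ :=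
    tsum_nonneg fun l => mul_nonneg (hw.pos _ _).le (l2Inner_self_nonneg _)
  have ha : ∑ l : Λ, w l₀ l ≤ W := by
    rw [Finset.sum_coe_sort Λ fun l => w l₀ l]; exact hw.sum_le l₀ Λ
  have hsumJ : ∀ b : Lattice d, ∑ l : Λ, w l₀ l * |M.J l b| ≤ D * w l₀ b := fun b => by
    rw [Finset.sum_coe_sort Λ fun l => w l₀ l * |M.J l b|]; exact hw.sum_mul_abs_J_le l₀ b Λ
  have hb : ∑ l : Λ, w l₀ l * ∑ a : Λ, |M.J l a| * n a ≤ D * S := by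
    simp_rw [Finset.mul_sum]
    rw [Finset.sum_comm, hS, Finset.mul_sum]
    refine Finset.sum_le_sum fun a _ => ?_
    have := mul_le_mul_of_nonneg_right (hsumJ a) (hn a)
    rw [Finset.sum_mul] at this
    simpa only [mul_assoc] using this
  have hc : ∑ l : Λ, w l₀ l * outerStrength M Λ l ξ ≤ D * outerWeight w Λ l₀ ξ := by
    have hsm : ∀ l : Λ, Summable fun b : {x : Lattice d // x ∉ Λ} =>
        w l₀ l * (|M.J l b| * l2Inner (ξ b) (ξ b)) :=
      fun l => ((hJx l).subtype _).mul_left _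
    simp_rw [outerStrength, ← tsum_mul_left]
    rw [← Summable.tsum_finsetSum fun l _ => hsm l, outerWeight, ← tsum_mul_left]
    refine (summable_sum fun l _ => hsm l).tsum_le_tsum (fun b => ?_)
      (((hξ l₀).subtype _).mul_left D)
    have := mul_le_mul_of_nonneg_right (hsumJ b) (l2Inner_self_nonneg (ξ b))
    rw [Finset.sum_mul] at this
    simpa only [mul_assoc] using this
  have hmain : S ≤ C * ∑ l : Λ, w l₀ l + θ * (∑ l : Λ, w l₀ l * ∑ a : Λ, |M.J l a| * n a +
      ∑ l : Λ, w l₀ l * outerStrength M Λ l ξ) := by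
    rw [← Finset.sum_add_distrib, Finset.mul_sum, Finset.mul_sum, ← Finset.sum_add_distrib]
    refine Finset.sum_le_sum fun l _ => ?_
    refine (mul_le_mul_of_nonneg_left (h l) (hw.pos l₀ l).le).trans (le_of_eq ?_)
    ring
  have h1 := mul_le_mul_of_nonneg_left ha hC
  have h2 := mul_le_mul_of_nonneg_left (add_le_add hb hc) hθ
  have h3 := mul_le_mul_of_nonneg_right hθD hS0
  have h4 := mul_le_mul_of_nonneg_right hθD hT0
  linarith

/-- The expectation of a function of a single loop in a finite volume, bounded uniformly in the
volume up to the influence `outerWeight` of the boundary condition. -/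
lemma lintegral_localGibbs_le (hν : 0 < ν) (hw : IsWeight M w W D) {θ C : ℝ} (hC0 : 0 ≤ C)
    (hθ : 0 ≤ θ) (hθD : θ * D ≤ 1 / 2) (hC : OneSiteBound M β θ D C) {Λ : Finset (Lattice d)}
    (l₀ : Λ) {ξ : Config d β ν} (hξ : ∀ l₀, Summable fun l => w l₀ l * l2Inner (ξ l) (ξ l))
    {F : Loop β ν → ℝ≥0∞} (hF : Measurable F) :
    ∫⁻ ω, F (ω l₀) ∂(localGibbs M Λ ξ) ≤
      (∫⁻ y, F y * ENNReal.ofReal (Real.exp (-l2Inner y y)) ∂(freeMeasure M.m M.a β ν)) *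
        ENNReal.ofReal (Real.exp (C + C * W + outerWeight w Λ l₀ ξ)) := by
  have hJx := hw.summable_abs_J_mul hξ
  choose n hn0 hn using exists_expMoment_eq (M := M) (Λ := Λ) hν hw.J_le hJx
  have hθ1 : θ * D ≤ 1 := by linarith
  have hfield : ∀ l : Lattice d,
      ∫⁻ ω, ENNReal.ofReal (Real.exp (C + θ * fieldStrength M Λ l ω ξ)) ∂(localGibbs M Λ ξ) ≤
      ENNReal.ofReal (Real.exp
        (C + θ * (∑ a : Λ, |M.J l a| * n a + outerStrength M Λ l ξ))) :=
    fun l => lintegral_exp_fieldStrength_le hν hw.J_le hθ hθ1 l hJx hn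
  have hrec : ∀ l : Λ, n l ≤ C + θ * (∑ a : Λ, |M.J l a| * n a + outerStrength M Λ l ξ) := by
    intro l
    have h1 := lintegral_localGibbs_site_le hw.J_le hC l hJx
      (F := fun y => ENNReal.ofReal (Real.exp (l2Inner y y))) measurable_exp_l2Inner_self
    have h2 : ∫⁻ y : Loop β ν, ENNReal.ofReal (Real.exp (l2Inner y y)) *
        ENNReal.ofReal (Real.exp (-l2Inner y y)) ∂(freeMeasure M.m M.a β ν) ≤ 1 := by
      have : ∀ y : Loop β ν, ENNReal.ofReal (Real.exp (l2Inner y y)) *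
          ENNReal.ofReal (Real.exp (-l2Inner y y)) = 1 := fun y => by
        rw [← ENNReal.ofReal_mul (Real.exp_pos _).le, ← Real.exp_add, add_neg_cancel,
          Real.exp_zero, ENNReal.ofReal_one]
      simp only [this, lintegral_one]
      exact freeMeasure_univ_le_one M.m_pos M.a_pos
    have h3 := h1.trans (mul_le_mul' h2 (hfield l))
    have h4 : ∫⁻ ω, ENNReal.ofReal (Real.exp (l2Inner (ω l) (ω l))) ∂(localGibbs M Λ ξ) =
      ENNReal.ofReal (Real.exp (n l)) := hn l
    rw [h4, one_mul, ENNReal.ofReal_le_ofReal_iff (Real.exp_pos _).le, Real.exp_le_exp] at h3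
    exact h3
  have hS := hw.sum_mul_le hC0 hθ hθD hn0 hξ hrec l₀
  refine (lintegral_localGibbs_site_le hw.J_le hC l₀ hJx hF).trans
    (mul_le_mul_right ((hfield l₀).trans ?_) _)
  refine ENNReal.ofReal_le_ofReal (Real.exp_le_exp.2 ?_)
  have hT0 : 0 ≤ outerWeight w Λ l₀ ξ :=
    tsum_nonneg fun l => mul_nonneg (hw.pos _ _).le (l2Inner_self_nonneg _)
  have h1 : ∑ a : Λ, |M.J l₀ a| * n a ≤ D * ∑ a : Λ, w l₀ a * n a := by
    rw [Finset.mul_sum]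
    refine Finset.sum_le_sum fun a _ => ?_
    rw [← mul_assoc]
    exact mul_le_mul_of_nonneg_right (hw.abs_J_le _ _) (hn0 a)
  have h2 : outerStrength M Λ l₀ ξ ≤ D * outerWeight w Λ l₀ ξ := by
    rw [outerWeight, ← tsum_mul_left]
    refine ((hJx l₀).subtype _).tsum_le_tsum (fun b => ?_) (((hξ l₀).subtype _).mul_left D)
    have := mul_le_mul_of_nonneg_right (hw.abs_J_le l₀ b) (l2Inner_self_nonneg (ξ b))
    simpa only [mul_assoc] using this
  have h3 := mul_le_mul_of_nonneg_left (add_le_add h1 h2) hθ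
  have hS0 : 0 ≤ ∑ l : Λ, w l₀ l * n l :=
    Finset.sum_nonneg fun l _ => mul_nonneg (hw.pos _ _).le (hn0 l)
  have h4 := mul_le_mul_of_nonneg_right hθD hS0
  have h5 := mul_le_mul_of_nonneg_right hθD hT0
  linarith

end FiniteVolume

/-! ### Tails under tempered Gibbs measures -/

section GibbsTails

variable {d ν : ℕ} {β : ℝ} [Fact (0 < β)]

lemma lowerSemicontinuous_holderNorm (σ : ℝ) :
    LowerSemicontinuous fun ω : Loop β ν => holderNorm σ ω := by
  unfold holderNorm
  refine LowerSemicontinuous.add ?_ (lowerSemicontinuous_iSup fun τ =>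
    lowerSemicontinuous_iSup fun τ' => lowerSemicontinuous_iSup fun h => ?_)
  · exact (ENNReal.continuous_ofReal.comp continuous_norm).lowerSemicontinuous
  · have hd : 0 < dist τ τ' ^ σ := Real.rpow_pos_of_pos (dist_pos.2 h) _
    refine Continuous.lowerSemicontinuous ?_
    refine (ENNReal.continuous_div_const _ (ENNReal.ofReal_pos.2 hd).ne').comp
      (ENNReal.continuous_ofReal.comp (continuous_norm.comp ?_))
    exact (continuous_eval_const τ).sub (continuous_eval_const τ')

lemma measurable_holderNorm (σ : ℝ) : Measurable fun ω : Loop β ν => holderNorm σ ω :=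
  (lowerSemicontinuous_holderNorm σ).measurable

/-- The kernel `π_Λ(· | ξ)` on events that concern a single loop in `Λ`. -/
lemma gibbsKernel_site (M : Model d ν) {ε : ℝ} {Λ : Finset (Lattice d)} (l₀ : Λ)
    {S : Set (Loop β ν)} (hS : MeasurableSet S) {ξ : Config d β ν} (hξ : ξ ∈ M.tempered β ε) :
    M.gibbsKernel ε Λ {ω | ω l₀ ∈ S} ξ =
      ∫⁻ ω, S.indicator (fun _ => (1 : ℝ≥0∞)) (ω l₀) ∂(localGibbs M Λ ξ) := by
  rw [Model.gibbsKernel, if_pos hξ,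
    lintegral_localGibbs Λ ξ (f := fun ω => S.indicator (fun _ => (1 : ℝ≥0∞)) (ω l₀))
      ((measurable_const.indicator hS).comp (measurable_pi_apply l₀))]
  congr 1
  refine lintegral_congr fun ω => ?_
  rw [mul_comm]
  congr 1
  have hg : Model.glue Λ ω ξ l₀ = ω l₀ := by simp [Model.glue]
  have hiff : Model.glue Λ ω ξ ∈ {ω : Config d β ν | ω l₀ ∈ S} ↔ ω l₀ ∈ S := by
    rw [Set.mem_ofPred_eq, hg]
  by_cases h : ω l₀ ∈ S
  · rw [Set.indicator_of_mem h, Set.indicator_of_mem (hiff.2 h)]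
  · rw [Set.indicator_of_notMem h, Set.indicator_of_notMem (fun h' => h (hiff.1 h'))]

/-- Gaussian tails of the Hölder norms of the loops, uniform over the sites and over all tempered
Gibbs measures. The bound in finite volume is integrated over the boundary condition, whose
influence disappears as the volume exhausts the lattice. -/
lemma exists_gibbs_tail (hd : 0 < d) (hν : 0 < ν) (M : Model d ν) {σ : ℝ}
    (hσ : σ ∈ Set.Ioo (0 : ℝ) (1 / 2)) :
    ∃ C lam : ℝ, 0 < lam ∧ ∀ ε : ℝ, 0 < ε → ∀ μ ∈ M.temperedGibbs β ε,
      ∀ (l₀ : Lattice d) (R : ℝ), 0 ≤ R →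
        μ {ω | ENNReal.ofReal R < holderNorm σ (ω l₀)} ≤
          ENNReal.ofReal (C * Real.exp (-(lam * R ^ 2))) := by
  obtain ⟨w, W, D, hw, hdom⟩ := exists_isWeight hd M
  obtain ⟨C₁, lam, hC₁, hlam, htail⟩ := freeMeasure_tail (β := β) hν M.m_pos M.a_pos hσ
  have hD := hw.D_nonneg
  -- the coupling of the one-site estimate is chosen small relative to the interaction
  set θ : ℝ := 1 / (2 * (D + 1)) with hθ
  have hθ0 : 0 < θ := by positivity
  have hθD : θ * D ≤ 1 / 2 := by
    rw [hθ, one_div_mul_eq_div, div_le_div_iff₀ (by positivity) (by norm_num)]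
    linarith
  obtain ⟨C', hC'⟩ := exists_oneSiteBound (β := β) hν M hθ0 hD
  set C : ℝ := max C' 0 with hC
  have hC0 : 0 ≤ C := le_max_right _ _
  have hbound : OneSiteBound M β θ D C := fun l H T hH F => by
    refine (hC' l H T hH F).trans ?_
    gcongr
    exact le_max_left _ _
  refine ⟨C₁ * Real.exp (C + C * W), lam, hlam, fun ε hε μ hμ l₀ R hR => ?_⟩
  obtain ⟨hprob, hDLR⟩ := hμ
  set S : Set (Loop β ν) := {y | ENNReal.ofReal R < holderNorm σ y} with hS
  have hSm : MeasurableSet S := measurableSet_lt measurable_const (measurable_holderNorm σ)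
  set K : ℝ := C₁ * Real.exp (C + C * W) * Real.exp (-(lam * R ^ 2)) with hK
  have hK0 : 0 ≤ K := by positivity
  -- on the event `S` the one-site estimate leaves the tail of the free measure
  have hFree : ∫⁻ y, S.indicator (fun _ => (1 : ℝ≥0∞)) y *
      ENNReal.ofReal (Real.exp (-l2Inner y y)) ∂(freeMeasure M.m M.a β ν) ≤
      ENNReal.ofReal (C₁ * Real.exp (-(lam * R ^ 2))) := by
    refine le_trans ?_ (htail R hR)
    rw [← lintegral_indicator_one hSm]
    refine lintegral_mono fun y => ?_
    refine (mul_le_of_le_one_right (zero_le) ?_)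
    rw [← ENNReal.ofReal_one]
    refine ENNReal.ofReal_le_ofReal (Real.exp_le_one_iff.2 ?_)
    exact neg_nonpos.2 (l2Inner_self_nonneg y)
  -- the bound in finite volume
  have hker : ∀ Λ : Finset (Lattice d), l₀ ∈ Λ → ∀ ξ : Config d β ν,
      M.gibbsKernel ε Λ {ω | ω l₀ ∈ S} ξ ≤
        ENNReal.ofReal (min 1 (K * Real.exp (outerWeight w Λ l₀ ξ))) := by
    intro Λ hl ξ
    by_cases hξ : ξ ∈ M.tempered β ε
    · have hξw : ∀ l, Summable fun l' => w l l' * l2Inner (ξ l') (ξ l') :=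
        fun l => hw.summable_of_tempered hdom hε hξ l
      have := isProbabilityMeasure_localGibbs hν hw.J_le Λ (hw.summable_abs_J_mul hξw)
      rw [gibbsKernel_site M ⟨l₀, hl⟩ hSm hξ]
      rcases min_choice 1 (K * Real.exp (outerWeight w Λ l₀ ξ)) with h | h
      · rw [h, ENNReal.ofReal_one]
        have hone : ∀ y, S.indicator (fun _ => (1 : ℝ≥0∞)) y ≤ 1 := fun y =>
          Set.indicator_apply_le' (fun _ => le_rfl) fun _ => zero_le
        exact (lintegral_mono fun ω => hone _).trans (by simp)
      · rw [h]
        refine (lintegral_localGibbs_le hν hw hC0 hθ0.le hθD hbound ⟨l₀, hl⟩ hξw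
          (measurable_const.indicator hSm)).trans ((mul_le_mul_left hFree _).trans (le_of_eq ?_))
        rw [← ENNReal.ofReal_mul (by positivity), hK, Real.exp_add (C + C * W)]
        congr 1
        ring
    · rw [Model.gibbsKernel, if_neg hξ]
      exact zero_le
  obtain ⟨s, hs⟩ := Filter.exists_seq_tendsto (Filter.atTop : Filter (Finset (Lattice d)))
  have hΛ : Filter.Tendsto (fun n => insert l₀ (s n)) Filter.atTop Filter.atTop :=
    Filter.tendsto_atTop_mono (fun n => Finset.subset_insert _ _) hs
  have hle : ∀ n, μ {ω | ω l₀ ∈ S} ≤ ∫⁻ ξ, ENNReal.ofReal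
      (min 1 (K * Real.exp (outerWeight w (insert l₀ (s n)) l₀ ξ))) ∂μ := fun n => by
    rw [← hDLR (insert l₀ (s n)) (Finset.insert_nonempty _ _) {ω | ω l₀ ∈ S}
      (measurable_pi_apply l₀ hSm)]
    exact lintegral_mono fun ξ => hker _ (Finset.mem_insert_self _ _) ξ
  have hlim : Filter.Tendsto (fun n => ∫⁻ ξ, ENNReal.ofReal
      (min 1 (K * Real.exp (outerWeight w (insert l₀ (s n)) l₀ ξ))) ∂μ) Filter.atTop
      (nhds (∫⁻ _ξ, ENNReal.ofReal (min 1 (K * Real.exp 0)) ∂μ)) := by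
    refine tendsto_lintegral_of_dominated_convergence (fun _ => 1) (fun n => ?_)
      (fun n => .of_forall fun ξ => ?_) (by simp) (.of_forall fun ξ => ?_)
    · refine (measurable_const.min (Measurable.const_mul (Real.measurable_exp.comp ?_) K)
        ).ennreal_ofReal
      have hcoord : ∀ l, Measurable fun ξ : Config d β ν => ξ l := fun l => measurable_pi_apply l
      exact Measurable.tsum fun l => (measurable_l2Inner (hcoord l) (hcoord l)).const_mul _
    · rw [← ENNReal.ofReal_one]
      exact ENNReal.ofReal_le_ofReal (min_le_left _ _)
    · -- for non-summable `ξ` the sums over complements are zero by convention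
      have h1 : Filter.Tendsto (fun n => outerWeight w (insert l₀ (s n)) l₀ ξ) Filter.atTop
          (nhds 0) :=
        (tendsto_tsum_compl_atTop_zero fun l => w l₀ l * l2Inner (ξ l) (ξ l)).comp hΛ
      have h2 : Continuous fun t : ℝ => ENNReal.ofReal (min 1 (K * Real.exp t)) :=
        ENNReal.continuous_ofReal.comp
          (continuous_const.min (continuous_const.mul Real.continuous_exp))
      exact (h2.tendsto 0).comp h1
  refine (ge_of_tendsto' hlim hle).trans ?_
  rw [lintegral_const, measure_univ, mul_one, Real.exp_zero, mul_one]
  exact ENNReal.ofReal_le_ofReal (min_le_right _ _)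

lemma measurableSet_lebowitzPresutti (b σ : ℝ) :
    MeasurableSet (lebowitzPresutti d β ν b σ) := by
  have h : lebowitzPresutti d β ν b σ = ⋂ l₀ : Lattice d, ⋃ Λ : Finset (Lattice d),
      ⋂ l : Lattice d, ⋂ _ : l ∉ Λ, {ξ : Config d β ν |
        holderNorm σ (ξ l) ^ 2 ≤ ENNReal.ofReal (b * Real.log (1 + latDist l l₀))} := by
    ext ξ
    simp [lebowitzPresutti]
  rw [h]
  refine MeasurableSet.iInter fun l₀ => MeasurableSet.iUnion fun Λ => MeasurableSet.iInter fun l =>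
    MeasurableSet.iInter fun _ => ?_
  exact measurableSet_le (((measurable_holderNorm σ).comp (measurable_pi_apply l)).pow_const 2)
    measurable_const

/-- The Borel–Cantelli argument: uniform Gaussian tails of the Hölder norms imply the logarithmic
growth bound. -/
lemma measure_lebowitzPresutti_eq_one (hd : 0 < d) {μ : Measure (Config d β ν)}
    [IsProbabilityMeasure μ] {σ C lam : ℝ} (hlam : 0 < lam)
    (h : ∀ (l₀ : Lattice d) (R : ℝ), 0 ≤ R →
      μ {ω | ENNReal.ofReal R < holderNorm σ (ω l₀)} ≤
        ENNReal.ofReal (C * Real.exp (-(lam * R ^ 2)))) :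
    μ (lebowitzPresutti d β ν ((d + 1) / lam) σ) = 1 := by
  set b : ℝ := (d + 1) / lam with hb
  have hb0 : 0 < b := by positivity
  have hlog : ∀ l l₀ : Lattice d, 0 ≤ b * Real.log (1 + latDist l l₀) := fun l l₀ =>
    mul_nonneg hb0.le (Real.log_nonneg (by linarith [latDist_nonneg l l₀]))
  rw [← prob_compl_eq_zero_iff (measurableSet_lebowitzPresutti b σ)]
  have hae : ∀ᵐ ξ ∂μ, ∀ l₀ : Lattice d, {l : Lattice d | ξ ∈ {ω : Config d β ν |
      ENNReal.ofReal (Real.sqrt (b * Real.log (1 + latDist l l₀))) <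
        holderNorm σ (ω l)}}.Finite := by
    rw [ae_all_iff]
    intro l₀
    refine ae_finite_setOfPred_mem ?_
    obtain ⟨W, hW⟩ := exists_sum_one_add_latDist_rpow_le hd (p := (d : ℝ) + 1) (by linarith)
    have hsum : Summable fun l => C * (1 + latDist l₀ l) ^ (-((d : ℝ) + 1)) :=
      (summable_of_sum_le (fun l => by
        have := latDist_nonneg l₀ l
        positivity) (hW l₀)).mul_left C
    refine ne_top_of_le_ne_top hsum.tsum_ofReal_ne_top (ENNReal.tsum_le_tsum fun l => ?_)
    refine (h l _ (Real.sqrt_nonneg _)).trans (le_of_eq ?_)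
    have hpos : 0 < 1 + latDist l₀ l := by linarith [latDist_nonneg l₀ l]
    rw [Real.sq_sqrt (hlog l l₀), latDist_comm l l₀, Real.rpow_def_of_pos hpos]
    congr 3
    rw [hb]
    field_simp
  refine measure_mono_null ?_ (ae_iff.1 hae)
  intro ξ hξ hfin
  refine hξ fun l₀ => ⟨(hfin l₀).toFinset, fun l hl => ?_⟩
  have hl' : holderNorm σ (ξ l) ≤
      ENNReal.ofReal (Real.sqrt (b * Real.log (1 + latDist l l₀))) := by
    by_contra hcon
    exact hl ((hfin l₀).mem_toFinset.2 (not_le.1 hcon))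
  calc holderNorm σ (ξ l) ^ 2 ≤
        ENNReal.ofReal (Real.sqrt (b * Real.log (1 + latDist l l₀))) ^ 2 := by gcongr
    _ = _ := by rw [← ENNReal.ofReal_pow (Real.sqrt_nonneg _), Real.sq_sqrt (hlog l l₀)]

end GibbsTails

end QuantumCrystal

theorem theorem3p3 (d ν : ℕ) (hd : 0 < d) (hν : 0 < ν) (β : ℝ) [Fact (0 < β)]
    (M : QuantumCrystal.Model d ν) (σ : ℝ) (hσ : σ ∈ Set.Ioo (0 : ℝ) (1 / 2)) :
    ∃ b : ℝ, 0 < b ∧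
      MeasurableSet (QuantumCrystal.lebowitzPresutti d β ν b σ) ∧
      ∀ ε : ℝ, 0 < ε → ∀ μ ∈ M.temperedGibbs β ε,
        μ (QuantumCrystal.lebowitzPresutti d β ν b σ) = 1 := by
  obtain ⟨C, lam, hlam, h⟩ := QuantumCrystal.exists_gibbs_tail (β := β) hd hν M hσ
  -- with this `b` the tail at distance `r` is of order `(1 + r) ^ (-(d + 1))`
  refine ⟨(d + 1) / lam, by positivity, QuantumCrystal.measurableSet_lebowitzPresutti _ _,
    fun ε hε μ hμ => ?_⟩
  have := hμ.1
  exact QuantumCrystal.measure_lebowitzPresutti_eq_one hd hlam fun l₀ R hR =>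
    h ε hε μ hμ l₀ R hR
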